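/- Let $M(x,t)$ be a complex-valued function integrable on the triangle $0\le t\le x\le\pi$, known a priori. For a complex-valued function $q$ that is analytic on $[0,\pi]$ (real-analytic in a neighbourhood of each point of $[0,\pi]$) and $\lambda\in\mathbb C$ consider $$-y''(x)+q(x)y(x)+\int_0^x M(x,t)y(t)\,dt=\lambda y(x),\qquad x\in[0,\pi], \tag{1}$$ where solutions have an absolutely continuous derivative and satisfy (1) almost everywhere. Let $C(x,\lambda)$, $S(x,\lambda)$ be the solutions with $C(0,\lambda)=S'(0,\lambda)=1$, $C'(0,\lambda)=S(0,\lambda)=0$, and put $\Delta_1(\lambda)=S(\pi,\lambda)$, $\Delta_2(\lambda)=C(\pi,\lambda)$, $N(\lambda)=-\Delta_2(\lambda)/\Delta_1(\lambda)$ (the Weyl-type function). Let $L_k$ ($k=1,2$) be the boundary value problem for (1) with $y^{(k-1)}(0)=y(\pi)=0$. For $\delta\in(0,\pi/2)$ let $Q_\delta=\{\rho\in\mathbb C:\arg\rho\in[\delta,\pi-\delta]\}$. Objects belonging to another analytic potential $\tilde q$ with the same $M$ carry a tilde. Then the following holds. (a) For every $\lambda$ the functions $C$ and $S$ exist, and every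 solution of (1) is $y=y(0)C+y'(0)S$ on $[0,\pi]$. The functions $\Delta_1,\Delta_2$ are entire, and the zeros of $\Delta_k$ are exactly the eigenvalues of $L_k$. For every $\delta\in(0,\pi/2)$, $\Delta_1(\rho^2)\neq0$ for all $\rho\in Q_\delta$ with $|\rho|$ large enough. If $\Delta_1(\lambda)\ne0$, then (1) has a solution $\Phi$ with $\Phi(0)=1$, $\Phi(\pi)=0$, and every such solution has $\Phi'(0)=N(\lambda)$. (b) Uniqueness. Let $q,\tilde q$ be analytic on $[0,\pi]$. Then $N(\lambda)=\tilde N(\lambda)$ for all $\lambda$ with $\Delta_1(\lambda)\ne0\neq\tilde\Delta_1(\lambda)$ if and only if $q=\tilde q$ on $[0,\pi]$. Likewise, the spectra of $L_1$ and $\tilde L_1$ coincide and the spectra of $L_2$ and $\tilde L_2$ coincide, eigenvalues being counted with their multiplicity as zeros of the characteristic functions $\Delta_k$, $\tilde\Delta_k$, if and only if $q=\tilde q$ on $[0,\pi]$. (c) Reconstruction. Let $q$ be analytic on $[0,\pi]$, $q_k=q^{(k)}(0)$, and $\delta\in(0,\pi/2)$. For every $k\ge0$ and every $\tilde q$ analytic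 on $[0,\pi]$ with $\tilde q^{(j)}(0)=q_j$ for $0\le j<k$, $$q_k-\tilde q^{(k)}(0)=-\lim_{|\rho|\to\infty,\ \rho\in Q_\delta}(-2i\rho)^{k+1}\bigl(N(\rho^2)-\tilde N(\rho^2)\bigr). \tag{12}$$ Consequently $q$ is recovered from $N$ as follows. (i) Compute numbers $c_0,c_1,\dots$ one after another: at stage $k$ take an analytic model potential $\tilde q$ on $[0,\pi]$ with $\tilde q^{(j)}(0)=c_j$ for $j<k$, and define $c_k$ by (12) with $c_k$ in place of $q_k$. This can be carried out, and whatever models are taken, $c_k=q_k$ for all $k$. (ii) Let $R=\bigl(\limsup_{k\to\infty}(|c_k|/k!)^{1/k}\bigr)^{-1}\in[0,\infty]$. Then $R>0$, and $$q(x)=\sum_{k=0}^\infty c_k\frac{x^k}{k!}\qquad\text{for }0<x<R,\ x\le\pi,$$ and $q$ is on all of $[0,\pi]$ the analytic continuation of this sum: every function analytic on $[0,\pi]$ that equals the sum for $0<x<R$, $x\le\pi$, coincides with $q$ on $[0,\pi]$. -/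

import Mathlib

open Set Filter Topology MeasureTheory

namespace IntegroDiff

noncomputable section

/-- The closed triangle `0 ≤ t ≤ x ≤ π` (points are pairs `(x, t)`), the domain of the kernel. -/
def triangle : Set (ℝ × ℝ) := {p | 0 ≤ p.2 ∧ p.2 ≤ p.1 ∧ p.1 ≤ Real.pi}

/-- The derivative `y'` of a function on `[0, π]`, one-sided at the end points. -/
def der (y : ℝ → ℂ) (x : ℝ) : ℂ := derivWithin y (Icc 0 Real.pi) x

/-- `y` is a (Carathéodory) solution on `[0, π]` of
`-y''(x) + q(x) y(x) + ∫₀ˣ M(x,t) y(t) dt = lam * y(x)`: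
`y` is differentiable on `[0, π]` and `y'` is absolutely continuous with
`y''(x) = (q(x) - lam) y(x) + ∫₀ˣ M(x,t) y(t) dt` for almost every `x`,
that is, `y'` is the indefinite integral of the right-hand side. -/
def IsSolution (M : ℝ → ℝ → ℂ) (q : ℝ → ℂ) (lam : ℂ) (y : ℝ → ℂ) : Prop :=
  DifferentiableOn ℝ y (Icc 0 Real.pi) ∧
  IntervalIntegrable
    (fun s => (q s - lam) * y s + ∫ t in (0 : ℝ)..s, M s t * y t) volume 0 Real.pi ∧
  ∀ x ∈ Icc (0 : ℝ) Real.pi,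
    der y x = der y 0 +
      ∫ s in (0 : ℝ)..x, ((q s - lam) * y s + ∫ t in (0 : ℝ)..s, M s t * y t)

/-- The solution with `y(0) = a`, `y'(0) = b` (a chosen one; it is unique on `[0, π]`). -/
def cauchySol (M : ℝ → ℝ → ℂ) (q : ℝ → ℂ) (a b lam : ℂ) : ℝ → ℂ :=
  Classical.epsilon fun y => IsSolution M q lam y ∧ y 0 = a ∧ der y 0 = b

/-- `C(x, lam)`, as a function of `x`: `C(0) = 1`, `C'(0) = 0`. -/
def solC (M : ℝ → ℝ → ℂ) (q : ℝ → ℂ) (lam : ℂ) : ℝ → ℂ := cauchySol M q 1 0 lam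

/-- `S(x, lam)`, as a function of `x`: `S(0) = 0`, `S'(0) = 1`. -/
def solS (M : ℝ → ℝ → ℂ) (q : ℝ → ℂ) (lam : ℂ) : ℝ → ℂ := cauchySol M q 0 1 lam

/-- `Δ₁(lam) = S(π, lam)`, the characteristic function of `L₁`. -/
def Delta1 (M : ℝ → ℝ → ℂ) (q : ℝ → ℂ) (lam : ℂ) : ℂ := solS M q lam Real.pi

/-- `Δ₂(lam) = C(π, lam)`, the characteristic function of `L₂`. -/
def Delta2 (M : ℝ → ℝ → ℂ) (q : ℝ → ℂ) (lam : ℂ) : ℂ := solC M q lam Real.pi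

/-- The Weyl-type function `N = -Δ₂ / Δ₁` (meaningful where `Δ₁ ≠ 0`). -/
def weylN (M : ℝ → ℝ → ℂ) (q : ℝ → ℂ) (lam : ℂ) : ℂ := -(Delta2 M q lam) / Delta1 M q lam

/-- `lam` is an eigenvalue of `L₁`: boundary conditions `y(0) = y(π) = 0`. -/
def IsEigenvalue1 (M : ℝ → ℝ → ℂ) (q : ℝ → ℂ) (lam : ℂ) : Prop :=
  ∃ y, IsSolution M q lam y ∧ y 0 = 0 ∧ y Real.pi = 0 ∧ ∃ x ∈ Icc (0 : ℝ) Real.pi, y x ≠ 0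

/-- `lam` is an eigenvalue of `L₂`: boundary conditions `y'(0) = y(π) = 0`. -/
def IsEigenvalue2 (M : ℝ → ℝ → ℂ) (q : ℝ → ℂ) (lam : ℂ) : Prop :=
  ∃ y, IsSolution M q lam y ∧ der y 0 = 0 ∧ y Real.pi = 0 ∧ ∃ x ∈ Icc (0 : ℝ) Real.pi, y x ≠ 0

/-- The spectrum of `L₁` counted with multiplicity, as a multiplicity function:
the order of `lam` as a zero of `Δ₁` (zero if `lam` is not an eigenvalue). -/
def spectrum1 (M : ℝ → ℝ → ℂ) (q : ℝ → ℂ) (lam : ℂ) : ℕ∞ := analyticOrderAt (Delta1 M q) lam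

/-- The spectrum of `L₂` counted with multiplicity, as a multiplicity function. -/
def spectrum2 (M : ℝ → ℝ → ℂ) (q : ℝ → ℂ) (lam : ℂ) : ℕ∞ := analyticOrderAt (Delta2 M q) lam

/-- `|ρ| → ∞` inside the sector `δ ≤ arg ρ ≤ π - δ`. -/
def sectorInfty (δ : ℝ) : Filter ℂ :=
  Bornology.cobounded ℂ ⊓ 𝓟 {ρ : ℂ | δ ≤ ρ.arg ∧ ρ.arg ≤ Real.pi - δ}

/-- A run of step (i) of the algorithm on the input `N` (the kernel `M` being known):
at stage `k` an analytic model potential `m k` is taken whose Taylor coefficients at `0` of order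
`< k` are the numbers `c 0, …, c (k - 1)` found so far, and `c k` is computed from
`c k - (m k)⁽ᵏ⁾(0) = - lim (-2iρ)ᵏ⁺¹ (N(ρ²) - N_{m k}(ρ²))`. -/
structure IsRun (M : ℝ → ℝ → ℂ) (N : ℂ → ℂ) (δ : ℝ) (m : ℕ → ℝ → ℂ) (c : ℕ → ℂ) : Prop where
  analytic : ∀ k, AnalyticOnNhd ℝ (m k) (Icc 0 Real.pi)
  agree : ∀ k, ∀ j < k, iteratedDeriv j (m k) 0 = c j
  step : ∀ k, Tendsto
    (fun ρ : ℂ => -((-2 * Complex.I * ρ) ^ (k + 1) * (N (ρ ^ 2) - weylN M (m k) (ρ ^ 2))))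
    (sectorInfty δ) (𝓝 (c k - iteratedDeriv k (m k) 0))

/-- `R = (limsup (|c k| / k!)^(1/k))⁻¹`, with values in `[0, ∞]`. -/
def taylorRadius (c : ℕ → ℂ) : ENNReal :=
  (limsup (fun k : ℕ => ENNReal.ofReal ((‖c k‖ / (k.factorial : ℝ)) ^ (1 / (k : ℝ)))) atTop)⁻¹

/-- On the part `0 < x < R`, `x ≤ π`, the function `g` is the sum of the power series
`∑ c k * x ^ k / k!`. -/
def IsTaylorSum (c : ℕ → ℂ) (g : ℝ → ℂ) : Prop :=
  ∀ x : ℝ, 0 < x → x ≤ Real.pi → ENNReal.ofReal x < taylorRadius c →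
    HasSum (fun k : ℕ => c k * (x : ℂ) ^ k / (k.factorial : ℂ)) (g x)

end

end IntegroDiff

namespace IntegroDiff

/-! Write λ = ρ². Everything rests on one exact formula for N - Ñ. The adjoint of the memory
integral runs over [t, π], and the reflection x ↦ π - x turns the adjoint equation into one of the
original type, with kernel M(π - t, π - x), again integrable on the triangle. Let Φ be the solution
for q with Φ(0) = 1, Φ(π) = 0, and let w be the S-solution of the reflected equation for q̃.
Lagrange's identity (`IsSolution.lagrange`) then gives N - Ñ = -∫₀^π (q - q̃)(x) Φ(x) w(π - x)/w(π)
dx, which is `weylN_sub_weylN`.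

For Im ρ large, both Φ(x) and w(π - x)/w(π) are e^{iρx} up to O(1/Im ρ)
(`IsSolution.norm_weylSolution_sub_le`, `norm_solS_div_sub_le`), so their product acts like
e^{2iρx}. If q - q̃ has leading Taylor term b x^k at 0, a Watson-type argument replaces the integral
by b k!/(-2iρ)^{k+1}; this is formula (12), `tendsto_weylN_sub`. A delicate point is that the memory
may keep Φ from decaying in x, so its error is only bounded uniformly. The reflected factor does
have exponentially decaying errors, and one decaying factor is enough (`norm_mul_sub_mul_le`).

Equality of the Weyl-type functions thus forces equality of all Taylor coefficients at 0 by
induction, and analyticity carries the equality over [0, π]. The same formula shows that every run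
of the algorithm computes the Taylor coefficients of q. For the two spectra, each Δ_k is recovered
from its zeros: the quotient of two candidates is entire and zero-free, is bounded on large squares
in the ρ-plane by comparison with sin ρπ or cos ρπ, hence is constant by Liouville, and the
asymptotics on the imaginary axis make the constant 1 (`eq_of_isSineType`).

Existence, uniqueness and entire dependence on λ come from inverting 1 - T for a Volterra operator T
which is affine in λ (`isUnit_one_sub_volterra`, `volterra_sub_const`). -/

/-- The function `q y + ∫₀ˢ M(s,t) y(t) dt`. -/
noncomputable def force (M : ℝ → ℝ → ℂ) (q y : ℝ → ℂ) (s : ℝ) : ℂ :=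
  q s * y s + ∫ t in (0 : ℝ)..s, M s t * y t

/-- The total mass of a row of the kernel. -/
noncomputable def rowMass (M : ℝ → ℝ → ℂ) (s : ℝ) : ℝ := ∫ t in (0 : ℝ)..s, ‖M s t‖

/-- The total mass of the potential and the kernel. -/
noncomputable def totalMass (M : ℝ → ℝ → ℂ) (q : ℝ → ℂ) : ℝ :=
  ∫ s in (0 : ℝ)..Real.pi, (‖q s‖ + rowMass M s)

/-! ### Fubini on the triangle and bounds for the perturbation term. -/

lemma isClosed_triangle : IsClosed triangle := by
  have h : triangle = {p : ℝ × ℝ | 0 ≤ p.2} ∩ {p : ℝ × ℝ | p.2 ≤ p.1} ∩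
      {p : ℝ × ℝ | p.1 ≤ Real.pi} := by
    ext p; simp [triangle, and_assoc]
  rw [h]
  exact ((isClosed_le (by fun_prop) (by fun_prop)).inter
    (isClosed_le (by fun_prop) (by fun_prop))).inter (isClosed_le (by fun_prop) (by fun_prop))

lemma isCompact_triangle : IsCompact triangle := by
  refine (isCompact_Icc (a := ((0 : ℝ), (0 : ℝ))) (b := (Real.pi, Real.pi))).of_isClosed_subset
    isClosed_triangle ?_
  rintro ⟨x, t⟩ ⟨h1, h2, h3⟩
  simp only [mem_Icc, Prod.mk_le_mk] at *
  exact ⟨⟨h1.trans h2, h1⟩, h3, h2.trans h3⟩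

section Fubini

variable {E : Type*} [NormedAddCommGroup E] {G : ℝ → ℝ → E}

lemma integrable_indicator_triangle
    (hG : IntegrableOn (fun p : ℝ × ℝ => G p.1 p.2) triangle) :
    Integrable (triangle.indicator fun p : ℝ × ℝ => G p.1 p.2) (volume.prod volume) :=
  (integrable_indicator_iff isClosed_triangle.measurableSet).2 hG

lemma indicator_triangle_row {s : ℝ} (hs : s ∈ Icc (0 : ℝ) Real.pi) :
    (fun t => triangle.indicator (fun p : ℝ × ℝ => G p.1 p.2) (s, t)) =
      (Icc 0 s).indicator (G s) := by
  ext t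
  by_cases h : t ∈ Icc 0 s
  · rw [indicator_of_mem h, indicator_of_mem (show (s, t) ∈ triangle from ⟨h.1, h.2, hs.2⟩)]
  · rw [indicator_of_notMem h, indicator_of_notMem fun h' => h ⟨h'.1, h'.2.1⟩]

lemma indicator_triangle_col {t : ℝ} (ht : t ∈ Icc (0 : ℝ) Real.pi) :
    (fun s => triangle.indicator (fun p : ℝ × ℝ => G p.1 p.2) (s, t)) =
      (Icc t Real.pi).indicator (fun s => G s t) := by
  ext s
  by_cases h : s ∈ Icc t Real.pi
  · rw [indicator_of_mem h, indicator_of_mem (show (s, t) ∈ triangle from ⟨ht.1, h.1, h.2⟩)]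
  · rw [indicator_of_notMem h, indicator_of_notMem fun h' => h ⟨h'.2.1, h'.2.2⟩]

lemma ae_intervalIntegrable_row (hG : IntegrableOn (fun p : ℝ × ℝ => G p.1 p.2) triangle) :
    ∀ᵐ s, s ∈ Icc (0 : ℝ) Real.pi → IntervalIntegrable (G s) volume 0 s := by
  filter_upwards [(integrable_indicator_triangle hG).prod_right_ae] with s h hs
  rw [indicator_triangle_row hs, integrable_indicator_iff measurableSet_Icc] at h
  exact (intervalIntegrable_iff_integrableOn_Icc_of_le hs.1).2 h

variable [NormedSpace ℝ E]

lemma integral_indicator_triangle_row (s : ℝ) :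
    ∫ t, triangle.indicator (fun p : ℝ × ℝ => G p.1 p.2) (s, t) =
      (Icc 0 Real.pi).indicator (fun s => ∫ t in (0 : ℝ)..s, G s t) s := by
  by_cases hs : s ∈ Icc (0 : ℝ) Real.pi
  · rw [indicator_triangle_row hs, indicator_of_mem hs, integral_indicator measurableSet_Icc,
      integral_Icc_eq_integral_Ioc, intervalIntegral.integral_of_le hs.1]
  · rw [indicator_of_notMem hs]
    refine integral_eq_zero_of_ae (Eventually.of_forall fun t => ?_)
    exact indicator_of_notMem (fun h => hs ⟨h.1.trans h.2.1, h.2.2⟩) _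

lemma integral_indicator_triangle_col (t : ℝ) :
    ∫ s, triangle.indicator (fun p : ℝ × ℝ => G p.1 p.2) (s, t) =
      (Icc 0 Real.pi).indicator (fun t => ∫ s in t..Real.pi, G s t) t := by
  by_cases ht : t ∈ Icc (0 : ℝ) Real.pi
  · rw [indicator_triangle_col ht, indicator_of_mem ht, integral_indicator measurableSet_Icc,
      integral_Icc_eq_integral_Ioc, intervalIntegral.integral_of_le ht.2]
  · rw [indicator_of_notMem ht]
    refine integral_eq_zero_of_ae (Eventually.of_forall fun t => ?_)
    exact indicator_of_notMem (fun h => ht ⟨h.1, h.2.1.trans h.2.2⟩) _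

lemma intervalIntegrable_integral_row
    (hG : IntegrableOn (fun p : ℝ × ℝ => G p.1 p.2) triangle) :
    IntervalIntegrable (fun s => ∫ t in (0 : ℝ)..s, G s t) volume 0 Real.pi := by
  have h := (integrable_indicator_triangle hG).integral_prod_left
  simp_rw [integral_indicator_triangle_row] at h
  rw [intervalIntegrable_iff_integrableOn_Icc_of_le Real.pi_pos.le]
  exact (integrable_indicator_iff measurableSet_Icc).1 h

lemma integral_triangle_swap (hG : IntegrableOn (fun p : ℝ × ℝ => G p.1 p.2) triangle) :
    ∫ s in (0 : ℝ)..Real.pi, ∫ t in (0 : ℝ)..s, G s t =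
      ∫ t in (0 : ℝ)..Real.pi, ∫ s in t..Real.pi, G s t := by
  have h := integral_integral_swap (f := fun s t =>
    triangle.indicator (fun p : ℝ × ℝ => G p.1 p.2) (s, t)) (integrable_indicator_triangle hG)
  simp_rw [integral_indicator_triangle_row, integral_indicator_triangle_col] at h
  simpa only [integral_indicator measurableSet_Icc, integral_Icc_eq_integral_Ioc,
    ← intervalIntegral.integral_of_le Real.pi_pos.le] using h

end Fubini

variable {M : ℝ → ℝ → ℂ} {q y : ℝ → ℂ}

lemma integrableOn_mul_triangle (hM : IntegrableOn (fun p : ℝ × ℝ => M p.1 p.2) triangle)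
    {f : ℝ → ℝ → ℂ} (hf : ContinuousOn (fun p : ℝ × ℝ => f p.1 p.2) triangle) :
    IntegrableOn (fun p : ℝ × ℝ => (fun s t => M s t * f s t) p.1 p.2) triangle :=
  hM.mul_continuousOn hf isCompact_triangle

lemma continuousOn_snd_triangle (hy : ContinuousOn y (Icc 0 Real.pi)) :
    ContinuousOn (fun p : ℝ × ℝ => (fun _ t => y t) p.1 p.2) triangle :=
  hy.comp continuousOn_snd fun _ h => ⟨h.1, h.2.1.trans h.2.2⟩

lemma continuousOn_fst_triangle (hy : ContinuousOn y (Icc 0 Real.pi)) :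
    ContinuousOn (fun p : ℝ × ℝ => (fun s _ => y s) p.1 p.2) triangle :=
  hy.comp continuousOn_fst fun _ h => ⟨h.1.trans h.2.1, h.2.2⟩

lemma intervalIntegrable_of_continuousOn (hy : ContinuousOn y (Icc 0 Real.pi)) :
    IntervalIntegrable y volume 0 Real.pi :=
  (hy.mono (uIcc_of_le Real.pi_pos.le).subset).intervalIntegrable

lemma intervalIntegrable_rowMass (hM : IntegrableOn (fun p : ℝ × ℝ => M p.1 p.2) triangle) :
    IntervalIntegrable (rowMass M) volume 0 Real.pi :=
  intervalIntegrable_integral_row (G := fun s t => ‖M s t‖) hM.norm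

lemma intervalIntegrable_mass (hM : IntegrableOn (fun p : ℝ × ℝ => M p.1 p.2) triangle)
    (hq : ContinuousOn q (Icc 0 Real.pi)) :
    IntervalIntegrable (fun s => ‖q s‖ + rowMass M s) volume 0 Real.pi :=
  (intervalIntegrable_of_continuousOn hq).norm.add (intervalIntegrable_rowMass hM)

lemma rowMass_nonneg {s : ℝ} (hs : 0 ≤ s) : 0 ≤ rowMass M s :=
  intervalIntegral.integral_nonneg hs fun _ _ => norm_nonneg _

lemma totalMass_nonneg : 0 ≤ totalMass M q :=
  intervalIntegral.integral_nonneg Real.pi_pos.le fun _ h =>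
    add_nonneg (norm_nonneg _) (rowMass_nonneg h.1)

lemma ae_row_mul (hM : IntegrableOn (fun p : ℝ × ℝ => M p.1 p.2) triangle)
    (hy : ContinuousOn y (Icc 0 Real.pi)) :
    ∀ᵐ s, s ∈ Icc (0 : ℝ) Real.pi → IntervalIntegrable (fun t => M s t * y t) volume 0 s :=
  ae_intervalIntegrable_row (integrableOn_mul_triangle hM (f := fun _ t => y t) (continuousOn_snd_triangle hy))

lemma intervalIntegrable_memory (hM : IntegrableOn (fun p : ℝ × ℝ => M p.1 p.2) triangle)
    (hy : ContinuousOn y (Icc 0 Real.pi)) :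
    IntervalIntegrable (fun s => ∫ t in (0 : ℝ)..s, M s t * y t) volume 0 Real.pi :=
  intervalIntegrable_integral_row (integrableOn_mul_triangle hM (f := fun _ t => y t) (continuousOn_snd_triangle hy))

lemma intervalIntegrable_force (hM : IntegrableOn (fun p : ℝ × ℝ => M p.1 p.2) triangle)
    (hq : ContinuousOn q (Icc 0 Real.pi)) (hy : ContinuousOn y (Icc 0 Real.pi)) :
    IntervalIntegrable (force M q y) volume 0 Real.pi :=
  (intervalIntegrable_of_continuousOn (hq.mul hy)).add (intervalIntegrable_memory hM hy)

lemma intervalIntegrable_sub_interval {f : ℝ → ℂ} (hf : IntervalIntegrable f volume 0 Real.pi)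
    {a b : ℝ} (ha : a ∈ Icc (0 : ℝ) Real.pi) (hb : b ∈ Icc (0 : ℝ) Real.pi) :
    IntervalIntegrable f volume a b :=
  hf.mono_set (by rw [uIcc_of_le Real.pi_pos.le]; exact uIcc_subset_Icc ha hb)

/-- An increasing weight passes through the memory integral, since its value at t ≤ s is dominated
by its value at s. This is why α ≥ 0 is required. The bound is only almost everywhere because single
rows of the kernel need not be integrable. -/
lemma ae_norm_force_le (hM : IntegrableOn (fun p : ℝ × ℝ => M p.1 p.2) triangle)
    {Y α : ℝ} (hα : 0 ≤ α)
    (hY : ∀ t ∈ Icc (0 : ℝ) Real.pi, ‖y t‖ ≤ Y * Real.exp (α * t)) :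
    ∀ᵐ s, s ∈ Icc (0 : ℝ) Real.pi →
      ‖force M q y s‖ ≤ (‖q s‖ + rowMass M s) * (Y * Real.exp (α * s)) := by
  filter_upwards [ae_intervalIntegrable_row hM] with s h hs
  have hY0 : 0 ≤ Y := by
    have := (norm_nonneg _).trans (hY s hs)
    exact nonneg_of_mul_nonneg_left this (Real.exp_pos _)
  rw [force, add_mul]
  refine (norm_add_le _ _).trans (add_le_add ?_ ?_)
  · rw [norm_mul]
    gcongr
    exact hY s hs
  · rw [rowMass, ← intervalIntegral.integral_mul_const]
    refine intervalIntegral.norm_integral_le_of_norm_le hs.1 (Eventually.of_forall fun t ht => ?_)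
      ((h hs).norm.mul_const _)
    rw [norm_mul]
    gcongr
    refine (hY t ⟨ht.1.le, ht.2.trans hs.2⟩).trans ?_
    gcongr
    exact ht.2

/-- The single source of all later estimates. The test function v has to compensate the growth of
the weight, and the remaining mass is at most the total L¹ mass. -/
lemma norm_integral_force_mul_le (hM : IntegrableOn (fun p : ℝ × ℝ => M p.1 p.2) triangle)
    (hq : ContinuousOn q (Icc 0 Real.pi)) {Y α B a b : ℝ} {v : ℝ → ℂ} (hα : 0 ≤ α)
    (hY : ∀ t ∈ Icc (0 : ℝ) Real.pi, ‖y t‖ ≤ Y * Real.exp (α * t))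
    (ha : 0 ≤ a) (hab : a ≤ b) (hb : b ≤ Real.pi) (hB : 0 ≤ B)
    (hv : ∀ s ∈ Icc a b, Real.exp (α * s) * ‖v s‖ ≤ B) :
    ‖∫ s in a..b, force M q y s * v s‖ ≤ totalMass M q * Y * B := by
  have hY0 : 0 ≤ Y := by
    have := (norm_nonneg _).trans (hY 0 ⟨le_rfl, Real.pi_pos.le⟩)
    simpa using this
  have hint := intervalIntegrable_mass hM hq
  have hsub : uIcc a b ⊆ uIcc 0 Real.pi := by
    rw [uIcc_of_le hab, uIcc_of_le Real.pi_pos.le]; exact Icc_subset_Icc ha hb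
  calc ‖∫ s in a..b, force M q y s * v s‖
      ≤ ∫ s in a..b, (‖q s‖ + rowMass M s) * (Y * B) := by
        refine intervalIntegral.norm_integral_le_of_norm_le hab ?_
          ((hint.mono_set hsub).mul_const _)
        filter_upwards [ae_norm_force_le (q := q) hM hα hY] with s h hs
        have hs' : s ∈ Icc (0 : ℝ) Real.pi := ⟨ha.trans hs.1.le, hs.2.trans hb⟩
        have hm : 0 ≤ ‖q s‖ + rowMass M s := add_nonneg (norm_nonneg _) (rowMass_nonneg hs'.1)
        rw [norm_mul]
        calc _ ≤ (‖q s‖ + rowMass M s) * (Y * Real.exp (α * s)) * ‖v s‖ := by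
              gcongr; exact h hs'
          _ = (‖q s‖ + rowMass M s) * Y * (Real.exp (α * s) * ‖v s‖) := by ring
          _ ≤ (‖q s‖ + rowMass M s) * Y * B := by
              gcongr; exact hv s ⟨hs.1.le, hs.2⟩
          _ = _ := by ring
    _ = (∫ s in a..b, (‖q s‖ + rowMass M s)) * (Y * B) :=
        intervalIntegral.integral_mul_const _ _
    _ ≤ totalMass M q * (Y * B) := by
        gcongr
        refine intervalIntegral.integral_mono_interval ha hab hb ?_ hint
        refine (ae_restrict_iff' measurableSet_Ioc).2 (Eventually.of_forall fun s hs => ?_)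
        exact add_nonneg (norm_nonneg _) (rowMass_nonneg hs.1.le)
    _ = _ := by ring

/-! ### Absolute continuity and integration by parts. -/

lemma absolutelyContinuousOnInterval_ofReal {f : ℝ → ℝ} {a b : ℝ}
    (hf : AbsolutelyContinuousOnInterval f a b) :
    AbsolutelyContinuousOnInterval (fun x => (f x : ℂ)) a b := by
  simpa only [AbsolutelyContinuousOnInterval, Complex.isometry_ofReal.dist_eq] using hf

lemma absolutelyContinuousOnInterval_const (c : ℂ) (a b : ℝ) :
    AbsolutelyContinuousOnInterval (fun _ : ℝ => c) a b :=
  LipschitzOnWith.absolutelyContinuousOnInterval (K := 0)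
    (LipschitzWith.const c).lipschitzOnWith

/-- The real and imaginary parts are integrated separately and recombined; the result is identified
with the complex primitive only on the interval, which suffices. -/
lemma absolutelyContinuousOnInterval_primitive {u' : ℝ → ℂ} {a b : ℝ}
    (hu' : IntervalIntegrable u' volume a b) :
    ∃ U : ℝ → ℂ, AbsolutelyContinuousOnInterval U a b ∧
      ∀ x ∈ uIcc a b, U x = ∫ s in a..x, u' s := by
  have hre : IntervalIntegrable (fun s => (u' s).re) volume a b := ⟨hu'.1.re, hu'.2.re⟩
  have him : IntervalIntegrable (fun s => (u' s).im) volume a b := ⟨hu'.1.im, hu'.2.im⟩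
  have h1 := absolutelyContinuousOnInterval_ofReal
    (hre.absolutelyContinuousOnInterval_intervalIntegral (c := a) left_mem_uIcc)
  have h2 := absolutelyContinuousOnInterval_ofReal
    (him.absolutelyContinuousOnInterval_intervalIntegral (c := a) left_mem_uIcc)
  have h3 := h1.fun_add ((absolutelyContinuousOnInterval_const Complex.I a b).fun_smul h2)
  refine ⟨_, h3, fun x hx => ?_⟩
  have hx' : uIcc a x ⊆ uIcc a b := uIcc_subset_uIcc_left hx
  have i1 : IntervalIntegrable (fun s => ((u' s).re : ℂ)) volume a x :=
    ⟨(hre.mono_set hx').1.ofReal, (hre.mono_set hx').2.ofReal⟩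
  have i2 : IntervalIntegrable (fun s => ((u' s).im : ℂ)) volume a x :=
    ⟨(him.mono_set hx').1.ofReal, (him.mono_set hx').2.ofReal⟩
  simp only [smul_eq_mul]
  rw [← intervalIntegral.integral_ofReal, ← intervalIntegral.integral_ofReal,
    ← intervalIntegral.integral_const_mul, ← intervalIntegral.integral_add i1 (i2.const_mul _)]
  refine intervalIntegral.integral_congr fun s _ => ?_
  simp only [mul_comm Complex.I]
  exact Complex.re_add_im _

lemma absolutelyContinuousOnInterval_of_hasDerivWithinAt {v v' : ℝ → ℂ} {a b : ℝ} (hab : a ≤ b)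
    (hv : ∀ x ∈ Icc a b, HasDerivWithinAt v (v' x) (Icc a b) x)
    (hv' : ContinuousOn v' (Icc a b)) : AbsolutelyContinuousOnInterval v a b := by
  obtain ⟨B, hB⟩ := isCompact_Icc.exists_bound_of_continuousOn hv'
  refine LipschitzOnWith.absolutelyContinuousOnInterval (K := B.toNNReal) ?_
  rw [uIcc_of_le hab]
  refine (convex_Icc a b).lipschitzOnWith_of_nnnorm_hasDerivWithin_le hv fun x hx => ?_
  exact NNReal.coe_le_coe.1 ((hB x hx).trans (Real.le_coe_toNNReal B))

/-- The product rule for an indefinite integral and a continuously differentiable function. -/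
lemma integral_product_rule {u v u' v' : ℝ → ℂ} {a b : ℝ} (hab : a ≤ b)
    (hu' : IntervalIntegrable u' volume a b)
    (hu : ∀ x ∈ Icc a b, u x = u a + ∫ s in a..x, u' s)
    (hv : ∀ x ∈ Icc a b, HasDerivWithinAt v (v' x) (Icc a b) x)
    (hv' : ContinuousOn v' (Icc a b)) :
    ∫ s in a..b, (u' s * v s + u s * v' s) = u b * v b - u a * v a := by
  have hI : uIcc a b = Icc a b := uIcc_of_le hab
  have hvc : ContinuousOn v (Icc a b) := fun x hx => (hv x hx).continuousWithinAt
  have huc : ContinuousOn u (Icc a b) := by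
    have : ContinuousOn (fun x => u a + ∫ s in a..x, u' s) (Icc a b) :=
      continuousOn_const.add (intervalIntegral.continuousOn_primitive_interval
        (by rw [hI]; exact (intervalIntegrable_iff_integrableOn_Icc_of_le hab).1 hu') |>.mono
          hI.symm.subset)
    exact this.congr hu
  have hint : IntervalIntegrable (fun s => u' s * v s + u s * v' s) volume a b :=
    (hu'.mul_continuousOn (hI ▸ hvc)).add ((huc.mul hv').mono hI.subset).intervalIntegrable
  obtain ⟨U, hUac, hU⟩ := absolutelyContinuousOnInterval_primitive hu'
  obtain ⟨V, hVac, hV⟩ := absolutelyContinuousOnInterval_primitive hint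
  rw [hI] at hU hV
  have hvac := absolutelyContinuousOnInterval_of_hasDerivWithinAt hab hv hv'
  -- The function (u(a) + U) v - V is absolutely continuous with derivative zero almost everywhere,
  -- hence constant; comparing its end values is the claim. The end points are discarded because v
  -- has only one-sided derivatives there.
  have hW := (((absolutelyContinuousOnInterval_const (u a) a b).fun_add hUac).fun_smul
    hvac).fun_sub hVac
  obtain ⟨C, hC⟩ := hW.const_of_ae_hasDerivAt_zero (by
    have hend : ∀ᵐ x : ℝ, x ≠ a ∧ x ≠ b := by
      have h1 : ∀ᵐ x : ℝ, x ≠ a := by simp [ae_iff]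
      have h2 : ∀ᵐ x : ℝ, x ≠ b := by simp [ae_iff]
      exact h1.and h2
    filter_upwards [hend, hu'.ae_hasDerivAt_integral, hint.ae_hasDerivAt_integral]
      with x hx hx1 hx2 hxI
    have hx' : x ∈ Icc a b := hI ▸ hxI
    have hxo : Icc a b ∈ 𝓝 x :=
      Icc_mem_nhds (lt_of_le_of_ne hx'.1 (Ne.symm hx.1)) (lt_of_le_of_ne hx'.2 hx.2)
    have d1 : HasDerivAt U (u' x) x := (hx1 hxI a left_mem_uIcc).congr_of_eventuallyEq
      (by filter_upwards [hxo] with z hz using hU z hz)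
    have d2 := (hv x hx').hasDerivAt hxo
    have d4 : HasDerivAt V (u' x * v x + u x * v' x) x :=
      (hx2 hxI a left_mem_uIcc).congr_of_eventuallyEq
        (by filter_upwards [hxo] with z hz using hV z hz)
    have d3 := ((d1.const_add (u a)).fun_smul d2).fun_sub d4
    convert! d3 using 1
    simp only [smul_eq_mul]
    rw [hU x hx', ← hu x hx']; ring)
  have ea := hC a left_mem_uIcc
  have eb := hC b right_mem_uIcc
  have hb : b ∈ Icc a b := ⟨hab, le_rfl⟩
  have ha : a ∈ Icc a b := ⟨le_rfl, hab⟩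
  simp only [smul_eq_mul, hU b hb, hU a ha, hV b hb, hV a ha, ← hu b hb,
    intervalIntegral.integral_same, sub_zero, add_zero] at ea eb
  rw [ea, ← eb]; ring

end IntegroDiff
-- The Volterra operator and its resolvent.
namespace IntegroDiff

variable {M : ℝ → ℝ → ℂ} {q y z : ℝ → ℂ}

/-- The indefinite integral of `force M q y`. -/
noncomputable def forcePrimitive (M : ℝ → ℝ → ℂ) (q y : ℝ → ℂ) (x : ℝ) : ℂ :=
  ∫ s in (0 : ℝ)..x, force M q y s

lemma continuousOn_primitive_of_intervalIntegrable {f : ℝ → ℂ}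
    (hf : IntervalIntegrable f volume 0 Real.pi) :
    ContinuousOn (fun x => ∫ s in (0 : ℝ)..x, f s) (Icc 0 Real.pi) := by
  have h := intervalIntegral.continuousOn_primitive_interval (a := (0 : ℝ)) (b := Real.pi)
    (by rw [uIcc_of_le Real.pi_pos.le]
        exact (intervalIntegrable_iff_integrableOn_Icc_of_le Real.pi_pos.le).1 hf)
  rwa [uIcc_of_le Real.pi_pos.le] at h

lemma continuousOn_forcePrimitive (hM : IntegrableOn (fun p : ℝ × ℝ => M p.1 p.2) triangle)
    (hq : ContinuousOn q (Icc 0 Real.pi)) (hy : ContinuousOn y (Icc 0 Real.pi)) :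
    ContinuousOn (forcePrimitive M q y) (Icc 0 Real.pi) :=
  continuousOn_primitive_of_intervalIntegrable (intervalIntegrable_force hM hq hy)

lemma zero_mem_Icc_pi : (0 : ℝ) ∈ Icc (0 : ℝ) Real.pi := ⟨le_rfl, Real.pi_pos.le⟩

lemma pi_mem_Icc_pi : Real.pi ∈ Icc (0 : ℝ) Real.pi := ⟨Real.pi_pos.le, le_rfl⟩

lemma integral_congr_of_le_pi {f g : ℝ → ℂ} {x : ℝ} (hx : x ∈ Icc (0 : ℝ) Real.pi)
    (h : ∀ s ∈ Icc (0 : ℝ) Real.pi, f s = g s) :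
    ∫ s in (0 : ℝ)..x, f s = ∫ s in (0 : ℝ)..x, g s := by
  refine intervalIntegral.integral_congr fun s hs => h s ?_
  rw [uIcc_of_le hx.1] at hs
  exact ⟨hs.1, hs.2.trans hx.2⟩

lemma force_congr (h : EqOn y z (Icc 0 Real.pi)) {s : ℝ} (hs : s ∈ Icc (0 : ℝ) Real.pi) :
    force M q y s = force M q z s := by
  rw [force, force, h hs]
  congr 1
  refine integral_congr_of_le_pi hs fun t ht => ?_
  rw [h ht]

lemma force_smul (c : ℂ) (s : ℝ) : force M q (fun x => c * y x) s = c * force M q y s := by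
  rw [force, force, mul_add, ← intervalIntegral.integral_const_mul]
  congr 1
  · ring
  · congr 1; ext t; ring

lemma ae_force_add (hM : IntegrableOn (fun p : ℝ × ℝ => M p.1 p.2) triangle)
    (hy : ContinuousOn y (Icc 0 Real.pi)) (hz : ContinuousOn z (Icc 0 Real.pi)) :
    ∀ᵐ s, s ∈ Icc (0 : ℝ) Real.pi →
      force M q (fun x => y x + z x) s = force M q y s + force M q z s := by
  filter_upwards [ae_row_mul hM hy, ae_row_mul hM hz] with s h1 h2 hs
  have : ∫ t in (0 : ℝ)..s, M s t * (y t + z t) =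
      (∫ t in (0 : ℝ)..s, M s t * y t) + ∫ t in (0 : ℝ)..s, M s t * z t := by
    rw [← intervalIntegral.integral_add (h1 hs) (h2 hs)]
    congr 1; ext t; ring
  rw [force, force, force, this]; ring

lemma force_sub_const (lam : ℂ) (s : ℝ) :
    force M (fun x => q x - lam) y s = force M q y s - lam * y s := by
  rw [force, force]; ring

lemma forcePrimitive_congr (h : EqOn y z (Icc 0 Real.pi)) {x : ℝ}
    (hx : x ∈ Icc (0 : ℝ) Real.pi) : forcePrimitive M q y x = forcePrimitive M q z x :=
  integral_congr_of_le_pi hx fun _ hs => force_congr h hs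

lemma forcePrimitive_smul (c : ℂ) (x : ℝ) :
    forcePrimitive M q (fun x => c * y x) x = c * forcePrimitive M q y x := by
  simp_rw [forcePrimitive, force_smul, intervalIntegral.integral_const_mul]

lemma forcePrimitive_add (hM : IntegrableOn (fun p : ℝ × ℝ => M p.1 p.2) triangle)
    (hq : ContinuousOn q (Icc 0 Real.pi))
    (hy : ContinuousOn y (Icc 0 Real.pi)) (hz : ContinuousOn z (Icc 0 Real.pi)) {x : ℝ}
    (hx : x ∈ Icc (0 : ℝ) Real.pi) :
    forcePrimitive M q (fun x => y x + z x) x = forcePrimitive M q y x + forcePrimitive M q z x := by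
  have h1 := intervalIntegrable_sub_interval (intervalIntegrable_force hM hq hy) zero_mem_Icc_pi hx
  have h2 := intervalIntegrable_sub_interval (intervalIntegrable_force hM hq hz) zero_mem_Icc_pi hx
  simp_rw [forcePrimitive]
  rw [← intervalIntegral.integral_add h1 h2]
  refine intervalIntegral.integral_congr_ae ?_
  filter_upwards [ae_force_add (q := q) hM hy hz] with s h hs
  rw [uIoc_of_le hx.1] at hs
  exact h ⟨hs.1.le, hs.2.trans hx.2⟩

lemma norm_forcePrimitive_le (hM : IntegrableOn (fun p : ℝ × ℝ => M p.1 p.2) triangle)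
    (hq : ContinuousOn q (Icc 0 Real.pi)) {Y α : ℝ} (hα : 0 ≤ α)
    (hY : ∀ t ∈ Icc (0 : ℝ) Real.pi, ‖y t‖ ≤ Y * Real.exp (α * t)) {x : ℝ}
    (hx : x ∈ Icc (0 : ℝ) Real.pi) :
    ‖forcePrimitive M q y x‖ ≤ totalMass M q * Y * Real.exp (α * x) := by
  have h := norm_integral_force_mul_le hM hq (v := fun _ => 1) hα hY le_rfl hx.1 hx.2
    (Real.exp_pos (α * x)).le (fun s hs => by
      rw [norm_one, mul_one]
      exact Real.exp_le_exp.2 (mul_le_mul_of_nonneg_left hs.2 hα))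
  simpa [forcePrimitive] using h

lemma intervalIntegrable_forcePrimitive
    (hM : IntegrableOn (fun p : ℝ × ℝ => M p.1 p.2) triangle)
    (hq : ContinuousOn q (Icc 0 Real.pi)) (hy : ContinuousOn y (Icc 0 Real.pi)) {x : ℝ}
    (hx : x ∈ Icc (0 : ℝ) Real.pi) :
    IntervalIntegrable (forcePrimitive M q y) volume 0 x :=
  intervalIntegrable_sub_interval
    (intervalIntegrable_of_continuousOn (continuousOn_forcePrimitive hM hq hy)) zero_mem_Icc_pi hx

/-- The continuous functions on `[0, π]`. -/
abbrev Cpi : Type := C(Icc (0 : ℝ) Real.pi, ℂ)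

/-- The extension of a continuous function on `[0, π]` to the line by constants. -/
noncomputable def Cpi.ext (u : Cpi) : ℝ → ℂ := IccExtend Real.pi_pos.le u

lemma Cpi.continuous_ext (u : Cpi) : Continuous u.ext := u.continuous.Icc_extend'

lemma Cpi.ext_apply (u : Cpi) {x : ℝ} (hx : x ∈ Icc (0 : ℝ) Real.pi) : u.ext x = u ⟨x, hx⟩ :=
  IccExtend_of_mem _ _ hx

lemma Cpi.norm_ext_le (u : Cpi) (x : ℝ) : ‖u.ext x‖ ≤ ‖u‖ := u.norm_coe_le_norm _

/-- The restriction to `[0, π]` of a function continuous there. -/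
noncomputable def Cpi.restrict (y : ℝ → ℂ) (hy : ContinuousOn y (Icc 0 Real.pi)) : Cpi :=
  ⟨(Icc 0 Real.pi).domRestrict y, hy.domRestrict⟩

/-- The Volterra operator `u ↦ ∫₀ˣ ∫₀ˢ force M q u`. -/
noncomputable def volterra (hM : IntegrableOn (fun p : ℝ × ℝ => M p.1 p.2) triangle)
    (hq : ContinuousOn q (Icc 0 Real.pi)) : Cpi →L[ℂ] Cpi :=
  LinearMap.mkContinuous
    { toFun := fun u => Cpi.restrict (fun x => ∫ s in (0 : ℝ)..x, forcePrimitive M q u.ext s)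
        (continuousOn_primitive_of_intervalIntegrable (intervalIntegrable_of_continuousOn
          (continuousOn_forcePrimitive hM hq u.continuous_ext.continuousOn)))
      map_add' := fun u v => by
        ext ⟨x, hx⟩
        have hu := u.continuous_ext.continuousOn (s := Icc 0 Real.pi)
        have hv := v.continuous_ext.continuousOn (s := Icc 0 Real.pi)
        change ∫ s in (0 : ℝ)..x, forcePrimitive M q (u + v).ext s =
          (∫ s in (0 : ℝ)..x, forcePrimitive M q u.ext s) +
            ∫ s in (0 : ℝ)..x, forcePrimitive M q v.ext s
        rw [← intervalIntegral.integral_add (intervalIntegrable_forcePrimitive hM hq hu hx)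
          (intervalIntegrable_forcePrimitive hM hq hv hx)]
        exact integral_congr_of_le_pi hx fun s hs => forcePrimitive_add hM hq hu hv hs
      map_smul' := fun c u => by
        ext ⟨x, hx⟩
        change ∫ s in (0 : ℝ)..x, forcePrimitive M q (fun x => c * u.ext x) s =
          c * ∫ s in (0 : ℝ)..x, forcePrimitive M q u.ext s
        simp_rw [forcePrimitive_smul, intervalIntegral.integral_const_mul] }
    (totalMass M q * Real.pi) (fun u => by
      have hK : 0 ≤ totalMass M q := totalMass_nonneg
      have hpi := Real.pi_pos
      refine (ContinuousMap.norm_le _ (by positivity)).2 ?_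
      rintro ⟨x, hx⟩
      change ‖∫ s in (0 : ℝ)..x, forcePrimitive M q u.ext s‖ ≤ _
      have h := intervalIntegral.norm_integral_le_of_norm_le_const (a := 0) (b := x)
        (f := forcePrimitive M q u.ext) (C := totalMass M q * ‖u‖) (fun s hs => by
          rw [uIoc_of_le hx.1] at hs
          have := norm_forcePrimitive_le (y := u.ext) (Y := ‖u‖) hM hq (le_refl (0 : ℝ))
            (fun t _ => by simpa using u.norm_ext_le t) (x := s) ⟨hs.1.le, hs.2.trans hx.2⟩
          simpa using this)
      refine h.trans ?_
      rw [sub_zero, abs_of_nonneg hx.1, mul_right_comm]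
      have := hx.2
      gcongr)

lemma integral_exp_mul_le {α x : ℝ} (hα : 0 < α) :
    ∫ s in (0 : ℝ)..x, Real.exp (α * s) ≤ Real.exp (α * x) / α := by
  have h : ∫ s in (0 : ℝ)..x, Real.exp (α * s) = Real.exp (α * x) / α - 1 / α := by
    have := intervalIntegral.integral_eq_sub_of_hasDerivAt (a := 0) (b := x)
      (f := fun s => Real.exp (α * s) / α) (f' := fun s => Real.exp (α * s)) (fun s _ => by
        have := (((hasDerivAt_id s).const_mul α).exp).div_const α
        convert! this using 1
        simp; field_simp) ((by fun_prop : Continuous _).intervalIntegrable _ _)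
    simpa using this
  rw [h]
  have : 0 < 1 / α := by positivity
  linarith

/-- The function `exp (α x)` on `[0, π]`. -/
noncomputable def expWeight (α : ℝ) : Cpi := ⟨fun x => (Real.exp (α * x) : ℂ), by fun_prop⟩

lemma expWeight_mul_neg (α : ℝ) : expWeight α * expWeight (-α) = 1 := by
  ext x
  change (Real.exp (α * x) : ℂ) * (Real.exp (-α * x) : ℂ) = 1
  rw [← Complex.ofReal_mul, ← Real.exp_add]; simp

lemma isUnit_one_sub_of_conj {R : Type*} [Ring R] {W W' T : R} (h : W * W' = 1) (h' : W' * W = 1)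
    (hu : IsUnit (1 - W' * T * W)) : IsUnit (1 - T) := by
  have h1 : 1 - T = W * (1 - W' * T * W) * W' := by
    rw [mul_sub, sub_mul, mul_one, h]
    congr 1
    calc T = (W * W') * T * (W * W') := by rw [h]; simp
      _ = _ := by simp only [mul_assoc]
  rw [h1]
  have hW : IsUnit W := ⟨⟨W, W', h, h'⟩, rfl⟩
  have hW' : IsUnit W' := ⟨⟨W', W, h', h⟩, rfl⟩
  exact (hW.mul hu).mul hW'

/-- Bielecki's weighted norm, written as conjugation by multiplication by e^{αx}. Integrating e^{αs}
gains a factor 1/α, so for large α the conjugated operator is a contraction and the Neumann series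
applies without any smallness of the data. -/
lemma isUnit_one_sub_volterra (hM : IntegrableOn (fun p : ℝ × ℝ => M p.1 p.2) triangle)
    (hq : ContinuousOn q (Icc 0 Real.pi)) : IsUnit (1 - volterra hM hq) := by
  -- Chosen so that mass/α ≤ 1/2; the summand 1 keeps α positive when the mass vanishes.
  set α : ℝ := 2 * totalMass M q + 1
  have hK : 0 ≤ totalMass M q := totalMass_nonneg
  have hα : 0 < α := by positivity
  set W : Cpi →L[ℂ] Cpi := ContinuousLinearMap.mul ℂ Cpi (expWeight α)
  set W' : Cpi →L[ℂ] Cpi := ContinuousLinearMap.mul ℂ Cpi (expWeight (-α))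
  have hWW' : W * W' = 1 := by
    ext1 u
    change expWeight α * (expWeight (-α) * u) = u
    rw [← mul_assoc, expWeight_mul_neg, one_mul]
  have hW'W : W' * W = 1 := by
    ext1 u
    change expWeight (-α) * (expWeight α * u) = u
    rw [← mul_assoc, mul_comm (expWeight (-α)), expWeight_mul_neg, one_mul]
  have hnorm : ‖W' * volterra hM hq * W‖ ≤ 1 / 2 := by
    refine ContinuousLinearMap.opNorm_le_bound _ (by norm_num) fun u => ?_
    refine (ContinuousMap.norm_le _ (by positivity)).2 ?_
    rintro ⟨x, hx⟩
    change ‖(Real.exp (-α * x) : ℂ) *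
      ∫ s in (0 : ℝ)..x, forcePrimitive M q (expWeight α * u : Cpi).ext s‖ ≤ _
    have hb : ∀ t ∈ Icc (0 : ℝ) Real.pi,
        ‖(expWeight α * u : Cpi).ext t‖ ≤ ‖u‖ * Real.exp (α * t) := by
      intro t ht
      rw [Cpi.ext_apply _ ht]
      change ‖(Real.exp (α * t) : ℂ) * u ⟨t, ht⟩‖ ≤ _
      rw [norm_mul, Complex.norm_real, Real.norm_of_nonneg (Real.exp_pos _).le, mul_comm]
      gcongr
      exact u.norm_coe_le_norm _
    have h1 : ‖∫ s in (0 : ℝ)..x, forcePrimitive M q (expWeight α * u : Cpi).ext s‖ ≤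
        ∫ s in (0 : ℝ)..x, totalMass M q * ‖u‖ * Real.exp (α * s) := by
      refine intervalIntegral.norm_integral_le_of_norm_le hx.1
        (Eventually.of_forall fun s hs => ?_)
        ((by fun_prop : Continuous _).intervalIntegrable _ _)
      exact norm_forcePrimitive_le hM hq hα.le hb ⟨hs.1.le, hs.2.trans hx.2⟩
    rw [intervalIntegral.integral_const_mul] at h1
    rw [norm_mul, Complex.norm_real, Real.norm_of_nonneg (Real.exp_pos _).le]
    calc _ ≤ Real.exp (-α * x) * (totalMass M q * ‖u‖ * (Real.exp (α * x) / α)) := by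
          gcongr
          refine h1.trans ?_
          gcongr
          exact integral_exp_mul_le hα
      _ = (Real.exp (-α * x) * Real.exp (α * x)) * (totalMass M q / α) * ‖u‖ := by ring
      _ = totalMass M q / α * ‖u‖ := by rw [← Real.exp_add]; simp
      _ ≤ 1 / 2 * ‖u‖ := by
          refine mul_le_mul_of_nonneg_right ?_ (norm_nonneg u)
          rw [div_le_div_iff₀ hα two_pos]
          simp only [α]; linarith
  have hu : IsUnit (1 - W' * volterra hM hq * W) :=
    isUnit_one_sub_of_norm_lt_one (R := Cpi →L[ℂ] Cpi)
      (lt_of_le_of_lt hnorm (by norm_num : (1 / 2 : ℝ) < 1))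
  exact isUnit_one_sub_of_conj (R := Cpi →L[ℂ] Cpi) hWW' hW'W hu

lemma continuousOn_sub_const (hq : ContinuousOn q (Icc 0 Real.pi)) (lam : ℂ) :
    ContinuousOn (fun s => q s - lam) (Icc 0 Real.pi) := hq.sub continuousOn_const

/-- The spectral parameter enters affinely, through the double integration operator (zero kernel,
potential 1). Hence the inverse of 1 - T is analytic in it wherever it exists, that is, everywhere.
-/
lemma volterra_sub_const (hM : IntegrableOn (fun p : ℝ × ℝ => M p.1 p.2) triangle)
    (hq : ContinuousOn q (Icc 0 Real.pi)) (lam : ℂ) :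
    volterra hM (continuousOn_sub_const hq lam) = volterra hM hq -
      lam • volterra (M := fun _ _ => 0) (q := fun _ => 1) integrableOn_zero continuousOn_const := by
  ext u ⟨x, hx⟩
  have hu := u.continuous_ext.continuousOn (s := Icc 0 Real.pi)
  change ∫ s in (0 : ℝ)..x, forcePrimitive M (fun s => q s - lam) u.ext s =
    (∫ s in (0 : ℝ)..x, forcePrimitive M q u.ext s) -
      lam * ∫ s in (0 : ℝ)..x, forcePrimitive (fun _ _ => 0) (fun _ => 1) u.ext s
  rw [← intervalIntegral.integral_const_mul, ← intervalIntegral.integral_sub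
    (intervalIntegrable_forcePrimitive hM hq hu hx)
    ((intervalIntegrable_forcePrimitive integrableOn_zero continuousOn_const hu hx).const_mul lam)]
  refine integral_congr_of_le_pi hx fun s hs => ?_
  have h1 := intervalIntegrable_sub_interval (intervalIntegrable_force hM hq hu) zero_mem_Icc_pi hs
  have h2 := intervalIntegrable_sub_interval (intervalIntegrable_force (M := fun _ _ => 0)
    (q := fun _ => 1) integrableOn_zero continuousOn_const hu) zero_mem_Icc_pi hs
  rw [forcePrimitive, forcePrimitive, forcePrimitive, ← intervalIntegral.integral_const_mul,
    ← intervalIntegral.integral_sub h1 (h2.const_mul lam)]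
  congr 1; ext r
  rw [force_sub_const]
  simp [force]

end IntegroDiff
-- Cauchy problems, characteristic functions and the Weyl-type solution.
namespace IntegroDiff

variable {M : ℝ → ℝ → ℂ} {q y z : ℝ → ℂ} {lam : ℂ}

/-- Extending f continuously by constants reduces the one-sided statement at the end points to the
fundamental theorem on the line. -/
lemma hasDerivWithinAt_primitive {f : ℝ → ℂ} (hf : ContinuousOn f (Icc 0 Real.pi)) {x : ℝ}
    (hx : x ∈ Icc (0 : ℝ) Real.pi) :
    HasDerivWithinAt (fun x => ∫ s in (0 : ℝ)..x, f s) (f x) (Icc 0 Real.pi) x := by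
  have hc : Continuous (Cpi.restrict f hf).ext := Cpi.continuous_ext _
  have h := (hc.integral_hasStrictDerivAt 0 x).hasDerivAt.hasDerivWithinAt (s := Icc 0 Real.pi)
  have he : ∀ s ∈ Icc (0 : ℝ) Real.pi, (Cpi.restrict f hf).ext s = f s := fun s hs =>
    Cpi.ext_apply _ hs
  rw [he x hx] at h
  exact h.congr (fun z hz => (integral_congr_of_le_pi hz he).symm)
    (integral_congr_of_le_pi hx he).symm

lemma uniqueDiffOn_Icc_pi : UniqueDiffOn ℝ (Icc (0 : ℝ) Real.pi) := uniqueDiffOn_Icc Real.pi_pos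

lemma IsSolution.continuousOn (h : IsSolution M q lam y) : ContinuousOn y (Icc 0 Real.pi) :=
  h.1.continuousOn

lemma IsSolution.hasDerivWithinAt (h : IsSolution M q lam y) {x : ℝ}
    (hx : x ∈ Icc (0 : ℝ) Real.pi) : HasDerivWithinAt y (der y x) (Icc 0 Real.pi) x :=
  (h.1 x hx).hasDerivWithinAt

lemma IsSolution.der_eq (h : IsSolution M q lam y) {x : ℝ} (hx : x ∈ Icc (0 : ℝ) Real.pi) :
    der y x = der y 0 + forcePrimitive M (fun s => q s - lam) y x := h.2.2 x hx

lemma IsSolution.continuousOn_der (h : IsSolution M q lam y) :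
    ContinuousOn (der y) (Icc 0 Real.pi) :=
  (continuousOn_const.add (continuousOn_primitive_of_intervalIntegrable h.2.1)).congr h.2.2

lemma eq_add_integral_of_hasDerivWithinAt {y' : ℝ → ℂ}
    (hy : ∀ x ∈ Icc (0 : ℝ) Real.pi, HasDerivWithinAt y (y' x) (Icc 0 Real.pi) x)
    (hy' : ContinuousOn y' (Icc 0 Real.pi)) {x : ℝ} (hx : x ∈ Icc (0 : ℝ) Real.pi) :
    y x = y 0 + ∫ s in (0 : ℝ)..x, y' s := by
  have hsub : Icc 0 x ⊆ Icc 0 Real.pi := Icc_subset_Icc_right hx.2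
  have h := intervalIntegral.integral_eq_sub_of_hasDerivAt_of_le hx.1
    (f := y) (f' := y') (fun s hs => ((hy s (hsub hs)).continuousWithinAt.mono hsub))
    (fun s hs => (hy s (hsub ⟨hs.1.le, hs.2.le⟩)).hasDerivAt
      (Icc_mem_nhds hs.1 (hs.2.trans_le hx.2)))
    (intervalIntegrable_sub_interval (intervalIntegrable_of_continuousOn hy') zero_mem_Icc_pi hx)
  rw [h]; ring

lemma IsSolution.eq_integral (h : IsSolution M q lam y) {x : ℝ}
    (hx : x ∈ Icc (0 : ℝ) Real.pi) :
    y x = y 0 + der y 0 * x +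
      ∫ s in (0 : ℝ)..x, forcePrimitive M (fun s => q s - lam) y s := by
  rw [eq_add_integral_of_hasDerivWithinAt (fun x hx => h.hasDerivWithinAt hx)
    h.continuousOn_der hx]
  have h1 : ∫ s in (0 : ℝ)..x, der y s =
      ∫ s in (0 : ℝ)..x, (der y 0 + forcePrimitive M (fun s => q s - lam) y s) :=
    integral_congr_of_le_pi hx fun s hs => h.der_eq hs
  have h2 : IntervalIntegrable (forcePrimitive M (fun s => q s - lam) y) volume 0 x :=
    intervalIntegrable_sub_interval (intervalIntegrable_of_continuousOn
      (continuousOn_primitive_of_intervalIntegrable h.2.1)) zero_mem_Icc_pi hx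
  rw [h1, intervalIntegral.integral_add intervalIntegrable_const h2,
    intervalIntegral.integral_const]
  simp only [sub_zero, Complex.real_smul]
  ring

lemma hasDerivWithinAt_of_eq_integral
    (hM : IntegrableOn (fun p : ℝ × ℝ => M p.1 p.2) triangle)
    (hq : ContinuousOn q (Icc 0 Real.pi)) (hy : ContinuousOn y (Icc 0 Real.pi)) {a b : ℂ}
    (h : ∀ x ∈ Icc (0 : ℝ) Real.pi, y x = a + b * x +
      ∫ s in (0 : ℝ)..x, forcePrimitive M q y s)
    {x : ℝ} (hx : x ∈ Icc (0 : ℝ) Real.pi) :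
    HasDerivWithinAt y (b + forcePrimitive M q y x) (Icc 0 Real.pi) x := by
  have h1 := hasDerivWithinAt_primitive (continuousOn_forcePrimitive hM hq hy) hx
  have h2 : HasDerivWithinAt (fun x : ℝ => a + b * (x : ℂ)) b (Icc 0 Real.pi) x := by
    have := ((Complex.ofRealCLM.hasDerivAt (x := x)).const_mul b).const_add a
    simpa using this.hasDerivWithinAt
  exact (h2.fun_add h1).congr h (h x hx)

/-- Converse of `IsSolution.eq_integral`: the Cauchy problem is equivalent to a fixed-point equation
in which no derivative occurs, so it can be solved among continuous functions. -/
lemma isSolution_of_eq_integral (hM : IntegrableOn (fun p : ℝ × ℝ => M p.1 p.2) triangle)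
    (hq : ContinuousOn q (Icc 0 Real.pi)) (hy : ContinuousOn y (Icc 0 Real.pi)) {a b : ℂ}
    (h : ∀ x ∈ Icc (0 : ℝ) Real.pi, y x = a + b * x +
      ∫ s in (0 : ℝ)..x, forcePrimitive M (fun s => q s - lam) y s) :
    IsSolution M q lam y ∧ y 0 = a ∧ der y 0 = b := by
  have hq' := continuousOn_sub_const hq lam
  have hd := fun x hx => hasDerivWithinAt_of_eq_integral hM hq' hy h (x := x) hx
  have hder : ∀ x ∈ Icc (0 : ℝ) Real.pi,
      der y x = b + forcePrimitive M (fun s => q s - lam) y x := fun x hx =>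
    (hd x hx).derivWithin (uniqueDiffOn_Icc_pi x hx)
  have h0 : der y 0 = b := by
    rw [hder 0 zero_mem_Icc_pi]; simp [forcePrimitive]
  refine ⟨⟨fun x hx => (hd x hx).differentiableWithinAt, intervalIntegrable_force hM hq' hy,
    fun x hx => ?_⟩, ?_, h0⟩
  · rw [h0]; exact hder x hx
  · rw [h 0 zero_mem_Icc_pi]; simp

/-- The affine function `a + b x` on `[0, π]`. -/
noncomputable def affineCpi (a b : ℂ) : Cpi := ⟨fun x => a + b * ((x : ℝ) : ℂ), by fun_prop⟩

/-- The solution of the Cauchy problem `y(0) = a`, `y'(0) = b` obtained by inverting the Volterra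
operator. -/
noncomputable def volterraSol (hM : IntegrableOn (fun p : ℝ × ℝ => M p.1 p.2) triangle)
    (hq : ContinuousOn q (Icc 0 Real.pi)) (a b lam : ℂ) : Cpi :=
  Ring.inverse (1 - volterra hM (continuousOn_sub_const hq lam)) (affineCpi a b)

lemma isSolution_volterraSol (hM : IntegrableOn (fun p : ℝ × ℝ => M p.1 p.2) triangle)
    (hq : ContinuousOn q (Icc 0 Real.pi)) (a b lam : ℂ) :
    IsSolution M q lam (volterraSol hM hq a b lam).ext ∧ (volterraSol hM hq a b lam).ext 0 = a ∧
      der (volterraSol hM hq a b lam).ext 0 = b := by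
  set T := volterra hM (continuousOn_sub_const hq lam) with hT
  set u := volterraSol hM hq a b lam with hu
  have hfix : (1 - T) u = affineCpi a b := by
    have h1 := Ring.mul_inverse_cancel _
      (isUnit_one_sub_volterra hM (continuousOn_sub_const hq lam))
    exact congrArg (fun S : Cpi →L[ℂ] Cpi => S (affineCpi a b)) h1
  refine isSolution_of_eq_integral hM hq u.continuous_ext.continuousOn fun x hx => ?_
  have h2 := congrArg (fun v : Cpi => v ⟨x, hx⟩) hfix
  change u ⟨x, hx⟩ - ∫ s in (0 : ℝ)..x, forcePrimitive M (fun s => q s - lam) u.ext s =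
    a + b * x at h2
  rw [← h2, u.ext_apply hx]; ring

/-- Uniqueness: the restriction of y satisfies (1 - T) u = affine function, and 1 - T has a left
inverse. -/
lemma IsSolution.eq_volterraSol (hM : IntegrableOn (fun p : ℝ × ℝ => M p.1 p.2) triangle)
    (hq : ContinuousOn q (Icc 0 Real.pi)) (h : IsSolution M q lam y) {x : ℝ}
    (hx : x ∈ Icc (0 : ℝ) Real.pi) :
    y x = (volterraSol hM hq (y 0) (der y 0) lam).ext x := by
  set T := volterra hM (continuousOn_sub_const hq lam) with hT
  set u : Cpi := Cpi.restrict y h.continuousOn with hu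
  have he : EqOn u.ext y (Icc 0 Real.pi) := fun x hx => u.ext_apply hx
  have hfix : (1 - T) u = affineCpi (y 0) (der y 0) := by
    ext ⟨x, hx⟩
    change y x - ∫ s in (0 : ℝ)..x, forcePrimitive M (fun s => q s - lam) u.ext s =
      y 0 + der y 0 * x
    rw [h.eq_integral hx, integral_congr_of_le_pi hx fun s hs => forcePrimitive_congr he hs]
    ring
  have h1 := Ring.inverse_mul_cancel _
    (isUnit_one_sub_volterra hM (continuousOn_sub_const hq lam))
  have h2 : Ring.inverse (1 - T) ((1 - T) u) = u :=
    congrArg (fun S : Cpi →L[ℂ] Cpi => S u) h1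
  rw [hfix] at h2
  rw [volterraSol, ← hT, h2, he hx]

lemma IsSolution.eqOn (hM : IntegrableOn (fun p : ℝ × ℝ => M p.1 p.2) triangle)
    (hq : ContinuousOn q (Icc 0 Real.pi)) (h : IsSolution M q lam y) (h' : IsSolution M q lam z)
    (h0 : y 0 = z 0) (h1 : der y 0 = der z 0) : EqOn y z (Icc 0 Real.pi) := fun x hx => by
  rw [h.eq_volterraSol hM hq hx, h'.eq_volterraSol hM hq hx, h0, h1]

lemma isSolution_cauchySol (hM : IntegrableOn (fun p : ℝ × ℝ => M p.1 p.2) triangle)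
    (hq : ContinuousOn q (Icc 0 Real.pi)) (a b lam : ℂ) :
    IsSolution M q lam (cauchySol M q a b lam) ∧ cauchySol M q a b lam 0 = a ∧
      der (cauchySol M q a b lam) 0 = b :=
  Classical.epsilon_spec (p := fun y => IsSolution M q lam y ∧ y 0 = a ∧ der y 0 = b)
    ⟨_, isSolution_volterraSol hM hq a b lam⟩

/-- The solution picked by choice carries no regularity in `lam` of its own. By uniqueness its value
at π is that of the resolvent, which does depend analytically on `lam`. -/
lemma cauchySol_pi (hM : IntegrableOn (fun p : ℝ × ℝ => M p.1 p.2) triangle)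
    (hq : ContinuousOn q (Icc 0 Real.pi)) (a b lam : ℂ) :
    cauchySol M q a b lam Real.pi = volterraSol hM hq a b lam ⟨Real.pi, pi_mem_Icc_pi⟩ := by
  obtain ⟨h, h0, h1⟩ := isSolution_cauchySol hM hq a b lam
  rw [h.eq_volterraSol hM hq pi_mem_Icc_pi, h0, h1, Cpi.ext_apply _ pi_mem_Icc_pi]

lemma differentiableAt_inverse_one_sub_smul {R : Type*} [NormedRing R] [NormedAlgebra ℂ R]
    [CompleteSpace R] (l : R →L[ℂ] ℂ) (A B : R) (lam : ℂ)
    (h : IsUnit (1 - (A - lam • B))) :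
    DifferentiableAt ℂ (fun lam : ℂ => l (Ring.inverse (1 - (A - lam • B)))) lam := by
  have h1 : DifferentiableAt ℂ (fun lam : ℂ => 1 - (A - lam • B)) lam :=
    (differentiableAt_const _).sub ((differentiableAt_const _).sub
      (differentiableAt_id.smul_const B))
  have h2 : DifferentiableAt ℂ Ring.inverse (1 - (A - lam • B)) := differentiableAt_inverse h
  have h3 : DifferentiableAt ℂ (fun lam : ℂ => Ring.inverse (1 - (A - lam • B))) lam :=
    DifferentiableAt.comp (g := Ring.inverse) lam h2 h1
  exact l.differentiableAt.comp lam h3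

/-- The functional `A ↦ (A f)(π)`. -/
noncomputable def evalPiCLM (f : Cpi) : (Cpi →L[ℂ] Cpi) →L[ℂ] ℂ :=
  (ContinuousMap.evalCLM ℂ (⟨Real.pi, pi_mem_Icc_pi⟩ : Icc (0 : ℝ) Real.pi)).comp
    (ContinuousLinearMap.apply ℂ Cpi f)

/-- The value at `π` of the solution of a Cauchy problem is an entire function of `lam`. -/
lemma differentiable_cauchySol_pi (hM : IntegrableOn (fun p : ℝ × ℝ => M p.1 p.2) triangle)
    (hq : ContinuousOn q (Icc 0 Real.pi)) (a b : ℂ) :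
    Differentiable ℂ fun lam => cauchySol M q a b lam Real.pi := by
  intro lam
  set J : Cpi →L[ℂ] Cpi := volterra (M := fun _ _ => 0) (q := fun _ => 1)
    integrableOn_zero continuousOn_const with hJ
  have hT : ∀ lam : ℂ, volterra hM (continuousOn_sub_const hq lam) = volterra hM hq - lam • J :=
    volterra_sub_const hM hq
  have hu : IsUnit (1 - (volterra hM hq - lam • J)) := by
    rw [← hT]; exact isUnit_one_sub_volterra hM (continuousOn_sub_const hq lam)
  have h := differentiableAt_inverse_one_sub_smul (R := Cpi →L[ℂ] Cpi)
    (evalPiCLM (affineCpi a b)) (volterra hM hq) J lam hu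
  refine h.congr_of_eventuallyEq (Eventually.of_forall fun z => ?_)
  change cauchySol M q a b z Real.pi = _
  rw [cauchySol_pi hM hq, volterraSol, hT]
  rfl

lemma IsSolution.const_mul (h : IsSolution M q lam y) (c : ℂ) :
    IsSolution M q lam (fun x => c * y x) ∧ der (fun x => c * y x) 0 = c * der y 0 := by
  have hd : ∀ x ∈ Icc (0 : ℝ) Real.pi, der (fun x => c * y x) x = c * der y x := fun x hx =>
    ((h.hasDerivWithinAt hx).const_mul c).derivWithin (uniqueDiffOn_Icc_pi x hx)
  have hf : force M (fun s => q s - lam) (fun x => c * y x) =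
      fun s => c * force M (fun s => q s - lam) y s := by ext s; exact force_smul c s
  refine ⟨⟨h.1.const_mul c, ?_, fun x hx => ?_⟩, hd 0 zero_mem_Icc_pi⟩
  · change IntervalIntegrable (force M (fun s => q s - lam) (fun x => c * y x)) volume _ _
    rw [hf]
    exact IntervalIntegrable.const_mul h.2.1 c
  · rw [hd x hx, hd 0 zero_mem_Icc_pi, h.der_eq hx, mul_add, ← forcePrimitive_smul]
    rfl

lemma IsSolution.add (hM : IntegrableOn (fun p : ℝ × ℝ => M p.1 p.2) triangle)
    (hq : ContinuousOn q (Icc 0 Real.pi)) (h : IsSolution M q lam y)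
    (h' : IsSolution M q lam z) :
    IsSolution M q lam (fun x => y x + z x) ∧ der (fun x => y x + z x) 0 = der y 0 + der z 0 := by
  have hd : ∀ x ∈ Icc (0 : ℝ) Real.pi, der (fun x => y x + z x) x = der y x + der z x :=
    fun x hx => ((h.hasDerivWithinAt hx).fun_add (h'.hasDerivWithinAt hx)).derivWithin
      (uniqueDiffOn_Icc_pi x hx)
  have hq' := continuousOn_sub_const hq lam
  have hyz := h.continuousOn.add h'.continuousOn
  refine ⟨⟨h.1.add h'.1, intervalIntegrable_force hM hq' hyz, fun x hx => ?_⟩,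
    hd 0 zero_mem_Icc_pi⟩
  have := forcePrimitive_add hM hq' h.continuousOn h'.continuousOn hx
  rw [hd x hx, hd 0 zero_mem_Icc_pi, h.der_eq hx, h'.der_eq hx]
  change _ = _ + forcePrimitive M (fun s => q s - lam) (fun x => y x + z x) x
  rw [this]; ring

lemma IsSolution.congr_potential {q' : ℝ → ℂ} (hqq : EqOn q q' (Icc 0 Real.pi))
    (h : IsSolution M q lam y) : IsSolution M q' lam y := by
  have hf : ∀ s ∈ Icc (0 : ℝ) Real.pi, (q s - lam) * y s + ∫ t in (0 : ℝ)..s, M s t * y t =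
      (q' s - lam) * y s + ∫ t in (0 : ℝ)..s, M s t * y t := fun s hs => by rw [hqq hs]
  refine ⟨h.1, h.2.1.congr fun s hs => ?_, fun x hx => ?_⟩
  · rw [uIoc_of_le Real.pi_pos.le] at hs
    exact hf s ⟨hs.1.le, hs.2⟩
  · rw [h.2.2 x hx, integral_congr_of_le_pi hx hf]

/-- Potentials agreeing on [0, π] define the same predicate, so the choice operator returns the same
function, even outside [0, π]. -/
lemma cauchySol_congr {q' : ℝ → ℂ} (hqq : EqOn q q' (Icc 0 Real.pi)) (a b lam : ℂ) :
    cauchySol M q a b lam = cauchySol M q' a b lam := by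
  have : (fun y => IsSolution M q lam y ∧ y 0 = a ∧ der y 0 = b) =
      fun y => IsSolution M q' lam y ∧ y 0 = a ∧ der y 0 = b := by
    ext y
    exact and_congr_left fun _ => ⟨fun h => h.congr_potential hqq,
      fun h => h.congr_potential hqq.symm⟩
  rw [cauchySol, cauchySol, this]

lemma isSolution_solC (hM : IntegrableOn (fun p : ℝ × ℝ => M p.1 p.2) triangle)
    (hq : ContinuousOn q (Icc 0 Real.pi)) (lam : ℂ) :
    IsSolution M q lam (solC M q lam) ∧ solC M q lam 0 = 1 ∧ der (solC M q lam) 0 = 0 :=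
  isSolution_cauchySol hM hq 1 0 lam

lemma isSolution_solS (hM : IntegrableOn (fun p : ℝ × ℝ => M p.1 p.2) triangle)
    (hq : ContinuousOn q (Icc 0 Real.pi)) (lam : ℂ) :
    IsSolution M q lam (solS M q lam) ∧ solS M q lam 0 = 0 ∧ der (solS M q lam) 0 = 1 :=
  isSolution_cauchySol hM hq 0 1 lam

lemma isSolution_combination (hM : IntegrableOn (fun p : ℝ × ℝ => M p.1 p.2) triangle)
    (hq : ContinuousOn q (Icc 0 Real.pi)) (a b lam : ℂ) :
    IsSolution M q lam (fun x => a * solC M q lam x + b * solS M q lam x) ∧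
      a * solC M q lam 0 + b * solS M q lam 0 = a ∧
      der (fun x => a * solC M q lam x + b * solS M q lam x) 0 = b := by
  obtain ⟨hC, hC0, hC1⟩ := isSolution_solC hM hq lam
  obtain ⟨hS, hS0, hS1⟩ := isSolution_solS hM hq lam
  obtain ⟨h, hd⟩ := (hC.const_mul a).1.add hM hq (hS.const_mul b).1
  rw [(hC.const_mul a).2, (hS.const_mul b).2, hC1, hS1] at hd
  exact ⟨h, by rw [hC0, hS0]; ring, by rw [hd]; ring⟩

lemma IsSolution.eq_combination (hM : IntegrableOn (fun p : ℝ × ℝ => M p.1 p.2) triangle)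
    (hq : ContinuousOn q (Icc 0 Real.pi)) (h : IsSolution M q lam y) {x : ℝ}
    (hx : x ∈ Icc (0 : ℝ) Real.pi) :
    y x = y 0 * solC M q lam x + der y 0 * solS M q lam x := by
  obtain ⟨h', h0, h1⟩ := isSolution_combination hM hq (y 0) (der y 0) lam
  exact h.eqOn hM hq h' h0.symm h1.symm hx

lemma der_eq_zero
    (h0 : ∀ x ∈ Icc (0 : ℝ) Real.pi, y x = 0) : der y 0 = 0 := by
  have h1 : HasDerivWithinAt y 0 (Icc 0 Real.pi) 0 :=
    (hasDerivWithinAt_const _ _ (0 : ℂ)).congr h0 (h0 0 zero_mem_Icc_pi)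
  exact h1.derivWithin (uniqueDiffOn_Icc_pi 0 zero_mem_Icc_pi)

lemma isEigenvalue1_iff (hM : IntegrableOn (fun p : ℝ × ℝ => M p.1 p.2) triangle)
    (hq : ContinuousOn q (Icc 0 Real.pi)) (lam : ℂ) :
    IsEigenvalue1 M q lam ↔ Delta1 M q lam = 0 := by
  obtain ⟨hS, hS0, hS1⟩ := isSolution_solS hM hq lam
  constructor
  · rintro ⟨y, hy, y0, yp, x, hx, hne⟩
    have h1 := hy.eq_combination hM hq pi_mem_Icc_pi
    rw [yp, y0, zero_mul, zero_add] at h1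
    refine (mul_eq_zero.1 h1.symm).resolve_left fun h => hne ?_
    rw [hy.eq_combination hM hq hx, y0, h]; ring
  · intro h
    refine ⟨solS M q lam, hS, hS0, h, ?_⟩
    -- S cannot vanish identically on [0, π], because S'(0) = 1.
    by_contra! hcon
    exact one_ne_zero (hS1.symm.trans (der_eq_zero hcon))

lemma isEigenvalue2_iff (hM : IntegrableOn (fun p : ℝ × ℝ => M p.1 p.2) triangle)
    (hq : ContinuousOn q (Icc 0 Real.pi)) (lam : ℂ) :
    IsEigenvalue2 M q lam ↔ Delta2 M q lam = 0 := by
  obtain ⟨hC, hC0, hC1⟩ := isSolution_solC hM hq lam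
  constructor
  · rintro ⟨y, hy, y0, yp, x, hx, hne⟩
    have h1 := hy.eq_combination hM hq pi_mem_Icc_pi
    rw [yp, y0, zero_mul, add_zero] at h1
    refine (mul_eq_zero.1 h1.symm).resolve_left fun h => hne ?_
    rw [hy.eq_combination hM hq hx, y0, h]; ring
  · intro h
    refine ⟨solC M q lam, hC, hC1, h, 0, zero_mem_Icc_pi, ?_⟩
    rw [hC0]; exact one_ne_zero

lemma exists_weylSolution (hM : IntegrableOn (fun p : ℝ × ℝ => M p.1 p.2) triangle)
    (hq : ContinuousOn q (Icc 0 Real.pi)) (h : Delta1 M q lam ≠ 0) :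
    ∃ y, IsSolution M q lam y ∧ y 0 = 1 ∧ y Real.pi = 0 := by
  obtain ⟨h', h0, -⟩ := isSolution_combination hM hq 1 (weylN M q lam) lam
  refine ⟨_, h', h0, ?_⟩
  rw [weylN]
  change 1 * Delta2 M q lam + _ * Delta1 M q lam = 0
  rw [div_mul_cancel₀ _ h]; ring

lemma IsSolution.der_eq_weylN (hM : IntegrableOn (fun p : ℝ × ℝ => M p.1 p.2) triangle)
    (hq : ContinuousOn q (Icc 0 Real.pi)) (h : Delta1 M q lam ≠ 0) (hy : IsSolution M q lam y)
    (h0 : y 0 = 1) (hp : y Real.pi = 0) : der y 0 = weylN M q lam := by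
  have h1 := hy.eq_combination hM hq pi_mem_Icc_pi
  rw [hp, h0] at h1
  change 0 = 1 * Delta2 M q lam + der y 0 * Delta1 M q lam at h1
  rw [weylN, eq_div_iff h]
  linear_combination -h1

lemma differentiable_Delta1 (hM : IntegrableOn (fun p : ℝ × ℝ => M p.1 p.2) triangle)
    (hq : ContinuousOn q (Icc 0 Real.pi)) : Differentiable ℂ (Delta1 M q) :=
  differentiable_cauchySol_pi hM hq 0 1

lemma differentiable_Delta2 (hM : IntegrableOn (fun p : ℝ × ℝ => M p.1 p.2) triangle)
    (hq : ContinuousOn q (Icc 0 Real.pi)) : Differentiable ℂ (Delta2 M q) :=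
  differentiable_cauchySol_pi hM hq 1 0

end IntegroDiff
-- Asymptotics of solutions for large ρ.
namespace IntegroDiff

variable {M : ℝ → ℝ → ℂ} {q y z : ℝ → ℂ} {lam ρ : ℂ}

lemma hasDerivAt_sin_mul_sub (ρ : ℂ) (c s : ℝ) :
    HasDerivAt (fun s : ℝ => Complex.sin (ρ * (c - s))) (-(ρ * Complex.cos (ρ * (c - s)))) s := by
  have h1 : HasDerivAt (fun s : ℝ => ρ * ((c : ℂ) - (s : ℂ))) (-ρ) s := by
    have := ((Complex.ofRealCLM.hasDerivAt (x := s)).const_sub (c : ℂ)).const_mul ρ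
    simpa using this
  convert! (Complex.hasDerivAt_sin _).comp s h1 using 1
  ring

lemma hasDerivAt_cos_mul_sub (ρ : ℂ) (c s : ℝ) :
    HasDerivAt (fun s : ℝ => Complex.cos (ρ * (c - s))) (ρ * Complex.sin (ρ * (c - s))) s := by
  have h1 : HasDerivAt (fun s : ℝ => ρ * ((c : ℂ) - (s : ℂ))) (-ρ) s := by
    have := ((Complex.ofRealCLM.hasDerivAt (x := s)).const_sub (c : ℂ)).const_mul ρ
    simpa using this
  convert! (Complex.hasDerivAt_cos _).comp s h1 using 1
  ring

lemma eq_add_integral_subinterval {f f' : ℝ → ℂ} (hf' : IntervalIntegrable f' volume 0 Real.pi)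
    (hf : ∀ x ∈ Icc (0 : ℝ) Real.pi, f x = f 0 + ∫ s in (0 : ℝ)..x, f' s) {a b : ℝ} (ha : 0 ≤ a)
    (hb : b ≤ Real.pi) {x : ℝ} (hx : x ∈ Icc a b) : f x = f a + ∫ s in a..x, f' s := by
  have ha' : a ∈ Icc (0 : ℝ) Real.pi := ⟨ha, hx.1.trans (hx.2.trans hb)⟩
  have hx' : x ∈ Icc (0 : ℝ) Real.pi := ⟨ha.trans hx.1, hx.2.trans hb⟩
  rw [hf x hx', hf a ha', ← intervalIntegral.integral_add_adjacent_intervals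
    (intervalIntegrable_sub_interval hf' zero_mem_Icc_pi ha')
    (intervalIntegrable_sub_interval hf' ha' hx')]
  ring

/-- The identity of Lagrange for a solution and the functions `sin (ρ (c - x))`. -/
lemma IsSolution.integral_force_mul_sin (h : IsSolution M q (ρ ^ 2) y) (c : ℝ) {a b : ℝ}
    (ha : 0 ≤ a) (hab : a ≤ b) (hb : b ≤ Real.pi) :
    ∫ s in a..b, force M q y s * Complex.sin (ρ * (c - s)) =
      (der y b * Complex.sin (ρ * (c - b)) + ρ * y b * Complex.cos (ρ * (c - b))) -
      (der y a * Complex.sin (ρ * (c - a)) + ρ * y a * Complex.cos (ρ * (c - a))) := by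
  have hsub : Icc a b ⊆ Icc 0 Real.pi := Icc_subset_Icc ha hb
  have ha' : a ∈ Icc (0 : ℝ) Real.pi := hsub ⟨le_rfl, hab⟩
  have hb' : b ∈ Icc (0 : ℝ) Real.pi := hsub ⟨hab, le_rfl⟩
  have hF : IntervalIntegrable (force M (fun s => q s - ρ ^ 2) y) volume 0 Real.pi := h.2.1
  have hd : IntervalIntegrable (der y) volume 0 Real.pi :=
    intervalIntegrable_of_continuousOn h.continuousOn_der
  have hs : Continuous fun s : ℝ => Complex.sin (ρ * (c - s)) := by fun_prop
  have hc : Continuous fun s : ℝ => Complex.cos (ρ * (c - s)) := by fun_prop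
  have hdc : ContinuousOn (der y) (uIcc a b) :=
    h.continuousOn_der.mono (by rw [uIcc_of_le hab]; exact hsub)
  have hyc : ContinuousOn y (uIcc a b) :=
    h.continuousOn.mono (by rw [uIcc_of_le hab]; exact hsub)
  have hF' := intervalIntegrable_sub_interval hF ha' hb'
  have hd' := intervalIntegrable_sub_interval hd ha' hb'
  -- The product rule is used twice, for y' sin and for y ρ cos. In the sum the cross terms y' ρ cos
  -- cancel, and the ρ² y in the second absorbs the spectral parameter of the equation.
  have h1 := integral_product_rule hab hF'
    (fun x hx => eq_add_integral_subinterval hF (fun x hx => h.der_eq hx) ha hb hx)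
    (v := fun s : ℝ => Complex.sin (ρ * (c - s)))
    (v' := fun s : ℝ => -(ρ * Complex.cos (ρ * (c - s))))
    (fun x _ => (hasDerivAt_sin_mul_sub ρ c x).hasDerivWithinAt)
    (by fun_prop)
  have h2 := integral_product_rule hab hd'
    (fun x hx => eq_add_integral_subinterval hd (fun x hx =>
      eq_add_integral_of_hasDerivWithinAt (fun x hx => h.hasDerivWithinAt hx)
        h.continuousOn_der hx) ha hb hx)
    (v := fun s : ℝ => ρ * Complex.cos (ρ * (c - s)))
    (v' := fun s : ℝ => ρ * (ρ * Complex.sin (ρ * (c - s))))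
    (fun x _ => ((hasDerivAt_cos_mul_sub ρ c x).const_mul ρ).hasDerivWithinAt)
    (by fun_prop)
  have i1 : IntervalIntegrable (fun s => force M (fun s => q s - ρ ^ 2) y s *
      Complex.sin (ρ * (c - s)) + der y s * -(ρ * Complex.cos (ρ * (c - s)))) volume a b :=
    (hF'.mul_continuousOn hs.continuousOn).add
      (hdc.mul (by fun_prop : Continuous _).continuousOn).intervalIntegrable
  have i2 : IntervalIntegrable (fun s => der y s * (ρ * Complex.cos (ρ * (c - s))) +
      y s * (ρ * (ρ * Complex.sin (ρ * (c - s))))) volume a b :=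
    ((hdc.mul (by fun_prop : Continuous _).continuousOn).add
      (hyc.mul (by fun_prop : Continuous _).continuousOn)).intervalIntegrable
  have h3 : ∫ s in a..b, force M q y s * Complex.sin (ρ * (c - s)) =
      (∫ s in a..b, (force M (fun s => q s - ρ ^ 2) y s *
        Complex.sin (ρ * (c - s)) + der y s * -(ρ * Complex.cos (ρ * (c - s))))) +
      ∫ s in a..b, (der y s * (ρ * Complex.cos (ρ * (c - s))) +
        y s * (ρ * (ρ * Complex.sin (ρ * (c - s))))) := by
    rw [← intervalIntegral.integral_add i1 i2]
    congr 1; ext s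
    rw [force_sub_const]; ring
  rw [h3, h1, h2]; ring

lemma norm_exp_I_mul (z : ℂ) : ‖Complex.exp (Complex.I * z)‖ = Real.exp (-z.im) := by
  rw [Complex.norm_exp]; simp

lemma norm_sin_le (z : ℂ) : ‖Complex.sin z‖ ≤ Real.exp |z.im| := by
  have h1 : Complex.sin z = (Complex.exp (-z * Complex.I) - Complex.exp (z * Complex.I)) *
      Complex.I / 2 := rfl
  rw [h1, norm_div, norm_mul, Complex.norm_I, mul_one, Complex.norm_ofNat, div_le_iff₀ two_pos]
  refine (norm_sub_le _ _).trans ?_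
  rw [Complex.norm_exp, Complex.norm_exp, mul_two]
  refine add_le_add (Real.exp_le_exp.2 ?_) (Real.exp_le_exp.2 ?_)
  · simpa using le_abs_self _
  · simpa using neg_le_abs _

lemma norm_cos_le (z : ℂ) : ‖Complex.cos z‖ ≤ Real.exp |z.im| := by
  have h1 : Complex.cos z = (Complex.exp (z * Complex.I) + Complex.exp (-z * Complex.I)) / 2 := rfl
  rw [h1, norm_div, Complex.norm_ofNat, div_le_iff₀ two_pos]
  refine (norm_add_le _ _).trans ?_
  rw [Complex.norm_exp, Complex.norm_exp, mul_two]
  refine add_le_add (Real.exp_le_exp.2 ?_) (Real.exp_le_exp.2 ?_)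
  · simpa using neg_le_abs _
  · simpa using le_abs_self _

lemma norm_sin_mul_le (ρ : ℂ) {x : ℝ} (hx : 0 ≤ x) :
    ‖Complex.sin (ρ * x)‖ ≤ Real.exp (|ρ.im| * x) := by
  have := norm_sin_le (ρ * x)
  rwa [Complex.im_mul_ofReal, abs_mul, abs_of_nonneg hx] at this

lemma norm_cos_mul_le (ρ : ℂ) {x : ℝ} (hx : 0 ≤ x) :
    ‖Complex.cos (ρ * x)‖ ≤ Real.exp (|ρ.im| * x) := by
  have := norm_cos_le (ρ * x)
  rwa [Complex.im_mul_ofReal, abs_mul, abs_of_nonneg hx] at this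

/-- An absorption argument. Let Y be the maximum of the weighted |y|, which is attained by
compactness; evaluating the perturbation bound there gives Y ≤ A + κY, so Y ≤ 2A when κ ≤ 1/2. -/
lemma norm_le_of_perturbation {y y₀ : ℝ → ℂ} (hy : ContinuousOn y (Icc 0 Real.pi))
    {A α κ : ℝ} (hκ : κ ≤ 1 / 2)
    (h0 : ∀ x ∈ Icc (0 : ℝ) Real.pi, ‖y₀ x‖ ≤ A * Real.exp (α * x))
    (h : ∀ Y : ℝ, (∀ x ∈ Icc (0 : ℝ) Real.pi, ‖y x‖ ≤ Y * Real.exp (α * x)) →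
      ∀ x ∈ Icc (0 : ℝ) Real.pi, ‖y x - y₀ x‖ ≤ κ * Y * Real.exp (α * x)) :
    ∀ x ∈ Icc (0 : ℝ) Real.pi, ‖y x‖ ≤ 2 * A * Real.exp (α * x) := by
  obtain ⟨x₀, hx₀, hmax⟩ := isCompact_Icc.exists_isMaxOn (nonempty_Icc.2 Real.pi_pos.le)
    (f := fun x => ‖y x‖ * Real.exp (-(α * x))) (hy.norm.mul (by fun_prop))
  set Y := ‖y x₀‖ * Real.exp (-(α * x₀)) with hYdef
  have hY0 : 0 ≤ Y := by positivity
  have key : ∀ x, ‖y x‖ * Real.exp (-(α * x)) * Real.exp (α * x) = ‖y x‖ := fun x => by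
    rw [mul_assoc, ← Real.exp_add]; simp
  have hY : ∀ x ∈ Icc (0 : ℝ) Real.pi, ‖y x‖ ≤ Y * Real.exp (α * x) := fun x hx => by
    rw [← key x]
    gcongr
    exact hmax hx
  have hYA : Y ≤ 2 * A := by
    have h1 := h Y hY x₀ hx₀
    have h2 := h0 x₀ hx₀
    have h3 : ‖y x₀‖ ≤ A * Real.exp (α * x₀) + κ * Y * Real.exp (α * x₀) := by
      calc ‖y x₀‖ = ‖y₀ x₀ + (y x₀ - y₀ x₀)‖ := by congr 1; ring
        _ ≤ _ := (norm_add_le _ _).trans (add_le_add h2 h1)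
    have h4 : Y * Real.exp (α * x₀) ≤ (A + κ * Y) * Real.exp (α * x₀) := by
      rw [hYdef, key x₀, add_mul]; exact h3
    have h5 := le_of_mul_le_mul_right h4 (Real.exp_pos _)
    nlinarith
  intro x hx
  exact (hY x hx).trans (by gcongr)

/-- The solution with the same Cauchy data of `-y'' = ρ² y`. -/
noncomputable def freeSol (ρ a b : ℂ) (x : ℝ) : ℂ :=
  a * Complex.cos (ρ * x) + b * (Complex.sin (ρ * x) / ρ)

lemma IsSolution.eq_freeSol_add (h : IsSolution M q (ρ ^ 2) y) (hρ : ρ ≠ 0) {x : ℝ}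
    (hx : x ∈ Icc (0 : ℝ) Real.pi) :
    y x - freeSol ρ (y 0) (der y 0) x =
      (∫ s in (0 : ℝ)..x, force M q y s * Complex.sin (ρ * (x - s))) / ρ := by
  rw [h.integral_force_mul_sin x le_rfl hx.1 hx.2, freeSol, eq_div_iff hρ]
  simp only [sub_self, mul_zero, Complex.sin_zero, Complex.cos_zero, Complex.ofReal_zero, sub_zero]
  field_simp
  ring

/-- Variation of constants with kernel sin(ρ(x - s))/ρ. The weights e^{|Im ρ|s} and e^{|Im ρ|(x -
s)} multiply exactly to e^{|Im ρ|x}, so each application costs a factor mass/|ρ|, at most 1/2 under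
the hypothesis on ρ. -/
lemma IsSolution.norm_sub_freeSol_le (hM : IntegrableOn (fun p : ℝ × ℝ => M p.1 p.2) triangle)
    (hq : ContinuousOn q (Icc 0 Real.pi)) (h : IsSolution M q (ρ ^ 2) y) (hρ : ρ ≠ 0)
    (hρK : 2 * totalMass M q ≤ ‖ρ‖) {A : ℝ}
    (hA : ∀ x ∈ Icc (0 : ℝ) Real.pi,
      ‖freeSol ρ (y 0) (der y 0) x‖ ≤ A * Real.exp (|ρ.im| * x)) {x : ℝ}
    (hx : x ∈ Icc (0 : ℝ) Real.pi) :
    ‖y x - freeSol ρ (y 0) (der y 0) x‖ ≤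
      2 * A * totalMass M q / ‖ρ‖ * Real.exp (|ρ.im| * x) := by
  have hρ' : 0 < ‖ρ‖ := norm_pos_iff.2 hρ
  have hstep : ∀ Y : ℝ, (∀ x ∈ Icc (0 : ℝ) Real.pi, ‖y x‖ ≤ Y * Real.exp (|ρ.im| * x)) →
      ∀ x ∈ Icc (0 : ℝ) Real.pi, ‖y x - freeSol ρ (y 0) (der y 0) x‖ ≤
        totalMass M q / ‖ρ‖ * Y * Real.exp (|ρ.im| * x) := by
    intro Y hY x hx
    rw [h.eq_freeSol_add hρ hx, norm_div, div_le_iff₀ hρ']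
    have h1 := norm_integral_force_mul_le hM hq (v := fun s : ℝ => Complex.sin (ρ * (x - s)))
      (abs_nonneg ρ.im) hY le_rfl hx.1 hx.2 (Real.exp_pos (|ρ.im| * x)).le (fun s hs => by
        have h2 := norm_sin_mul_le ρ (sub_nonneg.2 hs.2)
        rw [Complex.ofReal_sub] at h2
        calc _ ≤ Real.exp (|ρ.im| * s) * Real.exp (|ρ.im| * (x - s)) := by gcongr
          _ = Real.exp (|ρ.im| * x) := by rw [← Real.exp_add]; ring_nf)
    refine h1.trans (le_of_eq ?_)
    field_simp
  have hbound := norm_le_of_perturbation h.continuousOn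
    (by rw [div_le_div_iff₀ hρ' two_pos]; linarith) hA hstep
  exact (hstep (2 * A) hbound x hx).trans (le_of_eq (by ring))

lemma norm_solS_sub_le (hM : IntegrableOn (fun p : ℝ × ℝ => M p.1 p.2) triangle)
    (hq : ContinuousOn q (Icc 0 Real.pi)) (hρ : ρ ≠ 0)
    (hρK : 2 * totalMass M q ≤ ‖ρ‖) {x : ℝ} (hx : x ∈ Icc (0 : ℝ) Real.pi) :
    ‖ρ * solS M q (ρ ^ 2) x - Complex.sin (ρ * x)‖ ≤
      2 * totalMass M q / ‖ρ‖ * Real.exp (|ρ.im| * x) := by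
  obtain ⟨h, h0, h1⟩ := isSolution_solS hM hq (ρ ^ 2)
  have hρ' : 0 < ‖ρ‖ := norm_pos_iff.2 hρ
  have h2 := h.norm_sub_freeSol_le hM hq hρ hρK (A := 1 / ‖ρ‖) (fun x hx => by
    rw [h0, h1, freeSol, zero_mul, zero_add, one_mul, norm_div, div_mul_eq_mul_div, one_mul]
    gcongr
    exact norm_sin_mul_le ρ hx.1) hx
  rw [h0, h1, freeSol, zero_mul, zero_add, one_mul] at h2
  have h3 : ρ * solS M q (ρ ^ 2) x - Complex.sin (ρ * x) =
      ρ * (solS M q (ρ ^ 2) x - Complex.sin (ρ * x) / ρ) := by field_simp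
  rw [h3, norm_mul]
  calc _ ≤ ‖ρ‖ * (2 * (1 / ‖ρ‖) * totalMass M q / ‖ρ‖ * Real.exp (|ρ.im| * x)) := by gcongr
    _ = _ := by field_simp

lemma norm_solC_sub_le (hM : IntegrableOn (fun p : ℝ × ℝ => M p.1 p.2) triangle)
    (hq : ContinuousOn q (Icc 0 Real.pi)) (hρ : ρ ≠ 0)
    (hρK : 2 * totalMass M q ≤ ‖ρ‖) {x : ℝ} (hx : x ∈ Icc (0 : ℝ) Real.pi) :
    ‖solC M q (ρ ^ 2) x - Complex.cos (ρ * x)‖ ≤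
      2 * totalMass M q / ‖ρ‖ * Real.exp (|ρ.im| * x) := by
  obtain ⟨h, h0, h1⟩ := isSolution_solC hM hq (ρ ^ 2)
  have h2 := h.norm_sub_freeSol_le hM hq hρ hρK (A := 1) (fun x hx => by
    rw [h0, h1, freeSol, zero_mul, add_zero, one_mul, one_mul]
    exact norm_cos_mul_le ρ hx.1) hx
  rw [h0, h1, freeSol, zero_mul, add_zero, one_mul, mul_one] at h2
  exact h2

lemma le_norm_sin (z : ℂ) : (Real.exp |z.im| - Real.exp (-|z.im|)) / 2 ≤ ‖Complex.sin z‖ := by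
  have h1 : Complex.sin z = (Complex.exp (-z * Complex.I) - Complex.exp (z * Complex.I)) *
      Complex.I / 2 := rfl
  rw [h1, norm_div, norm_mul, Complex.norm_I, mul_one, Complex.norm_ofNat]
  gcongr
  have h2 := abs_norm_sub_norm_le (Complex.exp (-z * Complex.I)) (Complex.exp (z * Complex.I))
  rw [Complex.norm_exp, Complex.norm_exp] at h2
  have e1 : (-z * Complex.I).re = z.im := by simp
  have e2 : (z * Complex.I).re = -z.im := by simp
  rw [e1, e2] at h2
  refine le_trans ?_ h2
  rcases abs_cases z.im with ⟨h, -⟩ | ⟨h, -⟩ <;> rw [h]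
  · exact le_abs_self _
  · rw [neg_neg, ← neg_sub]; exact neg_le_abs _

lemma le_norm_cos (z : ℂ) : (Real.exp |z.im| - Real.exp (-|z.im|)) / 2 ≤ ‖Complex.cos z‖ := by
  have h1 : Complex.cos z = (Complex.exp (z * Complex.I) + Complex.exp (-z * Complex.I)) / 2 := rfl
  rw [h1, norm_div, Complex.norm_ofNat]
  gcongr
  have h2 := abs_norm_sub_norm_le (Complex.exp (z * Complex.I)) (-Complex.exp (-z * Complex.I))
  rw [norm_neg, sub_neg_eq_add, Complex.norm_exp, Complex.norm_exp] at h2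
  have e1 : (-z * Complex.I).re = z.im := by simp
  have e2 : (z * Complex.I).re = -z.im := by simp
  rw [e1, e2] at h2
  refine le_trans ?_ h2
  rcases abs_cases z.im with ⟨h, -⟩ | ⟨h, -⟩ <;> rw [h]
  · rw [← neg_sub]; exact neg_le_abs _
  · rw [neg_neg]; exact le_abs_self _

lemma exp_div_four_le {v : ℝ} (hv : 1 ≤ v) :
    Real.exp v / 4 ≤ (Real.exp v - Real.exp (-v)) / 2 := by
  have h1 : 2 ≤ Real.exp v := by linarith [Real.add_one_le_exp v]
  have h2 : Real.exp (-v) ≤ 1 := Real.exp_le_one_iff.2 (by linarith)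
  linarith

lemma abs_im_mul_pi (ρ : ℂ) : |(ρ * Real.pi : ℂ).im| = |ρ.im| * Real.pi := by
  rw [Complex.im_mul_ofReal, abs_mul, abs_of_pos Real.pi_pos]

lemma one_le_mul_pi {t : ℝ} (ht : 1 ≤ t) : 1 ≤ t * Real.pi := by
  nlinarith [Real.pi_gt_three]

lemma le_norm_sin_mul_pi (hρ : 1 ≤ |ρ.im|) :
    Real.exp (|ρ.im| * Real.pi) / 4 ≤ ‖Complex.sin (ρ * Real.pi)‖ := by
  have h := le_norm_sin (ρ * Real.pi)
  rw [abs_im_mul_pi] at h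
  exact (exp_div_four_le (one_le_mul_pi hρ)).trans h

lemma le_norm_cos_mul_pi (hρ : 1 ≤ |ρ.im|) :
    Real.exp (|ρ.im| * Real.pi) / 4 ≤ ‖Complex.cos (ρ * Real.pi)‖ := by
  have h := le_norm_cos (ρ * Real.pi)
  rw [abs_im_mul_pi] at h
  exact (exp_div_four_le (one_le_mul_pi hρ)).trans h

/-- The factor 16 makes the relative error 1/8, half of the lower bound 1/4 available for the sine
away from its zeros. -/
lemma norm_Delta1_sub_le (hM : IntegrableOn (fun p : ℝ × ℝ => M p.1 p.2) triangle)
    (hq : ContinuousOn q (Icc 0 Real.pi)) (hρ : ρ ≠ 0) (hρK : 16 * totalMass M q ≤ ‖ρ‖) :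
    ‖ρ * Delta1 M q (ρ ^ 2) - Complex.sin (ρ * Real.pi)‖ ≤
      Real.exp (|ρ.im| * Real.pi) / 8 := by
  have hK : 0 ≤ totalMass M q := totalMass_nonneg
  have hρ' : 0 < ‖ρ‖ := norm_pos_iff.2 hρ
  refine (norm_solS_sub_le hM hq hρ (by linarith) pi_mem_Icc_pi).trans ?_
  have : 2 * totalMass M q / ‖ρ‖ ≤ 1 / 8 := by
    rw [div_le_div_iff₀ hρ' (by norm_num)]; linarith
  calc _ ≤ 1 / 8 * Real.exp (|ρ.im| * Real.pi) := by gcongr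
    _ = _ := by ring

lemma le_norm_Delta1 (hM : IntegrableOn (fun p : ℝ × ℝ => M p.1 p.2) triangle)
    (hq : ContinuousOn q (Icc 0 Real.pi)) (hρ : ρ ≠ 0) (hρK : 16 * totalMass M q ≤ ‖ρ‖)
    (hs : Real.exp (|ρ.im| * Real.pi) / 4 ≤ ‖Complex.sin (ρ * Real.pi)‖) :
    Real.exp (|ρ.im| * Real.pi) / 8 ≤ ‖ρ * Delta1 M q (ρ ^ 2)‖ := by
  have h1 := norm_Delta1_sub_le hM hq hρ hρK
  have h2 := norm_sub_norm_le (Complex.sin (ρ * Real.pi)) (ρ * Delta1 M q (ρ ^ 2))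
  rw [norm_sub_rev] at h2
  linarith

lemma Delta1_ne_zero (hM : IntegrableOn (fun p : ℝ × ℝ => M p.1 p.2) triangle)
    (hq : ContinuousOn q (Icc 0 Real.pi)) (hρ : 1 ≤ ρ.im) (hρK : 16 * totalMass M q ≤ ‖ρ‖) :
    Delta1 M q (ρ ^ 2) ≠ 0 := by
  intro h
  have hρ0 : ρ ≠ 0 := by rintro rfl; simp at hρ; linarith
  have h1 := le_norm_Delta1 hM hq hρ0 hρK (le_norm_sin_mul_pi (hρ.trans (le_abs_self _)))
  rw [h, mul_zero, norm_zero] at h1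
  linarith [Real.exp_pos (|ρ.im| * Real.pi)]

/-- The identity of Green for the solution vanishing at `π`. -/
lemma IsSolution.green_identity (h : IsSolution M q (ρ ^ 2) y) (h0 : y 0 = 1)
    (hp : y Real.pi = 0) {x : ℝ} (hx : x ∈ Icc (0 : ℝ) Real.pi) :
    ρ * (Complex.sin (ρ * Real.pi) * y x - Complex.sin (ρ * (Real.pi - x))) =
      (∫ s in (0 : ℝ)..x, force M q y s *
        (Complex.sin (ρ * (Real.pi - x)) * Complex.sin (ρ * ((0 : ℝ) - s)))) -
      ∫ s in x..Real.pi, force M q y s *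
        (Complex.sin (ρ * x) * Complex.sin (ρ * (Real.pi - s))) := by
  -- The sines centred at 0 and at π remove the unknowns y'(0) and y'(π). The combination with
  -- factors sin ρ(π - x) and sin ρx removes y'(x), and the addition theorem turns the coefficient
  -- of y(x) into ρ sin ρπ.
  have h1 := h.integral_force_mul_sin 0 le_rfl hx.1 hx.2
  have h2 := h.integral_force_mul_sin Real.pi hx.1 hx.2 le_rfl
  have e1 : ∫ s in (0 : ℝ)..x, force M q y s *
        (Complex.sin (ρ * (Real.pi - x)) * Complex.sin (ρ * ((0 : ℝ) - s))) =
      Complex.sin (ρ * (Real.pi - x)) *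
        ∫ s in (0 : ℝ)..x, force M q y s * Complex.sin (ρ * ((0 : ℝ) - s)) := by
    rw [← intervalIntegral.integral_const_mul]; congr 1; ext s; ring
  have e2 : ∫ s in x..Real.pi, force M q y s *
        (Complex.sin (ρ * x) * Complex.sin (ρ * (Real.pi - s))) =
      Complex.sin (ρ * x) *
        ∫ s in x..Real.pi, force M q y s * Complex.sin (ρ * (Real.pi - s)) := by
    rw [← intervalIntegral.integral_const_mul]; congr 1; ext s; ring
  have e3 : Complex.sin (ρ * Real.pi) = Complex.sin (ρ * x) * Complex.cos (ρ * (Real.pi - x)) +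
      Complex.cos (ρ * x) * Complex.sin (ρ * (Real.pi - x)) := by
    rw [← Complex.sin_add]; congr 1; ring
  rw [e1, e2, h1, h2, h0, hp, e3]
  simp only [Complex.ofReal_zero, zero_sub, mul_neg, Complex.sin_neg, Complex.cos_neg, mul_zero,
    sub_self, Complex.sin_zero, Complex.cos_zero, mul_one]
  ring

/-- The growing exponential e^{-iρ(π - x)} occurs in both terms and cancels; only e^{iρ(π ± x)}
survive. -/
lemma norm_sin_sub_exp_mul_sin_le (hρ : 0 ≤ ρ.im) {x : ℝ} (hx : x ∈ Icc (0 : ℝ) Real.pi) :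
    ‖Complex.sin (ρ * (Real.pi - x)) - Complex.exp (Complex.I * (ρ * x)) *
      Complex.sin (ρ * Real.pi)‖ ≤ Real.exp (-(ρ.im * (Real.pi - x))) := by
  have h1 : Complex.sin (ρ * (Real.pi - x)) - Complex.exp (Complex.I * (ρ * x)) *
      Complex.sin (ρ * Real.pi) =
      (Complex.exp (Complex.I * (ρ * (Real.pi + x : ℝ))) -
        Complex.exp (Complex.I * (ρ * (Real.pi - x : ℝ)))) * Complex.I / 2 := by
    have hs : ∀ z, Complex.sin z = (Complex.exp (-z * Complex.I) - Complex.exp (z * Complex.I)) *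
      Complex.I / 2 := fun z => rfl
    rw [hs, hs, show Complex.I * (ρ * (Real.pi + x : ℝ)) =
      Complex.I * (ρ * x) + ρ * Real.pi * Complex.I by push_cast; ring,
      show -(ρ * (Real.pi - x : ℂ)) * Complex.I =
        Complex.I * (ρ * x) + -(ρ * Real.pi) * Complex.I by ring,
      show ρ * (Real.pi - x : ℂ) * Complex.I = Complex.I * (ρ * (Real.pi - x : ℝ)) by
        push_cast; ring, Complex.exp_add, Complex.exp_add]
    ring
  rw [h1, norm_div, norm_mul, Complex.norm_I, mul_one, Complex.norm_ofNat, div_le_iff₀ two_pos]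
  refine (norm_sub_le _ _).trans ?_
  rw [norm_exp_I_mul, norm_exp_I_mul, Complex.im_mul_ofReal, Complex.im_mul_ofReal, mul_two]
  gcongr
  linarith [hx.1]

lemma exp_neg_le_inv {u : ℝ} (hu : 0 < u) : Real.exp (-u) ≤ 1 / u := by
  rw [Real.exp_neg, ← one_div]
  gcongr
  linarith [Real.add_one_le_exp u]

/-- The solution with `y(0) = 1`, `y(π) = 0` is close to `exp (iρx)` in the upper half-plane. -/
lemma IsSolution.norm_weylSolution_sub_le
    (hM : IntegrableOn (fun p : ℝ × ℝ => M p.1 p.2) triangle)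
    (hq : ContinuousOn q (Icc 0 Real.pi)) (h : IsSolution M q (ρ ^ 2) y) (h0 : y 0 = 1)
    (hp : y Real.pi = 0) (hρ : 1 ≤ ρ.im) (hρK : 16 * totalMass M q ≤ ‖ρ‖) {x : ℝ}
    (hx : x ∈ Icc (0 : ℝ) Real.pi) :
    ‖y x‖ ≤ 8 ∧
      ‖y x - Complex.exp (Complex.I * (ρ * x))‖ ≤ (64 * totalMass M q + 4) / ρ.im := by
  have hK : 0 ≤ totalMass M q := totalMass_nonneg
  have him : |ρ.im| = ρ.im := abs_of_nonneg (by linarith)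
  have hle : ρ.im ≤ ‖ρ‖ := him ▸ Complex.abs_im_le_norm ρ
  have hτ : 0 < ρ.im := by linarith
  have hρ' : 0 < ‖ρ‖ := by linarith
  have hρ0 : ρ ≠ 0 := norm_pos_iff.1 hρ'
  have hsin := le_norm_sin_mul_pi (ρ := ρ) (by rw [him]; exact hρ)
  rw [him] at hsin
  have hE : 0 < Real.exp (ρ.im * Real.pi) := Real.exp_pos _
  have hsin0 : Complex.sin (ρ * Real.pi) ≠ 0 := norm_pos_iff.1 (by linarith)
  -- The solution of the unperturbed equation with the same two boundary values.
  set y₀ : ℝ → ℂ := fun x => Complex.sin (ρ * (Real.pi - x)) / Complex.sin (ρ * Real.pi) with hy₀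
  have hsx : ∀ x ∈ Icc (0 : ℝ) Real.pi,
      ‖Complex.sin (ρ * (Real.pi - x))‖ ≤ Real.exp (ρ.im * (Real.pi - x)) := fun x hx => by
    have := norm_sin_mul_le ρ (sub_nonneg.2 hx.2)
    rwa [Complex.ofReal_sub, him] at this
  have hsx' : ∀ x ∈ Icc (0 : ℝ) Real.pi,
      ‖Complex.sin (ρ * x)‖ ≤ Real.exp (ρ.im * x) := fun x hx => by
    have := norm_sin_mul_le ρ hx.1
    rwa [him] at this
  -- The weight has exponent 0 although y₀ decays: a decreasing weight is not compatible with the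
  -- memory integral, which carries values near 0 to every later x.
  have hb0 : ∀ x ∈ Icc (0 : ℝ) Real.pi, ‖y₀ x‖ ≤ 4 * Real.exp (0 * x) := fun x hx => by
    rw [zero_mul, Real.exp_zero, mul_one, hy₀]
    simp only [norm_div]
    rw [div_le_iff₀ (norm_pos_iff.2 hsin0)]
    have h1 : Real.exp (ρ.im * (Real.pi - x)) ≤ Real.exp (ρ.im * Real.pi) := by
      gcongr; linarith [hx.1]
    linarith [hsx x hx]
  have hstep : ∀ Y : ℝ, (∀ x ∈ Icc (0 : ℝ) Real.pi, ‖y x‖ ≤ Y * Real.exp (0 * x)) →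
      ∀ x ∈ Icc (0 : ℝ) Real.pi, ‖y x - y₀ x‖ ≤ 8 * totalMass M q / ‖ρ‖ * Y * Real.exp (0 * x) := by
    intro Y hY x hx
    have hY0 : 0 ≤ Y := by simpa using (norm_nonneg _).trans (hY x hx)
    have hg := h.green_identity h0 hp hx
    have hi1 := norm_integral_force_mul_le hM hq
      (v := fun s : ℝ => Complex.sin (ρ * (Real.pi - x)) * Complex.sin (ρ * ((0 : ℝ) - s)))
      le_rfl hY le_rfl hx.1 hx.2 hE.le (fun s hs => by
        have hs' : s ∈ Icc (0 : ℝ) Real.pi := ⟨hs.1, hs.2.trans hx.2⟩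
        have e1 : Complex.sin (ρ * ((0 : ℝ) - s)) = -Complex.sin (ρ * s) := by
          rw [← Complex.sin_neg]; congr 1; push_cast; ring
        rw [e1, zero_mul, Real.exp_zero, one_mul, norm_mul, norm_neg]
        calc _ ≤ Real.exp (ρ.im * (Real.pi - x)) * Real.exp (ρ.im * s) := by
              gcongr
              · exact hsx x hx
              · exact hsx' s hs'
          _ = Real.exp (ρ.im * (Real.pi - x + s)) := by rw [← Real.exp_add]; ring_nf
          _ ≤ _ := by gcongr; linarith [hs.2])
    have hi2 := norm_integral_force_mul_le hM hq
      (v := fun s : ℝ => Complex.sin (ρ * x) * Complex.sin (ρ * (Real.pi - s)))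
      le_rfl hY hx.1 hx.2 le_rfl hE.le (fun s hs => by
        have hs' : s ∈ Icc (0 : ℝ) Real.pi := ⟨hx.1.trans hs.1, hs.2⟩
        rw [zero_mul, Real.exp_zero, one_mul, norm_mul]
        calc _ ≤ Real.exp (ρ.im * x) * Real.exp (ρ.im * (Real.pi - s)) := by
              gcongr
              · exact hsx' x hx
              · exact hsx s hs'
          _ = Real.exp (ρ.im * (Real.pi - s + x)) := by rw [← Real.exp_add]; ring_nf
          _ ≤ _ := by gcongr; linarith [hs.1])
    have e2 : ρ * (Complex.sin (ρ * Real.pi) * y x - Complex.sin (ρ * (Real.pi - x))) =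
        ρ * Complex.sin (ρ * Real.pi) * (y x - y₀ x) := by
      simp only [hy₀]; field_simp
    have h3 : ‖ρ‖ * ‖Complex.sin (ρ * Real.pi)‖ * ‖y x - y₀ x‖ ≤
        2 * (totalMass M q * Y * Real.exp (ρ.im * Real.pi)) := by
      rw [← norm_mul, ← norm_mul, ← e2, hg, two_mul]
      exact (norm_sub_le _ _).trans (add_le_add hi1 hi2)
    have h4 : ‖ρ‖ * (Real.exp (ρ.im * Real.pi) / 4) * ‖y x - y₀ x‖ ≤
        2 * (totalMass M q * Y * Real.exp (ρ.im * Real.pi)) :=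
      le_trans (by gcongr) h3
    rw [zero_mul, Real.exp_zero, mul_one, div_mul_eq_mul_div, le_div_iff₀ hρ']
    refine le_of_mul_le_mul_right ?_ hE
    linarith
  -- Here κ = 8 · mass/|ρ|, and κ ≤ 1/2 is exactly |ρ| ≥ 16 · mass. The bound 4 for y₀ becomes 8 for
  -- y.
  have hbound := norm_le_of_perturbation h.continuousOn
    (by rw [div_le_div_iff₀ hρ' two_pos]; linarith) hb0 hstep
  have hdiff := hstep _ hbound x hx
  have hbx := hbound x hx
  rw [zero_mul, Real.exp_zero, mul_one] at hbx hdiff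
  refine ⟨by linarith, ?_⟩
  have h5 : ‖y₀ x - Complex.exp (Complex.I * (ρ * x))‖ ≤ 4 / ρ.im := by
    have e3 : y₀ x - Complex.exp (Complex.I * (ρ * x)) = (Complex.sin (ρ * (Real.pi - x)) -
        Complex.exp (Complex.I * (ρ * x)) * Complex.sin (ρ * Real.pi)) /
          Complex.sin (ρ * Real.pi) := by
      simp only [hy₀]; field_simp
    rw [e3, norm_div, div_le_iff₀ (norm_pos_iff.2 hsin0)]
    have h6 := norm_sin_sub_exp_mul_sin_le hτ.le hx
    have h7 : Real.exp (-(ρ.im * (Real.pi - x))) ≤ 1 :=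
      Real.exp_le_one_iff.2 (neg_nonpos.2 (mul_nonneg hτ.le (sub_nonneg.2 hx.2)))
    have h8 : ρ.im ≤ Real.exp (ρ.im * Real.pi) := by
      have := Real.add_one_le_exp (ρ.im * Real.pi)
      nlinarith [Real.pi_gt_three]
    calc _ ≤ 1 := h6.trans h7
      _ = 4 / ρ.im * (ρ.im / 4) := by field_simp
      _ ≤ 4 / ρ.im * ‖Complex.sin (ρ * Real.pi)‖ := by gcongr; linarith
  calc ‖y x - Complex.exp (Complex.I * (ρ * x))‖
      = ‖(y x - y₀ x) + (y₀ x - Complex.exp (Complex.I * (ρ * x)))‖ := by congr 1; ring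
    _ ≤ 8 * totalMass M q / ‖ρ‖ * (2 * 4) + 4 / ρ.im := (norm_add_le _ _).trans
        (add_le_add hdiff h5)
    _ ≤ 8 * totalMass M q / ρ.im * (2 * 4) + 4 / ρ.im := by gcongr
    _ = _ := by ring

/-- Ratios of the solution `S` are close to exponentials in the upper half-plane. -/
lemma norm_solS_div_sub_le (hM : IntegrableOn (fun p : ℝ × ℝ => M p.1 p.2) triangle)
    (hq : ContinuousOn q (Icc 0 Real.pi)) (hρ : 1 ≤ ρ.im) (hρK : 16 * totalMass M q ≤ ‖ρ‖)
    {x : ℝ} (hx : x ∈ Icc (0 : ℝ) Real.pi) :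
    ‖solS M q (ρ ^ 2) (Real.pi - x) / Delta1 M q (ρ ^ 2) - Complex.exp (Complex.I * (ρ * x))‖ ≤
      (8 + 32 * totalMass M q) / ρ.im * Real.exp (-(ρ.im / 2 * x)) := by
  have hK : 0 ≤ totalMass M q := totalMass_nonneg
  have him : |ρ.im| = ρ.im := abs_of_nonneg (by linarith)
  have hle : ρ.im ≤ ‖ρ‖ := him ▸ Complex.abs_im_le_norm ρ
  have hτ : 0 < ρ.im := by linarith
  have hρ' : 0 < ‖ρ‖ := by linarith
  have hρ0 : ρ ≠ 0 := norm_pos_iff.1 hρ'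
  have hD := le_norm_Delta1 hM hq hρ0 hρK (le_norm_sin_mul_pi (by rw [him]; exact hρ))
  have hD0 := Delta1_ne_zero hM hq hρ hρK
  have hx' : Real.pi - x ∈ Icc (0 : ℝ) Real.pi := ⟨by linarith [hx.2], by linarith [hx.1]⟩
  have h1 := norm_solS_sub_le hM hq hρ0 (by linarith) hx'
  have h2 := norm_solS_sub_le hM hq hρ0 (by linarith) pi_mem_Icc_pi
  have h3 := norm_sin_sub_exp_mul_sin_le hτ.le hx
  rw [him] at h1 h2 hD
  rw [Complex.ofReal_sub] at h1
  change ‖ρ * Delta1 M q (ρ ^ 2) - _‖ ≤ _ at h2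
  set E := Complex.exp (Complex.I * (ρ * x)) with hE
  have hEn : ‖E‖ = Real.exp (-(ρ.im * x)) := by rw [hE, norm_exp_I_mul, Complex.im_mul_ofReal]
  -- Three errors over a common denominator: numerator against its sine, the two sines against the
  -- exponential, and denominator against its sine.
  have e1 : solS M q (ρ ^ 2) (Real.pi - x) / Delta1 M q (ρ ^ 2) - E =
      ((ρ * solS M q (ρ ^ 2) (Real.pi - x) - Complex.sin (ρ * (Real.pi - x))) +
        (Complex.sin (ρ * (Real.pi - x)) - E * Complex.sin (ρ * Real.pi)) -
        E * (ρ * Delta1 M q (ρ ^ 2) - Complex.sin (ρ * Real.pi))) / (ρ * Delta1 M q (ρ ^ 2)) := by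
    field_simp; ring
  have hpos : 0 < ‖ρ * Delta1 M q (ρ ^ 2)‖ := norm_pos_iff.2 (mul_ne_zero hρ0 hD0)
  rw [e1, norm_div, div_le_iff₀ hpos]
  have h4 : ‖E * (ρ * Delta1 M q (ρ ^ 2) - Complex.sin (ρ * Real.pi))‖ ≤
      2 * totalMass M q / ‖ρ‖ * Real.exp (ρ.im * (Real.pi - x)) := by
    rw [norm_mul, hEn]
    calc _ ≤ Real.exp (-(ρ.im * x)) *
          (2 * totalMass M q / ‖ρ‖ * Real.exp (ρ.im * Real.pi)) := by gcongr
      _ = 2 * totalMass M q / ‖ρ‖ *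
          (Real.exp (-(ρ.im * x)) * Real.exp (ρ.im * Real.pi)) := by ring
      _ = _ := by rw [← Real.exp_add]; ring_nf
  have h5 : Real.exp (ρ.im * (Real.pi - x)) ≤
      Real.exp (ρ.im * Real.pi) * Real.exp (-(ρ.im / 2 * x)) := by
    rw [← Real.exp_add]
    gcongr
    nlinarith [mul_nonneg hτ.le hx.1]
  -- This term is 1 at x = π, so the full rate e^{-x Im ρ} would leave no gain there. Halving the
  -- rate frees a factor e^{-Im ρ} ≤ 1/Im ρ, because π > 2.
  have h6 : Real.exp (-(ρ.im * (Real.pi - x))) ≤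
      1 / ρ.im * (Real.exp (ρ.im * Real.pi) * Real.exp (-(ρ.im / 2 * x))) := by
    have h7 : Real.exp (-ρ.im) ≤ 1 / ρ.im := exp_neg_le_inv hτ
    calc _ ≤ Real.exp (-ρ.im + (ρ.im * Real.pi + -(ρ.im / 2 * x))) := by
          gcongr
          have := mul_nonneg hτ.le (sub_nonneg.2 hx.2)
          nlinarith [Real.pi_gt_three, hx.1, hx.2]
      _ = Real.exp (-ρ.im) * (Real.exp (ρ.im * Real.pi) * Real.exp (-(ρ.im / 2 * x))) := by
          rw [Real.exp_add, Real.exp_add]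
      _ ≤ _ := by gcongr
  have h8 : 2 * totalMass M q / ‖ρ‖ ≤ 2 * totalMass M q / ρ.im := by gcongr
  calc _ ≤ 2 * totalMass M q / ‖ρ‖ * Real.exp (ρ.im * (Real.pi - x)) +
        Real.exp (-(ρ.im * (Real.pi - x))) +
        2 * totalMass M q / ‖ρ‖ * Real.exp (ρ.im * (Real.pi - x)) :=
        (norm_sub_le _ _).trans (add_le_add ((norm_add_le _ _).trans (add_le_add h1 h3)) h4)
    _ ≤ 2 * totalMass M q / ρ.im * (Real.exp (ρ.im * Real.pi) * Real.exp (-(ρ.im / 2 * x))) +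
        1 / ρ.im * (Real.exp (ρ.im * Real.pi) * Real.exp (-(ρ.im / 2 * x))) +
        2 * totalMass M q / ρ.im * (Real.exp (ρ.im * Real.pi) * Real.exp (-(ρ.im / 2 * x))) := by
        gcongr
    _ = (8 + 32 * totalMass M q) / ρ.im * Real.exp (-(ρ.im / 2 * x)) *
        (Real.exp (ρ.im * Real.pi) / 8) := by ring
    _ ≤ _ := by gcongr

end IntegroDiff
-- The reflected adjoint equation and Lagrange's identity.
namespace IntegroDiff

variable {M : ℝ → ℝ → ℂ} {q q' y w z : ℝ → ℂ} {lam ρ : ℂ}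

/-- The kernel of the adjoint equation, after the reflection `x ↦ π - x`. -/
noncomputable def reflectKernel (M : ℝ → ℝ → ℂ) (x t : ℝ) : ℂ := M (Real.pi - t) (Real.pi - x)

/-- The reflection `x ↦ π - x` of a function. -/
noncomputable def reflect (q : ℝ → ℂ) (x : ℝ) : ℂ := q (Real.pi - x)

lemma pi_sub_mem {x : ℝ} (hx : x ∈ Icc (0 : ℝ) Real.pi) : Real.pi - x ∈ Icc (0 : ℝ) Real.pi :=
  ⟨sub_nonneg.2 hx.2, sub_le_self _ hx.1⟩

lemma continuousOn_reflect (hq : ContinuousOn q (Icc 0 Real.pi)) :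
    ContinuousOn (reflect q) (Icc 0 Real.pi) :=
  hq.comp (by fun_prop) fun _ hx => pi_sub_mem hx

/-- The map (x, t) ↦ (π - t, π - x) preserves Lebesgue measure and the triangle, so all earlier
estimates apply to the reflected equation. -/
lemma integrableOn_reflectKernel (hM : IntegrableOn (fun p : ℝ × ℝ => M p.1 p.2) triangle) :
    IntegrableOn (fun p : ℝ × ℝ => reflectKernel M p.1 p.2) triangle := by
  have h1 : MeasurePreserving (fun x : ℝ => Real.pi - x) volume volume :=
    Measure.measurePreserving_sub_left volume Real.pi
  have h2 : MeasurePreserving (fun p : ℝ × ℝ => (Real.pi - p.2, Real.pi - p.1))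
      (volume.prod volume) (volume.prod volume) :=
    (h1.prod h1).comp Measure.measurePreserving_swap
  have h3 := h2.integrable_comp_of_integrable (integrable_indicator_triangle hM)
  have h4 : (triangle.indicator fun p : ℝ × ℝ => M p.1 p.2) ∘
      (fun p : ℝ × ℝ => (Real.pi - p.2, Real.pi - p.1)) =
      triangle.indicator fun p : ℝ × ℝ => reflectKernel M p.1 p.2 := by
    ext p
    by_cases hp : p ∈ triangle
    · have hp' : (Real.pi - p.2, Real.pi - p.1) ∈ triangle :=
        ⟨sub_nonneg.2 hp.2.2, sub_le_sub_left hp.2.1 _, sub_le_self _ hp.1⟩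
      rw [Function.comp_apply, indicator_of_mem hp, indicator_of_mem hp']
      rfl
    · have hp' : (Real.pi - p.2, Real.pi - p.1) ∉ triangle := fun h =>
        hp ⟨by simpa using h.2.2, sub_le_sub_iff_left _ |>.1 h.2.1, by simpa using h.1⟩
      rw [Function.comp_apply, indicator_of_notMem hp, indicator_of_notMem hp']
  rw [h4] at h3
  exact (integrable_indicator_iff isClosed_triangle.measurableSet).1 h3

lemma memory_reflect (t : ℝ) :
    ∫ u in (0 : ℝ)..(Real.pi - t), reflectKernel M (Real.pi - t) u * w u =
      ∫ s in t..Real.pi, M s t * w (Real.pi - s) := by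
  have h := intervalIntegral.integral_comp_sub_left (a := t) (b := Real.pi)
    (fun u => reflectKernel M (Real.pi - t) u * w u) Real.pi
  rw [sub_self] at h
  rw [← h]
  simp [reflectKernel]

/-- Fubini on the triangle: the memory operator is moved from y to w, where after reflection it has
again the forward form. -/
lemma integral_memory_mul_reflect (hM : IntegrableOn (fun p : ℝ × ℝ => M p.1 p.2) triangle)
    (hy : ContinuousOn y (Icc 0 Real.pi)) (hw : ContinuousOn w (Icc 0 Real.pi)) :
    ∫ s in (0 : ℝ)..Real.pi, (∫ t in (0 : ℝ)..s, M s t * y t) * w (Real.pi - s) =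
      ∫ t in (0 : ℝ)..Real.pi, y t *
        ∫ u in (0 : ℝ)..(Real.pi - t), reflectKernel M (Real.pi - t) u * w u := by
  have hG : IntegrableOn (fun p : ℝ × ℝ =>
      (fun s t => M s t * (y t * reflect w s)) p.1 p.2) triangle :=
    integrableOn_mul_triangle hM (f := fun s t => y t * reflect w s)
      ((continuousOn_snd_triangle hy).mul (continuousOn_fst_triangle (continuousOn_reflect hw)))
  have h := integral_triangle_swap (G := fun s t => M s t * (y t * reflect w s)) hG
  simp_rw [memory_reflect, ← intervalIntegral.integral_mul_const,
    ← intervalIntegral.integral_const_mul]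
  have a1 : ∀ s t, M s t * y t * w (Real.pi - s) = M s t * (y t * reflect w s) := fun s t => by
    simp only [reflect]; ring
  have a2 : ∀ s t, y t * (M s t * w (Real.pi - s)) = M s t * (y t * reflect w s) := fun s t => by
    simp only [reflect]; ring
  simp only [a1, a2]
  exact h

lemma hasDerivWithinAt_reflect {y' : ℝ → ℂ}
    (hy : ∀ x ∈ Icc (0 : ℝ) Real.pi, HasDerivWithinAt y (y' x) (Icc 0 Real.pi) x) {x : ℝ}
    (hx : x ∈ Icc (0 : ℝ) Real.pi) :
    HasDerivWithinAt (reflect y) (-(reflect y' x)) (Icc 0 Real.pi) x := by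
  have h1 : HasDerivWithinAt (fun x : ℝ => Real.pi - x) (-1) (Icc 0 Real.pi) x :=
    ((hasDerivAt_id x).const_sub Real.pi).hasDerivWithinAt
  have h2 := (hy _ (pi_sub_mem hx)).scomp x h1 (fun s hs => pi_sub_mem hs)
  rw [neg_one_smul] at h2
  exact h2

lemma IsSolution.integral_force_mul_reflect (h : IsSolution M q lam y) {w' : ℝ → ℂ}
    (hw : ∀ x ∈ Icc (0 : ℝ) Real.pi, HasDerivWithinAt w (w' x) (Icc 0 Real.pi) x)
    (hw' : ContinuousOn w' (Icc 0 Real.pi)) :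
    ∫ s in (0 : ℝ)..Real.pi, (force M (fun s => q s - lam) y s * w (Real.pi - s) -
      der y s * w' (Real.pi - s)) = der y Real.pi * w 0 - der y 0 * w Real.pi := by
  have h1 := integral_product_rule Real.pi_pos.le h.2.1 (fun x hx => h.der_eq hx)
    (v := reflect w) (v' := fun x => -(reflect w' x))
    (fun x hx => hasDerivWithinAt_reflect hw hx) (continuousOn_reflect hw').neg
  simp only [reflect, sub_self, sub_zero] at h1
  rw [← h1]
  congr 1; ext s
  simp only [force]
  ring

/-- The identity of Lagrange for an equation and its reflected adjoint. -/
lemma IsSolution.lagrange (hM : IntegrableOn (fun p : ℝ × ℝ => M p.1 p.2) triangle)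
    (hq : ContinuousOn q (Icc 0 Real.pi)) (hq' : ContinuousOn q' (Icc 0 Real.pi))
    (hy : IsSolution M q lam y) (hw : IsSolution (reflectKernel M) (reflect q') lam w)
    (hyp : y Real.pi = 0) (hw0 : w 0 = 0) :
    ∫ x in (0 : ℝ)..Real.pi, (q x - q' x) * y x * w (Real.pi - x) =
      -(der y 0 * w Real.pi) - der w Real.pi * y 0 := by
  have hMr := integrableOn_reflectKernel hM
  have hqr := continuousOn_reflect hq'
  have h1 := hy.integral_force_mul_reflect (fun x hx => hw.hasDerivWithinAt hx) hw.continuousOn_der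
  have h2 := hw.integral_force_mul_reflect (fun x hx => hy.hasDerivWithinAt hx) hy.continuousOn_der
  rw [hw0] at h1
  rw [hyp] at h2
  -- After s ↦ π - s in the second identity, the products of derivatives coincide with those in the
  -- first. The memory terms agree by Fubini, so the difference leaves only q - q' and boundary
  -- values.
  have hsub := intervalIntegral.integral_comp_sub_left (a := 0) (b := Real.pi)
    (fun s => force (reflectKernel M) (fun s => reflect q' s - lam) w s * y (Real.pi - s) -
      der w s * der y (Real.pi - s)) Real.pi
  simp only [sub_self, sub_zero, sub_sub_cancel] at hsub
  rw [← hsub] at h2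
  have cy := hy.continuousOn
  have cw := continuousOn_reflect hw.continuousOn
  have cdy := hy.continuousOn_der
  have cdw := continuousOn_reflect hw.continuousOn_der
  have ip : ∀ {f : ℝ → ℂ}, ContinuousOn f (Icc 0 Real.pi) → ContinuousOn f (uIcc 0 Real.pi) :=
    fun hf => by rwa [uIcc_of_le Real.pi_pos.le]
  have j1 : IntervalIntegrable (fun s => ∫ t in (0 : ℝ)..s, M s t * y t) volume 0 Real.pi :=
    intervalIntegrable_memory hM cy
  have j2 : IntervalIntegrable (fun s => ∫ u in (0 : ℝ)..(Real.pi - s),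
      reflectKernel M (Real.pi - s) u * w u) volume 0 Real.pi := by
    have := (intervalIntegrable_memory hMr hw.continuousOn).comp_sub_left Real.pi
    simp only [sub_self, sub_zero] at this
    exact this.symm
  have k1 : IntervalIntegrable (fun s => (∫ t in (0 : ℝ)..s, M s t * y t) * reflect w s)
      volume 0 Real.pi := j1.mul_continuousOn (ip cw)
  have k2 : IntervalIntegrable (fun s => y s * ∫ u in (0 : ℝ)..(Real.pi - s),
      reflectKernel M (Real.pi - s) u * w u) volume 0 Real.pi := j2.continuousOn_mul (ip cy)
  have k3 : IntervalIntegrable (fun s => (q s - lam) * y s * reflect w s - der y s *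
      reflect (der w) s) volume 0 Real.pi :=
    intervalIntegrable_of_continuousOn ((((continuousOn_sub_const hq lam).mul cy).mul cw).sub
      (cdy.mul cdw))
  have k4 : IntervalIntegrable (fun s => (q' s - lam) * y s * reflect w s - der y s *
      reflect (der w) s) volume 0 Real.pi :=
    intervalIntegrable_of_continuousOn ((((continuousOn_sub_const hq' lam).mul cy).mul cw).sub
      (cdy.mul cdw))
  have e1 : ∫ s in (0 : ℝ)..Real.pi, (force M (fun s => q s - lam) y s * w (Real.pi - s) -
      der y s * der w (Real.pi - s)) =
      (∫ s in (0 : ℝ)..Real.pi, ((q s - lam) * y s * reflect w s - der y s *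
        reflect (der w) s)) +
      ∫ s in (0 : ℝ)..Real.pi, (∫ t in (0 : ℝ)..s, M s t * y t) * reflect w s := by
    rw [← intervalIntegral.integral_add k3 k1]
    congr 1; ext s
    simp only [force, reflect]; ring
  have e2 : ∫ s in (0 : ℝ)..Real.pi, (force (reflectKernel M) (fun s => reflect q' s - lam) w
      (Real.pi - s) * y s - der w (Real.pi - s) * der y s) =
      (∫ s in (0 : ℝ)..Real.pi, ((q' s - lam) * y s * reflect w s - der y s *
        reflect (der w) s)) +
      ∫ s in (0 : ℝ)..Real.pi, y s * ∫ u in (0 : ℝ)..(Real.pi - s),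
        reflectKernel M (Real.pi - s) u * w u := by
    rw [← intervalIntegral.integral_add k4 k2]
    congr 1; ext s
    simp only [force, reflect, sub_sub_cancel]; ring
  have e3 := integral_memory_mul_reflect hM cy hw.continuousOn
  have e4 : ∫ x in (0 : ℝ)..Real.pi, (q x - q' x) * y x * w (Real.pi - x) =
      (∫ s in (0 : ℝ)..Real.pi, ((q s - lam) * y s * reflect w s - der y s *
        reflect (der w) s)) -
      ∫ s in (0 : ℝ)..Real.pi, ((q' s - lam) * y s * reflect w s - der y s *
        reflect (der w) s) := by
    rw [← intervalIntegral.integral_sub k3 k4]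
    congr 1; ext s
    simp only [reflect]; ring
  rw [e1] at h1
  rw [e2] at h2
  change ∫ s in (0 : ℝ)..Real.pi, (∫ t in (0 : ℝ)..s, M s t * y t) * reflect w s = _ at e3
  rw [e4]
  linear_combination h1 - h2 - e3

/-- The difference of two Weyl-type functions as an integral. -/
lemma weylN_sub_weylN (hM : IntegrableOn (fun p : ℝ × ℝ => M p.1 p.2) triangle)
    (hq : ContinuousOn q (Icc 0 Real.pi)) (hq' : ContinuousOn q' (Icc 0 Real.pi))
    (hD : Delta1 M q lam ≠ 0) (hD' : Delta1 M q' lam ≠ 0)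
    (hDr : Delta1 (reflectKernel M) (reflect q') lam ≠ 0)
    (hy : IsSolution M q lam y) (hy0 : y 0 = 1) (hyp : y Real.pi = 0) :
    weylN M q lam - weylN M q' lam = -∫ x in (0 : ℝ)..Real.pi, (q x - q' x) * (y x *
      (solS (reflectKernel M) (reflect q') lam (Real.pi - x) /
        Delta1 (reflectKernel M) (reflect q') lam)) := by
  obtain ⟨hw, hw0, -⟩ := isSolution_solS (integrableOn_reflectKernel hM)
    (continuousOn_reflect hq') lam
  obtain ⟨y', hy', hy'0, hy'p⟩ := exists_weylSolution hM hq' hD'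
  have h1 := hy.lagrange hM hq hq' hw hyp hw0
  -- Applied to q' on both sides, the integral vanishes and the identity expresses w'(π) through the
  -- Weyl-type function of q'. This eliminates w'(π) from `h1`.
  have h2 := hy'.lagrange hM hq' hq' hw hy'p hw0
  rw [hy.der_eq_weylN hM hq hD hy0 hyp, hy0] at h1
  rw [hy'.der_eq_weylN hM hq' hD' hy'0 hy'p, hy'0] at h2
  simp only [sub_self, zero_mul, intervalIntegral.integral_zero] at h2
  change _ = -(weylN M q lam * Delta1 (reflectKernel M) (reflect q') lam) - _ at h1
  change _ = -(weylN M q' lam * Delta1 (reflectKernel M) (reflect q') lam) - _ at h2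
  have h3 : ∫ x in (0 : ℝ)..Real.pi, (q x - q' x) * (y x *
      (solS (reflectKernel M) (reflect q') lam (Real.pi - x) /
        Delta1 (reflectKernel M) (reflect q') lam)) =
      (∫ x in (0 : ℝ)..Real.pi, (q x - q' x) * y x *
        solS (reflectKernel M) (reflect q') lam (Real.pi - x)) /
        Delta1 (reflectKernel M) (reflect q') lam := by
    rw [← intervalIntegral.integral_div]
    congr 1; ext x; ring
  rw [h3, ← neg_div, eq_div_iff hDr]
  linear_combination h1 - h2

end IntegroDiff
-- Limits in the sector and the formula for Taylor coefficients.
namespace IntegroDiff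

variable {M : ℝ → ℝ → ℂ} {q q' y w z : ℝ → ℂ} {lam ρ : ℂ} {δ : ℝ}

section Sector

lemma sin_mul_norm_le_im (hδ : δ ∈ Ioo (0 : ℝ) (Real.pi / 2))
    (hρ : δ ≤ ρ.arg ∧ ρ.arg ≤ Real.pi - δ) : Real.sin δ * ‖ρ‖ ≤ ρ.im := by
  have h1 : ρ.im = ‖ρ‖ * Real.sin ρ.arg := by
    rcases eq_or_ne ρ 0 with rfl | h
    · simp
    · rw [Complex.sin_arg]; field_simp
  have h2 : Real.sin δ ≤ Real.sin ρ.arg := by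
    rcases le_total ρ.arg (Real.pi / 2) with h | h
    · exact Real.sin_le_sin_of_le_of_le_pi_div_two (by linarith [hδ.1, Real.pi_pos]) h hρ.1
    · rw [← Real.sin_pi_sub ρ.arg]
      exact Real.sin_le_sin_of_le_of_le_pi_div_two (by linarith [hδ.1, Real.pi_pos])
        (by linarith) (by linarith [hρ.2])
  rw [h1, mul_comm]
  gcongr

lemma sin_pos_of_mem (hδ : δ ∈ Ioo (0 : ℝ) (Real.pi / 2)) : 0 < Real.sin δ :=
  Real.sin_pos_of_pos_of_lt_pi hδ.1 (by linarith [hδ.2, Real.pi_pos])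

lemma eventually_mem_sector (δ : ℝ) :
    ∀ᶠ ρ in sectorInfty δ, δ ≤ ρ.arg ∧ ρ.arg ≤ Real.pi - δ :=
  mem_inf_of_right (mem_principal_self _)

lemma tendsto_norm_sectorInfty (δ : ℝ) : Tendsto (fun ρ : ℂ => ‖ρ‖) (sectorInfty δ) atTop :=
  tendsto_norm_cobounded_atTop.mono_left inf_le_left

lemma tendsto_im_sectorInfty (hδ : δ ∈ Ioo (0 : ℝ) (Real.pi / 2)) :
    Tendsto Complex.im (sectorInfty δ) atTop := by
  refine tendsto_atTop_mono' _ ?_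
    ((tendsto_norm_sectorInfty δ).const_mul_atTop (sin_pos_of_mem hδ))
  filter_upwards [eventually_mem_sector δ] with ρ hρ using sin_mul_norm_le_im hδ hρ

/-- The imaginary half-axis lies in the sector. Without this, limits along the filter would not be
unique and the algorithm would determine nothing. -/
lemma sectorInfty_neBot (hδ : δ ∈ Ioo (0 : ℝ) (Real.pi / 2)) : (sectorInfty δ).NeBot := by
  have h : Tendsto (fun n : ℕ => ((n : ℝ) : ℂ) * Complex.I) atTop (sectorInfty δ) := by
    refine tendsto_inf.2 ⟨?_, tendsto_principal.2 ?_⟩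
    · rw [← tendsto_norm_atTop_iff_cobounded]
      refine tendsto_natCast_atTop_atTop.congr fun n => ?_
      simp
    · filter_upwards [eventually_gt_atTop 0] with n hn
      have hn' : (0 : ℝ) < n := Nat.cast_pos.2 hn
      change _ ≤ _ ∧ _ ≤ _
      rw [Complex.arg_real_mul _ hn', Complex.arg_I]
      constructor <;> linarith [hδ.2]
  exact h.neBot

end Sector

section Moments

lemma hasDerivAt_pow_mul_exp (r : ℂ) (k : ℕ) (x : ℝ) :
    HasDerivAt (fun x : ℝ => (x : ℂ) ^ (k + 1) * Complex.exp (-(r * x)))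
      ((k + 1) * ((x : ℂ) ^ k * Complex.exp (-(r * x))) -
        r * ((x : ℂ) ^ (k + 1) * Complex.exp (-(r * x)))) x := by
  have h : HasDerivAt (fun z : ℂ => z ^ (k + 1) * Complex.exp (-(r * z)))
      ((k + 1) * ((x : ℂ) ^ k * Complex.exp (-(r * x))) -
        r * ((x : ℂ) ^ (k + 1) * Complex.exp (-(r * x)))) (x : ℂ) := by
    have h1 := (hasDerivAt_pow (k + 1) (x : ℂ)).mul
      (((hasDerivAt_id (x : ℂ)).const_mul r).neg.cexp)
    convert! h1 using 1
    simp
    ring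
  exact h.comp_ofReal

lemma integral_pow_mul_exp_succ (r : ℂ) (k : ℕ) :
    r * ∫ x in (0 : ℝ)..Real.pi, (x : ℂ) ^ (k + 1) * Complex.exp (-(r * x)) =
      (k + 1) * (∫ x in (0 : ℝ)..Real.pi, (x : ℂ) ^ k * Complex.exp (-(r * x))) -
        (Real.pi : ℂ) ^ (k + 1) * Complex.exp (-(r * Real.pi)) := by
  have hc : ∀ n : ℕ, Continuous fun x : ℝ => (x : ℂ) ^ n * Complex.exp (-(r * x)) := fun n => by
    fun_prop
  have h := intervalIntegral.integral_eq_sub_of_hasDerivAt (a := 0) (b := Real.pi)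
    (fun x _ => hasDerivAt_pow_mul_exp r k x)
    ((((hc k).const_mul _).sub ((hc (k + 1)).const_mul _)).intervalIntegrable _ _)
  rw [intervalIntegral.integral_sub (((hc k).const_mul _).intervalIntegrable _ _)
    (((hc (k + 1)).const_mul _).intervalIntegrable _ _), intervalIntegral.integral_const_mul,
    intervalIntegral.integral_const_mul] at h
  simp only [Complex.ofReal_zero, ne_eq, Nat.add_eq_zero_iff, one_ne_zero, and_false,
    not_false_eq_true, zero_pow, zero_mul, sub_zero] at h
  linear_combination -h

lemma integral_exp_neg_mul (r : ℂ) :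
    r * ∫ x in (0 : ℝ)..Real.pi, Complex.exp (-(r * x)) = 1 - Complex.exp (-(r * Real.pi)) := by
  rw [← intervalIntegral.integral_const_mul]
  have h : ∀ x : ℝ, HasDerivAt (fun x : ℝ => -Complex.exp (-(r * x)))
      (r * Complex.exp (-(r * x))) x := fun x => by
    have h1 : HasDerivAt (fun z : ℂ => -Complex.exp (-(r * z)))
        (r * Complex.exp (-(r * x))) (x : ℂ) := by
      convert! (((hasDerivAt_id (x : ℂ)).const_mul r).neg.cexp).neg using 1
      simp
      ring
    exact h1.comp_ofReal
  rw [intervalIntegral.integral_eq_sub_of_hasDerivAt (fun x _ => h x)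
    ((by fun_prop : Continuous _).intervalIntegrable _ _)]
  simp
  ring

/-- Integration by parts in k; the boundary term at π is subtracted and nonnegative, so it can be
dropped. -/
lemma integral_real_pow_mul_exp_le {c : ℝ} (hc : 0 < c) (k : ℕ) :
    ∫ x in (0 : ℝ)..Real.pi, x ^ k * Real.exp (-(c * x)) ≤ k.factorial / c ^ (k + 1) := by
  have hcast : ∀ k : ℕ, ((∫ x in (0 : ℝ)..Real.pi, x ^ k * Real.exp (-(c * x)) : ℝ) : ℂ) =
      ∫ x in (0 : ℝ)..Real.pi, (x : ℂ) ^ k * Complex.exp (-((c : ℂ) * x)) := fun k => by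
    rw [← intervalIntegral.integral_ofReal]
    congr 1; ext x; push_cast; rfl
  induction k with
  | zero =>
    have h := integral_exp_neg_mul (c : ℂ)
    have h0 := hcast 0
    simp only [pow_zero, one_mul] at h0
    rw [← h0] at h
    have h1 : c * ∫ x in (0 : ℝ)..Real.pi, Real.exp (-(c * x)) = 1 - Real.exp (-(c * Real.pi)) := by
      exact_mod_cast h
    simp only [pow_zero, one_mul, Nat.factorial_zero, Nat.cast_one, zero_add, pow_one]
    rw [le_div_iff₀ hc, mul_comm, h1]
    linarith [Real.exp_pos (-(c * Real.pi))]
  | succ k ih =>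
    have h := integral_pow_mul_exp_succ (c : ℂ) k
    rw [← hcast, ← hcast] at h
    have h1 : c * ∫ x in (0 : ℝ)..Real.pi, x ^ (k + 1) * Real.exp (-(c * x)) =
        (k + 1) * (∫ x in (0 : ℝ)..Real.pi, x ^ k * Real.exp (-(c * x))) -
          Real.pi ^ (k + 1) * Real.exp (-(c * Real.pi)) := by
      exact_mod_cast h
    have h2 : 0 ≤ Real.pi ^ (k + 1) * Real.exp (-(c * Real.pi)) := by positivity
    have h3 : c * ∫ x in (0 : ℝ)..Real.pi, x ^ (k + 1) * Real.exp (-(c * x)) ≤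
        (k + 1) * (k.factorial / c ^ (k + 1)) := by
      rw [h1]
      have : ((k : ℝ) + 1) * (∫ x in (0 : ℝ)..Real.pi, x ^ k * Real.exp (-(c * x))) ≤
        (k + 1) * (k.factorial / c ^ (k + 1)) := by gcongr
      linarith
    rw [← le_div_iff₀' hc] at h3
    refine h3.trans (le_of_eq ?_)
    rw [Nat.factorial_succ]
    push_cast
    field_simp
    ring

lemma tendsto_pow_mul_exp_sector (hδ : δ ∈ Ioo (0 : ℝ) (Real.pi / 2)) (k : ℕ) :
    Tendsto (fun ρ : ℂ => (-2 * Complex.I * ρ) ^ k * Complex.exp (-(-2 * Complex.I * ρ * Real.pi)))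
      (sectorInfty δ) (𝓝 0) := by
  have hσ := sin_pos_of_mem hδ
  have h1 : Tendsto (fun ρ : ℂ => (2 / Real.sin δ) ^ k * (ρ.im ^ k * Real.exp (-ρ.im)))
      (sectorInfty δ) (𝓝 0) := by
    have := ((Real.tendsto_pow_mul_exp_neg_atTop_nhds_zero k).comp
      (tendsto_im_sectorInfty hδ)).const_mul ((2 / Real.sin δ) ^ k)
    simpa using this
  refine squeeze_zero_norm' ?_ h1
  filter_upwards [eventually_mem_sector δ] with ρ hρ
  have h2 := sin_mul_norm_le_im hδ hρ
  have h3 : 0 ≤ ρ.im := le_trans (by positivity) h2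
  have h4 : ‖-2 * Complex.I * ρ‖ ≤ 2 / Real.sin δ * ρ.im := by
    rw [norm_mul, norm_mul, norm_neg, Complex.norm_I, Complex.norm_ofNat, mul_one,
      div_mul_eq_mul_div, le_div_iff₀ hσ]
    linarith
  rw [norm_mul, norm_pow, ← mul_assoc, ← mul_pow, Complex.norm_exp]
  gcongr
  have : (-(-2 * Complex.I * ρ * Real.pi)).re = -(2 * Real.pi * ρ.im) := by
    simp [Complex.mul_re]
    ring
  rw [this]
  nlinarith [Real.pi_gt_three]

/-- With r = -2iρ, the same recursion multiplies the limit by k + 1 at each step. The boundary term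
at π is exponentially small in the sector and disappears. -/
lemma tendsto_pow_mul_moment (hδ : δ ∈ Ioo (0 : ℝ) (Real.pi / 2)) (k : ℕ) :
    Tendsto (fun ρ : ℂ => (-2 * Complex.I * ρ) ^ (k + 1) *
      ∫ x in (0 : ℝ)..Real.pi, (x : ℂ) ^ k * Complex.exp (-(-2 * Complex.I * ρ * x)))
      (sectorInfty δ) (𝓝 (k.factorial : ℂ)) := by
  induction k with
  | zero =>
    have h := (tendsto_pow_mul_exp_sector hδ 0).const_sub 1
    simp only [pow_zero, one_mul, sub_zero] at h
    simp only [zero_add, pow_one, pow_zero, one_mul, integral_exp_neg_mul, Nat.factorial_zero,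
      Nat.cast_one]
    exact h
  | succ k ih =>
    have h := (ih.const_mul ((k : ℂ) + 1)).sub
      ((tendsto_pow_mul_exp_sector hδ (k + 1)).const_mul ((Real.pi : ℂ) ^ (k + 1)))
    rw [mul_zero, sub_zero] at h
    rw [Nat.factorial_succ]
    push_cast
    refine h.congr fun ρ => ?_
    rw [pow_succ (-2 * Complex.I * ρ) (k + 1), mul_assoc _ (-2 * Complex.I * ρ),
      integral_pow_mul_exp_succ]
    ring

end Moments

/-- Taylor's formula on [0, π] uses one-sided derivatives at 0; these equal the two-sided ones
because p is analytic on a full neighbourhood of 0. -/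
lemma exists_taylor_bound {p : ℝ → ℂ} (hp : AnalyticOnNhd ℝ p (Icc 0 Real.pi)) {k : ℕ}
    (h0 : ∀ j < k, iteratedDeriv j p 0 = 0) :
    ∃ B : ℝ, 0 ≤ B ∧ ∀ x ∈ Icc (0 : ℝ) Real.pi,
      ‖p x - iteratedDeriv k p 0 / k.factorial * (x : ℂ) ^ k‖ ≤ B * x ^ (k + 1) := by
  obtain ⟨C, hC⟩ := exists_taylor_mean_remainder_bound (n := k) Real.pi_pos.le
    (hp.contDiffOn (n := (k : WithTop ℕ∞) + 1) uniqueDiffOn_Icc_pi)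
  refine ⟨|C|, abs_nonneg C, fun x hx => ?_⟩
  have h1 := hC x hx
  rw [taylor_within_apply, Finset.sum_range_succ, Finset.sum_eq_zero, zero_add, sub_zero,
    iteratedDerivWithin_eq_iteratedDeriv uniqueDiffOn_Icc_pi (hp 0 zero_mem_Icc_pi).contDiffAt
      zero_mem_Icc_pi] at h1
  · have h2 : (((k.factorial : ℝ)⁻¹ * x ^ k) • iteratedDeriv k p 0 : ℂ) =
        iteratedDeriv k p 0 / k.factorial * (x : ℂ) ^ k := by
      rw [Complex.real_smul]; push_cast; ring
    rw [h2] at h1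
    have := hx.1
    exact h1.trans (by gcongr; exact le_abs_self C)
  · intro j hj
    rw [iteratedDerivWithin_eq_iteratedDeriv uniqueDiffOn_Icc_pi
      (hp 0 zero_mem_Icc_pi).contDiffAt zero_mem_Icc_pi, h0 j (Finset.mem_range.1 hj), smul_zero]

/-- In ab - e² = a(b - e) + (a - e)e each product contains a factor bounded with the decaying weight
C, so none is needed for a or for a - e. -/
lemma norm_mul_sub_mul_le {a b e : ℂ} {A B C : ℝ} (ha : ‖a‖ ≤ 8) (hae : ‖a - e‖ ≤ A)
    (hbe : ‖b - e‖ ≤ B * C) (he : ‖e‖ ≤ C) : ‖a * b - e * e‖ ≤ (8 * B + A) * C := by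
  have h1 : a * b - e * e = a * (b - e) + (a - e) * e := by ring
  have hA : 0 ≤ A := (norm_nonneg _).trans hae
  calc ‖a * b - e * e‖ ≤ ‖a‖ * ‖b - e‖ + ‖a - e‖ * ‖e‖ := by
        rw [h1, ← norm_mul, ← norm_mul]; exact norm_add_le _ _
    _ ≤ 8 * (B * C) + A * C := by gcongr
    _ = _ := by ring

/-- The quantitative Watson lemma. With e = e^{2iρx}, pf - b x^k e = p(f - e) + (p - b x^k)e: the
first term is small through D, the second through the extra power of x, which gains a factor 1/τ. -/
lemma norm_integral_potential_sub_moment_le {p f : ℝ → ℂ} (hp : ContinuousOn p (Icc 0 Real.pi))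
    (hf : ContinuousOn f (Icc 0 Real.pi)) {b : ℂ} {k : ℕ} {B D τ : ℝ} (hB : 0 ≤ B) (hD : 0 ≤ D)
    (hτ : 0 < τ) (hρ : τ ≤ ρ.im)
    (hpb : ∀ x ∈ Icc (0 : ℝ) Real.pi, ‖p x - b * (x : ℂ) ^ k‖ ≤ B * x ^ (k + 1))
    (hfb : ∀ x ∈ Icc (0 : ℝ) Real.pi,
      ‖f x - Complex.exp (-(-2 * Complex.I * ρ * x))‖ ≤ D * Real.exp (-(τ / 2 * x))) :
    ‖(∫ x in (0 : ℝ)..Real.pi, p x * f x) -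
      b * ∫ x in (0 : ℝ)..Real.pi, (x : ℂ) ^ k * Complex.exp (-(-2 * Complex.I * ρ * x))‖ ≤
    (‖b‖ + B * Real.pi) * D * (k.factorial / (τ / 2) ^ (k + 1)) +
      B * ((k + 1).factorial / (τ / 2) ^ (k + 2)) := by
  have hc : Continuous fun x : ℝ => (x : ℂ) ^ k * Complex.exp (-(-2 * Complex.I * ρ * x)) := by
    fun_prop
  rw [← intervalIntegral.integral_const_mul, ← intervalIntegral.integral_sub
    (intervalIntegrable_of_continuousOn (y := fun x => p x * f x) (hp.mul hf)) ((hc.const_mul b).intervalIntegrable _ _)]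
  have hc1 : ∀ n : ℕ, Continuous fun x : ℝ => x ^ n * Real.exp (-(τ / 2 * x)) := fun n => by
    fun_prop
  have hbound : ∀ x ∈ Icc (0 : ℝ) Real.pi,
      ‖p x * f x - b * ((x : ℂ) ^ k * Complex.exp (-(-2 * Complex.I * ρ * x)))‖ ≤
        (‖b‖ + B * Real.pi) * D * (x ^ k * Real.exp (-(τ / 2 * x))) +
          B * (x ^ (k + 1) * Real.exp (-(τ / 2 * x))) := by
    intro x hx
    set e := Complex.exp (-(-2 * Complex.I * ρ * x)) with he
    have hx0 := hx.1
    have hen : ‖e‖ ≤ Real.exp (-(τ / 2 * x)) := by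
      rw [he, Complex.norm_exp]
      have : (-(-2 * Complex.I * ρ * x)).re = -(2 * ρ.im * x) := by
        simp [Complex.mul_re]
      rw [this]
      gcongr
      linarith
    have hxk : ‖(x : ℂ) ^ k‖ = x ^ k := by
      rw [norm_pow, Complex.norm_real, Real.norm_of_nonneg hx0]
    have hpn : ‖p x‖ ≤ (‖b‖ + B * Real.pi) * x ^ k := by
      calc ‖p x‖ = ‖b * (x : ℂ) ^ k + (p x - b * (x : ℂ) ^ k)‖ := by congr 1; ring
        _ ≤ ‖b‖ * x ^ k + B * x ^ (k + 1) := by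
          refine (norm_add_le _ _).trans (add_le_add ?_ (hpb x hx))
          rw [norm_mul, hxk]
        _ = (‖b‖ + B * x) * x ^ k := by ring
        _ ≤ _ := by gcongr; exact hx.2
    have e1 : p x * f x - b * ((x : ℂ) ^ k * e) =
        p x * (f x - e) + (p x - b * (x : ℂ) ^ k) * e := by ring
    calc _ ≤ ‖p x‖ * ‖f x - e‖ + ‖p x - b * (x : ℂ) ^ k‖ * ‖e‖ := by
          rw [e1, ← norm_mul, ← norm_mul]; exact norm_add_le _ _
      _ ≤ (‖b‖ + B * Real.pi) * x ^ k * (D * Real.exp (-(τ / 2 * x))) +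
          B * x ^ (k + 1) * Real.exp (-(τ / 2 * x)) := by
          gcongr
          · exact hfb x hx
          · exact hpb x hx
      _ = _ := by ring
  have hpi := Real.pi_pos
  have hτ2 : 0 < τ / 2 := by positivity
  calc _ ≤ ∫ x in (0 : ℝ)..Real.pi,
        ((‖b‖ + B * Real.pi) * D * (x ^ k * Real.exp (-(τ / 2 * x))) +
          B * (x ^ (k + 1) * Real.exp (-(τ / 2 * x)))) :=
        intervalIntegral.norm_integral_le_of_norm_le hpi.le
          (Eventually.of_forall fun x hx => hbound x ⟨hx.1.le, hx.2⟩)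
          ((((hc1 k).const_mul _).add ((hc1 (k + 1)).const_mul _)).intervalIntegrable _ _)
    _ = (‖b‖ + B * Real.pi) * D * (∫ x in (0 : ℝ)..Real.pi, x ^ k * Real.exp (-(τ / 2 * x))) +
          B * ∫ x in (0 : ℝ)..Real.pi, x ^ (k + 1) * Real.exp (-(τ / 2 * x)) := by
        rw [intervalIntegral.integral_add (((hc1 k).const_mul _).intervalIntegrable _ _)
          (((hc1 (k + 1)).const_mul _).intervalIntegrable _ _),
          intervalIntegral.integral_const_mul, intervalIntegral.integral_const_mul]
    _ ≤ _ := by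
        gcongr
        · exact integral_real_pow_mul_exp_le hτ2 k
        · exact integral_real_pow_mul_exp_le hτ2 (k + 1)

/-- The formula for the first Taylor coefficient in which two potentials differ. -/
theorem tendsto_weylN_sub (hM : IntegrableOn (fun p : ℝ × ℝ => M p.1 p.2) triangle)
    (hq : AnalyticOnNhd ℝ q (Icc 0 Real.pi)) (hq' : AnalyticOnNhd ℝ q' (Icc 0 Real.pi))
    (hδ : δ ∈ Ioo (0 : ℝ) (Real.pi / 2)) (k : ℕ)
    (hj : ∀ j < k, iteratedDeriv j q' 0 = iteratedDeriv j q 0) :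
    Tendsto (fun ρ : ℂ => -((-2 * Complex.I * ρ) ^ (k + 1) *
      (weylN M q (ρ ^ 2) - weylN M q' (ρ ^ 2))))
      (sectorInfty δ) (𝓝 (iteratedDeriv k q 0 - iteratedDeriv k q' 0)) := by
  have hMr := integrableOn_reflectKernel hM
  have cq := hq.continuousOn
  have cq' := hq'.continuousOn
  have cqr := continuousOn_reflect cq'
  have hσ := sin_pos_of_mem hδ
  have hder : ∀ j, iteratedDeriv j (fun x => q x - q' x) 0 =
      iteratedDeriv j q 0 - iteratedDeriv j q' 0 := fun j =>
    iteratedDeriv_fun_sub (hq 0 zero_mem_Icc_pi).contDiffAt (hq' 0 zero_mem_Icc_pi).contDiffAt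
  obtain ⟨B, hB, hpB⟩ := exists_taylor_bound (p := fun x => q x - q' x) (k := k) (hq.sub hq')
    (fun j h => by rw [hder, hj j h, sub_self])
  set a := iteratedDeriv k q 0 - iteratedDeriv k q' 0 with ha
  rw [hder k] at hpB
  set b : ℂ := a / k.factorial with hb
  have hmain : Tendsto (fun ρ : ℂ => b * ((-2 * Complex.I * ρ) ^ (k + 1) *
      ∫ x in (0 : ℝ)..Real.pi, (x : ℂ) ^ k * Complex.exp (-(-2 * Complex.I * ρ * x))))
      (sectorInfty δ) (𝓝 a) := by
    have h1 := (tendsto_pow_mul_moment hδ k).const_mul b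
    rwa [hb, div_mul_cancel₀ _ (Nat.cast_ne_zero.2 k.factorial_ne_zero)] at h1
  set K := totalMass M q
  set Kr := totalMass (reflectKernel M) (reflect q')
  have hK : 0 ≤ K := totalMass_nonneg
  have hKr : 0 ≤ Kr := totalMass_nonneg
  -- The constant 8B + A of `norm_mul_sub_mul_le`, with the factor 1/Im ρ removed from both errors.
  set D₀ : ℝ := 8 * (8 + 32 * Kr) + (64 * K + 4) with hD₀
  have hD₀0 : 0 ≤ D₀ := by positivity
  -- In the sector |2ρ| ≤ 2 Im ρ/sin δ, so multiplying by |2ρ|^{k+1} against (Im ρ/2)^{-(k+1)} costs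
  -- (4/sin δ)^{k+1}. One factor 1/Im ρ remains.
  set C : ℝ := (‖b‖ + B * Real.pi) * D₀ * k.factorial * (4 / Real.sin δ) ^ (k + 1) +
    2 * B * (k + 1).factorial * (4 / Real.sin δ) ^ (k + 1) with hC
  have herr : Tendsto (fun ρ : ℂ => -((-2 * Complex.I * ρ) ^ (k + 1) *
      (weylN M q (ρ ^ 2) - weylN M q' (ρ ^ 2))) - b * ((-2 * Complex.I * ρ) ^ (k + 1) *
      ∫ x in (0 : ℝ)..Real.pi, (x : ℂ) ^ k * Complex.exp (-(-2 * Complex.I * ρ * x))))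
      (sectorInfty δ) (𝓝 0) := by
    have hlim : Tendsto (fun ρ : ℂ => C / ρ.im) (sectorInfty δ) (𝓝 0) :=
      (tendsto_im_sectorInfty hδ).const_div_atTop C
    refine squeeze_zero_norm' ?_ hlim
    filter_upwards [eventually_mem_sector δ, (tendsto_im_sectorInfty hδ).eventually_ge_atTop 1,
      (tendsto_norm_sectorInfty δ).eventually_ge_atTop (16 * K),
      (tendsto_norm_sectorInfty δ).eventually_ge_atTop (16 * totalMass M q'),
      (tendsto_norm_sectorInfty δ).eventually_ge_atTop (16 * Kr)] with ρ hsec h1 hρK hρK' hρKr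
    have hτ : 0 < ρ.im := by linarith
    have hD := Delta1_ne_zero hM cq h1 hρK
    have hD' := Delta1_ne_zero hM cq' h1 hρK'
    have hDr := Delta1_ne_zero hMr cqr h1 hρKr
    obtain ⟨y, hy, hy0, hyp⟩ := exists_weylSolution hM cq hD
    obtain ⟨hw, -, -⟩ := isSolution_solS hMr cqr (ρ ^ 2)
    rw [weylN_sub_weylN hM cq cq' hD hD' hDr hy hy0 hyp]
    set f : ℝ → ℂ := fun x => y x * (solS (reflectKernel M) (reflect q') (ρ ^ 2) (Real.pi - x) /
      Delta1 (reflectKernel M) (reflect q') (ρ ^ 2)) with hf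
    have hfc : ContinuousOn f (Icc 0 Real.pi) :=
      hy.continuousOn.mul ((continuousOn_reflect hw.continuousOn).div_const _)
    have hfb : ∀ x ∈ Icc (0 : ℝ) Real.pi,
        ‖f x - Complex.exp (-(-2 * Complex.I * ρ * x))‖ ≤
          D₀ / ρ.im * Real.exp (-(ρ.im / 2 * x)) := by
      intro x hx
      have e1 : Complex.exp (-(-2 * Complex.I * ρ * x)) =
          Complex.exp (Complex.I * (ρ * x)) * Complex.exp (Complex.I * (ρ * x)) := by
        rw [← Complex.exp_add]; congr 1; ring
      obtain ⟨g1, g2⟩ := hy.norm_weylSolution_sub_le hM cq hy0 hyp h1 hρK hx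
      have g3 := norm_solS_div_sub_le hMr cqr h1 hρKr hx
      have g4 : ‖Complex.exp (Complex.I * (ρ * x))‖ ≤ Real.exp (-(ρ.im / 2 * x)) := by
        rw [norm_exp_I_mul, Complex.im_mul_ofReal]
        gcongr
        · exact hx.1
        · linarith
      rw [e1, hf]
      refine (norm_mul_sub_mul_le g1 g2 g3 g4).trans (le_of_eq ?_)
      rw [hD₀]; ring
    have hest := norm_integral_potential_sub_moment_le (ρ := ρ) (cq.sub cq') hfc hB
      (div_nonneg hD₀0 hτ.le) hτ le_rfl hpB hfb
    have hr : ‖-2 * Complex.I * ρ‖ ≤ 2 * ρ.im / Real.sin δ := by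
      rw [norm_mul, norm_mul, norm_neg, Complex.norm_I, Complex.norm_ofNat, mul_one,
        le_div_iff₀ hσ]
      linarith [sin_mul_norm_le_im hδ hsec]
    have e2 : ∀ u v : ℂ, -((-2 * Complex.I * ρ) ^ (k + 1) * -u) -
        b * ((-2 * Complex.I * ρ) ^ (k + 1) * v) = (-2 * Complex.I * ρ) ^ (k + 1) * (u - b * v) :=
      fun u v => by ring
    rw [e2, norm_mul, norm_pow]
    calc _ ≤ (2 * ρ.im / Real.sin δ) ^ (k + 1) *
          ((‖b‖ + B * Real.pi) * (D₀ / ρ.im) * (k.factorial / (ρ.im / 2) ^ (k + 1)) +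
            B * ((k + 1).factorial / (ρ.im / 2) ^ (k + 2))) := by
          gcongr
          exact hest
      _ = C / ρ.im := by
          rw [hC, pow_succ (ρ.im / 2) (k + 1)]
          have e3 : (2 * ρ.im / Real.sin δ) ^ (k + 1) =
              (4 / Real.sin δ) ^ (k + 1) * (ρ.im / 2) ^ (k + 1) := by
            rw [← mul_pow]; congr 1; ring
          rw [e3]
          have : (ρ.im / 2) ^ (k + 1) ≠ 0 := by positivity
          generalize (ρ.im / 2) ^ (k + 1) = P at this
          field_simp
          try ring
  have hsum := herr.add hmain
  rw [zero_add] at hsum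
  exact hsum.congr fun ρ => by ring

end IntegroDiff
-- Characteristic functions are determined by their zeros.
namespace IntegroDiff

variable {M : ℝ → ℝ → ℂ} {q q' : ℝ → ℂ} {ρ : ℂ}

/-- Division of entire functions with the same zeros. -/
lemma exists_entire_quotient {f g : ℂ → ℂ} (hf : Differentiable ℂ f) (hg : Differentiable ℂ g)
    (hg0 : ∃ z, g z ≠ 0) (h : ∀ z, analyticOrderAt f z = analyticOrderAt g z) :
    ∃ F : ℂ → ℂ, Differentiable ℂ F ∧ ∀ z, f z = F z * g z := by
  have hne : ∀ z, analyticOrderAt g z ≠ ⊤ := fun z hz => by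
    obtain ⟨z₀, hz₀⟩ := hg0
    have h1 : g =ᶠ[𝓝 z] fun _ => 0 := analyticOrderAt_eq_top.1 hz
    have h2 := AnalyticOnNhd.eq_of_eventuallyEq (fun w _ => hg.analyticAt w)
      (fun w _ => analyticAt_const) h1
    exact hz₀ (congrFun h2 z₀)
  -- The pointwise quotient takes the value 0 at zeros of g. Its meromorphic order is 0 everywhere,
  -- so the normal form replaces these values by the analytic ones.
  have hmer : MeromorphicOn (f / g) univ := fun z _ =>
    (hf.analyticAt z).meromorphicAt.div (hg.analyticAt z).meromorphicAt
  have hord : ∀ z, meromorphicOrderAt (f / g) z = 0 := fun z => by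
    rw [meromorphicOrderAt_div (hf.analyticAt z).meromorphicAt (hg.analyticAt z).meromorphicAt,
      (hf.analyticAt z).meromorphicOrderAt_eq, (hg.analyticAt z).meromorphicOrderAt_eq, h z]
    obtain ⟨n, hn⟩ := ENat.ne_top_iff_exists.1 (hne z)
    rw [← hn]
    simp only [ENat.map_natCast]
    exact_mod_cast sub_self (n : ℤ)
  have hF : ∀ z, AnalyticAt ℂ (toMeromorphicNFOn (f / g) univ) z := fun z => by
    refine (meromorphicNFOn_toMeromorphicNFOn (f / g) univ
      (mem_univ z)).meromorphicOrderAt_nonneg_iff_analyticAt.1 ?_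
    rw [meromorphicOrderAt_toMeromorphicNFOn hmer (mem_univ z), hord z]
  refine ⟨toMeromorphicNFOn (f / g) univ, fun z => (hF z).differentiableAt, fun z => ?_⟩
  -- Off the isolated zeros of g the identity is clear; continuity extends it to z.
  have h1 : ∀ᶠ w in 𝓝[≠] z, f w = toMeromorphicNFOn (f / g) univ w * g w := by
    have h2 := ((hg.analyticAt z).eventually_eq_zero_or_eventually_ne_zero).resolve_left
      fun h => hne z (analyticOrderAt_eq_top.2 h)
    filter_upwards [h2, hmer.toMeromorphicNFOn_eq_self_on_nhdsNE (mem_univ z)] with w hw hw'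
    rw [hw', Pi.div_apply, div_mul_cancel₀ _ hw]
  have h3 : Tendsto f (𝓝[≠] z) (𝓝 (f z)) := hf.continuous.continuousAt.mono_left nhdsWithin_le_nhds
  have h4 : Tendsto (fun w => toMeromorphicNFOn (f / g) univ w * g w) (𝓝[≠] z)
      (𝓝 (toMeromorphicNFOn (f / g) univ z * g z)) :=
    ((hF z).continuousAt.mul hg.continuous.continuousAt).mono_left nhdsWithin_le_nhds
  exact tendsto_nhds_unique (h3.congr' h1) h4

/-- Liouville's theorem for an entire function that is bounded on a sequence of squares. -/
lemma eq_of_bounded_on_squares {G : ℂ → ℂ} (hG : Differentiable ℂ G) {C : ℝ} {a : ℕ → ℝ}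
    (ha : Tendsto a atTop atTop)
    (h : ∀ᶠ n in atTop, ∀ ρ : ℂ, (|ρ.re| = a n ∨ |ρ.im| = a n) → ‖G ρ‖ ≤ C) (z w : ℂ) :
    G z = G w := by
  refine hG.apply_eq_apply_of_bounded (isBounded_iff_forall_norm_le.2 ⟨C, ?_⟩) z w
  rintro _ ⟨ρ, rfl⟩
  obtain ⟨n, hn, hna⟩ := (h.and (ha.eventually_gt_atTop (max 0 ‖ρ‖))).exists
  have hpos : 0 < a n := lt_of_le_of_lt (le_max_left _ _) hna
  have hρ : ‖ρ‖ < a n := lt_of_le_of_lt (le_max_right _ _) hna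
  have hneg : -a n ≠ a n := by linarith
  -- The maximum principle on a square that contains ρ transfers the bound from its boundary.
  refine Complex.norm_le_of_forall_mem_frontier_norm_le (f := G)
    (U := Ioo (-a n) (a n) ×ℂ Ioo (-a n) (a n))
    ((Metric.isBounded_Ioo _ _).reProdIm (Metric.isBounded_Ioo _ _)) hG.diffContOnCl
    (fun z hz => hn z ?_) (subset_closure ?_)
  · rw [Complex.frontier_reProdIm, frontier_Ioo (by linarith)] at hz
    have key : ∀ x : ℝ, x ∈ ({-a n, a n} : Set ℝ) → |x| = a n := by
      rintro x (rfl | rfl)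
      · rw [abs_neg, abs_of_pos hpos]
      · exact abs_of_pos hpos
    rcases hz with hz | hz
    · exact Or.inr (key _ hz.2)
    · exact Or.inl (key _ hz.1)
  · exact ⟨abs_lt.1 ((Complex.abs_re_le_norm ρ).trans_lt hρ),
      abs_lt.1 ((Complex.abs_im_le_norm ρ).trans_lt hρ)⟩

/-- The function `m(ρ) D(ρ²)` is `s(ρ)` up to a relative error `O(1/ρ)`. -/
def IsSineType (m s D : ℂ → ℂ) : Prop :=
  ∃ K : ℝ, 0 ≤ K ∧ ∀ ρ : ℂ, ρ ≠ 0 → 2 * K ≤ ‖ρ‖ →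
    ‖m ρ * D (ρ ^ 2) - s ρ‖ ≤ 2 * K / ‖ρ‖ * Real.exp (|ρ.im| * Real.pi)

section SineType

variable {m s D D' : ℂ → ℂ}

/-- Beyond 16K the error is at most 1/8 of the exponential, giving the factors 1 + 1/8 ≤ 2 and 1/4 -
1/8; the summand 1 keeps the radius positive. -/
lemma IsSineType.exists_bounds (h : IsSineType m s D)
    (hs : ∀ ρ, ‖s ρ‖ ≤ Real.exp (|ρ.im| * Real.pi)) :
    ∃ R : ℝ, 0 < R ∧ ∀ ρ : ℂ, R ≤ ‖ρ‖ →
      ‖m ρ * D (ρ ^ 2)‖ ≤ 2 * Real.exp (|ρ.im| * Real.pi) ∧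
      (Real.exp (|ρ.im| * Real.pi) / 4 ≤ ‖s ρ‖ →
        Real.exp (|ρ.im| * Real.pi) / 8 ≤ ‖m ρ * D (ρ ^ 2)‖) := by
  obtain ⟨K, hK, h⟩ := h
  refine ⟨16 * K + 1, by positivity, fun ρ hρ => ?_⟩
  have hρ' : 0 < ‖ρ‖ := by linarith
  have h1 := h ρ (norm_pos_iff.1 hρ') (by linarith)
  have hE := Real.exp_pos (|ρ.im| * Real.pi)
  have h2 : 2 * K / ‖ρ‖ * Real.exp (|ρ.im| * Real.pi) ≤ 1 / 8 * Real.exp (|ρ.im| * Real.pi) := by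
    refine mul_le_mul_of_nonneg_right ?_ hE.le
    rw [div_le_div_iff₀ hρ' (by norm_num)]; linarith
  have h3 := norm_sub_norm_le (m ρ * D (ρ ^ 2)) (s ρ)
  have h4 := norm_sub_norm_le (s ρ) (m ρ * D (ρ ^ 2))
  rw [norm_sub_rev] at h4
  exact ⟨by linarith [hs ρ], fun h5 => by linarith⟩

/-- A function of sine type is determined by its zeros and their multiplicities. -/
lemma eq_of_isSineType (hD : Differentiable ℂ D) (hD' : Differentiable ℂ D')
    (h : IsSineType m s D) (h' : IsSineType m s D')
    (hs : ∀ ρ, ‖s ρ‖ ≤ Real.exp (|ρ.im| * Real.pi))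
    (hsi : ∀ ρ : ℂ, 1 ≤ |ρ.im| → Real.exp (|ρ.im| * Real.pi) / 4 ≤ ‖s ρ‖) {a : ℕ → ℝ}
    (ha : Tendsto a atTop atTop)
    (hsr : ∀ (n : ℕ) (ρ : ℂ), |ρ.re| = a n → Real.exp (|ρ.im| * Real.pi) / 4 ≤ ‖s ρ‖)
    (hord : ∀ z, analyticOrderAt D z = analyticOrderAt D' z) : D = D' := by
  obtain ⟨R, hR, hb⟩ := h.exists_bounds hs
  obtain ⟨R', hR', hb'⟩ := h'.exists_bounds hs
  -- The division needs a divisor that is not identically zero; a point far up the imaginary axis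
  -- shows this.
  have hne : ∃ z, D' z ≠ 0 := by
    set t : ℝ := max 1 R' with ht
    have ht1 : 1 ≤ t := le_max_left _ _
    have htn : ‖(t : ℂ) * Complex.I‖ = t := by
      rw [norm_mul, Complex.norm_I, mul_one, Complex.norm_real, Real.norm_of_nonneg (by linarith)]
    have hti : |((t : ℂ) * Complex.I).im| = t := by
      simpa using (by linarith : (0 : ℝ) ≤ t)
    refine ⟨((t : ℂ) * Complex.I) ^ 2, fun h0 => ?_⟩
    have h1 := (hb' ((t : ℂ) * Complex.I) (by rw [htn]; exact le_max_right _ _)).2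
      (hsi _ (by rw [hti]; exact ht1))
    rw [h0, mul_zero, norm_zero] at h1
    linarith [Real.exp_pos (|((t : ℂ) * Complex.I).im| * Real.pi)]
  obtain ⟨F, hF, hFD⟩ := exists_entire_quotient hD hD' hne hord
  -- The squares live in the ρ-plane: vertical sides use the lines adapted to s, horizontal sides
  -- use |Im ρ| ≥ 1. The constant is 2 divided by 1/8.
  have hconst := eq_of_bounded_on_squares (G := fun ρ => F (ρ ^ 2)) (C := 16)
    (hF.comp (differentiable_id.pow 2)) ha (by
      filter_upwards [ha.eventually_ge_atTop (max 1 (max R R'))] with n hn ρ hρ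
      have ha1 : 1 ≤ a n := (le_max_left _ _).trans hn
      have haR : R ≤ a n := ((le_max_left _ _).trans (le_max_right _ _)).trans hn
      have haR' : R' ≤ a n := ((le_max_right _ _).trans (le_max_right _ _)).trans hn
      have hnorm : a n ≤ ‖ρ‖ := by
        rcases hρ with hρ | hρ <;> rw [← hρ]
        · exact Complex.abs_re_le_norm ρ
        · exact Complex.abs_im_le_norm ρ
      have hlow : Real.exp (|ρ.im| * Real.pi) / 4 ≤ ‖s ρ‖ := by
        rcases hρ with hρ | hρ
        · exact hsr n ρ hρ
        · exact hsi ρ (by rw [hρ]; exact ha1)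
      have h1 := (hb ρ (haR.trans hnorm)).1
      have h2 := (hb' ρ (haR'.trans hnorm)).2 hlow
      have hE := Real.exp_pos (|ρ.im| * Real.pi)
      rw [hFD, mul_left_comm, norm_mul] at h1
      by_contra hcon
      rw [not_le] at hcon
      have h3 : 16 * (Real.exp (|ρ.im| * Real.pi) / 8) <
          ‖F (ρ ^ 2)‖ * ‖m ρ * D' (ρ ^ 2)‖ := by
        calc _ < ‖F (ρ ^ 2)‖ * (Real.exp (|ρ.im| * Real.pi) / 8) := by gcongr
          _ ≤ _ := by gcongr
      linarith)
  set c := F (0 ^ 2) with hc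
  have hFc : ∀ ρ : ℂ, D (ρ ^ 2) = c * D' (ρ ^ 2) := fun ρ => by
    rw [hFD, hc]; congr 1; exact hconst ρ 0
  -- On the imaginary axis (1 - c)s is a combination of the two errors. It is O(1/t) relative to the
  -- exponential, whereas s is at least a quarter of it.
  have hc1 : c = 1 := by
    obtain ⟨K, hK, hKb⟩ := h
    obtain ⟨K', hK', hKb'⟩ := h'
    have key : ∀ᶠ t : ℝ in atTop, ‖1 - c‖ / 4 ≤ (2 * K + ‖c‖ * (2 * K')) / t := by
      filter_upwards [eventually_ge_atTop 1, eventually_ge_atTop (2 * K),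
        eventually_ge_atTop (2 * K')] with t ht htK htK'
      set ρ : ℂ := (t : ℂ) * Complex.I with hρ
      have htn : ‖ρ‖ = t := by
        rw [norm_mul, Complex.norm_I, mul_one, Complex.norm_real,
          Real.norm_of_nonneg (by linarith)]
      have hti : |ρ.im| = t := by simpa [hρ] using (by linarith : (0 : ℝ) ≤ t)
      have ht0 : 0 < t := by linarith
      have hρ0 : ρ ≠ 0 := norm_pos_iff.1 (by linarith)
      have h1 := hKb ρ hρ0 (by rw [htn]; exact htK)
      have h2 := hKb' ρ hρ0 (by rw [htn]; exact htK')
      have h3 := hsi ρ (by rw [hti]; exact ht)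
      rw [htn, hti] at h1 h2
      rw [hti] at h3
      have hE := Real.exp_pos (t * Real.pi)
      have e1 : (1 - c) * s ρ = c * (m ρ * D' (ρ ^ 2) - s ρ) - (m ρ * D (ρ ^ 2) - s ρ) := by
        rw [hFc]; ring
      have h4 : ‖1 - c‖ * (Real.exp (t * Real.pi) / 4) ≤
          ‖c‖ * (2 * K' / t * Real.exp (t * Real.pi)) + 2 * K / t * Real.exp (t * Real.pi) := by
        calc _ ≤ ‖1 - c‖ * ‖s ρ‖ := by gcongr
          _ = ‖c * (m ρ * D' (ρ ^ 2) - s ρ) - (m ρ * D (ρ ^ 2) - s ρ)‖ := by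
              rw [← norm_mul, e1]
          _ ≤ _ := by
              refine (norm_sub_le _ _).trans (add_le_add ?_ h1)
              rw [norm_mul]; gcongr
      refine le_of_mul_le_mul_right ?_ hE
      calc _ = ‖1 - c‖ * (Real.exp (t * Real.pi) / 4) := by ring
        _ ≤ _ := h4
        _ = _ := by ring
    have hlim : Tendsto (fun t : ℝ => (2 * K + ‖c‖ * (2 * K')) / t) atTop (𝓝 0) :=
      tendsto_const_nhds.div_atTop tendsto_id
    have h5 := ge_of_tendsto hlim key
    have h6 : ‖1 - c‖ = 0 := le_antisymm (by linarith) (norm_nonneg _)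
    exact (sub_eq_zero.1 (norm_eq_zero.1 h6)).symm
  ext z
  -- The equality is known only at squares, which is every complex number.
  obtain ⟨ρ, hρ⟩ := IsAlgClosed.exists_pow_nat_eq z two_pos
  rw [← hρ, hFc, hc1, one_mul]

end SineType

lemma exp_abs_div_four_le_cosh (v : ℝ) : Real.exp |v| / 4 ≤ Real.cosh v := by
  rw [← Real.cosh_abs, Real.cosh_eq]
  have := Real.exp_pos |v|
  have := Real.exp_pos (-|v|)
  linarith

lemma norm_sin_of_cos_re {z : ℂ} (h : Real.cos z.re = 0) : ‖Complex.sin z‖ = Real.cosh z.im := by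
  have h1 : |Real.sin z.re| = 1 := by
    have := Real.sin_sq_add_cos_sq z.re
    rw [h] at this
    refine (pow_eq_one_iff_of_nonneg (abs_nonneg _) two_ne_zero).1 ?_
    rw [sq_abs]
    linarith
  rw [Complex.sin_eq, ← Complex.ofReal_cos, h, ← Complex.ofReal_sin, ← Complex.ofReal_cosh]
  simp only [Complex.ofReal_zero, zero_mul, add_zero]
  rw [← Complex.ofReal_mul, Complex.norm_real, Real.norm_eq_abs, abs_mul, h1, one_mul,
    abs_of_pos (Real.cosh_pos _)]

lemma norm_cos_of_sin_re {z : ℂ} (h : Real.sin z.re = 0) : ‖Complex.cos z‖ = Real.cosh z.im := by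
  have h1 : |Real.cos z.re| = 1 := by
    have := Real.sin_sq_add_cos_sq z.re
    rw [h] at this
    refine (pow_eq_one_iff_of_nonneg (abs_nonneg _) two_ne_zero).1 ?_
    rw [sq_abs]
    linarith
  rw [Complex.cos_eq, ← Complex.ofReal_sin, h, ← Complex.ofReal_cos, ← Complex.ofReal_cosh]
  simp only [Complex.ofReal_zero, zero_mul, sub_zero]
  rw [← Complex.ofReal_mul, Complex.norm_real, Real.norm_eq_abs, abs_mul, h1, one_mul,
    abs_of_pos (Real.cosh_pos _)]

/-- Midway between the real zeros, cos(π Re ρ) = 0 and the modulus of the sine is exactly cosh(π Im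
ρ). For the cosine the integers play this role. -/
lemma le_norm_sin_of_re {n : ℕ} (h : |ρ.re| = n + 1 / 2) :
    Real.exp (|ρ.im| * Real.pi) / 4 ≤ ‖Complex.sin (ρ * Real.pi)‖ := by
  have h1 : Real.cos (ρ * Real.pi : ℂ).re = 0 := by
    rw [Complex.re_mul_ofReal, ← Real.cos_abs, abs_mul, h, abs_of_pos Real.pi_pos]
    rw [Real.cos_eq_zero_iff]
    exact ⟨n, by push_cast; ring⟩
  rw [norm_sin_of_cos_re h1, ← abs_im_mul_pi]
  exact exp_abs_div_four_le_cosh _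

lemma le_norm_cos_of_re {n : ℕ} (h : |ρ.re| = n) :
    Real.exp (|ρ.im| * Real.pi) / 4 ≤ ‖Complex.cos (ρ * Real.pi)‖ := by
  have h1 : Real.sin (ρ * Real.pi : ℂ).re = 0 := by
    rw [Complex.re_mul_ofReal]
    rcases abs_eq (Nat.cast_nonneg n) |>.1 h with h | h <;> rw [h]
    · exact Real.sin_nat_mul_pi n
    · rw [neg_mul, Real.sin_neg, Real.sin_nat_mul_pi, neg_zero]
  rw [norm_cos_of_sin_re h1, ← abs_im_mul_pi]
  exact exp_abs_div_four_le_cosh _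

/-- The spectrum of `L₁` determines the characteristic function. -/
lemma Delta1_eq_of_spectrum1_eq (hM : IntegrableOn (fun p : ℝ × ℝ => M p.1 p.2) triangle)
    (hq : ContinuousOn q (Icc 0 Real.pi)) (hq' : ContinuousOn q' (Icc 0 Real.pi))
    (h : ∀ lam, spectrum1 M q lam = spectrum1 M q' lam) : Delta1 M q = Delta1 M q' :=
  eq_of_isSineType (m := fun ρ => ρ) (s := fun ρ => Complex.sin (ρ * Real.pi))
    (differentiable_Delta1 hM hq) (differentiable_Delta1 hM hq')
    ⟨_, totalMass_nonneg, fun _ hρ hK => norm_solS_sub_le hM hq hρ hK pi_mem_Icc_pi⟩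
    ⟨_, totalMass_nonneg, fun _ hρ hK => norm_solS_sub_le hM hq' hρ hK pi_mem_Icc_pi⟩
    (fun ρ => norm_sin_mul_le ρ Real.pi_pos.le) (fun _ hρ => le_norm_sin_mul_pi hρ)
    (tendsto_atTop_add_const_right atTop (1 / 2 : ℝ) tendsto_natCast_atTop_atTop)
    (fun _ _ hρ => le_norm_sin_of_re hρ) h

/-- The spectrum of `L₂` determines the characteristic function. -/
lemma Delta2_eq_of_spectrum2_eq (hM : IntegrableOn (fun p : ℝ × ℝ => M p.1 p.2) triangle)
    (hq : ContinuousOn q (Icc 0 Real.pi)) (hq' : ContinuousOn q' (Icc 0 Real.pi))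
    (h : ∀ lam, spectrum2 M q lam = spectrum2 M q' lam) : Delta2 M q = Delta2 M q' :=
  eq_of_isSineType (m := fun _ => 1) (s := fun ρ => Complex.cos (ρ * Real.pi))
    (differentiable_Delta2 hM hq) (differentiable_Delta2 hM hq')
    ⟨_, totalMass_nonneg, fun _ hρ hK => by
      rw [one_mul]; exact norm_solC_sub_le hM hq hρ hK pi_mem_Icc_pi⟩
    ⟨_, totalMass_nonneg, fun _ hρ hK => by
      rw [one_mul]; exact norm_solC_sub_le hM hq' hρ hK pi_mem_Icc_pi⟩
    (fun ρ => norm_cos_mul_le ρ Real.pi_pos.le) (fun _ hρ => le_norm_cos_mul_pi hρ)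
    tendsto_natCast_atTop_atTop (fun _ _ hρ => le_norm_cos_of_re hρ) h

end IntegroDiff
-- Taylor series, uniqueness and the reconstruction algorithm.
namespace IntegroDiff

variable {M : ℝ → ℝ → ℂ} {q q' g : ℝ → ℂ} {δ : ℝ}

lemma eventually_Delta1_ne_zero (hM : IntegrableOn (fun p : ℝ × ℝ => M p.1 p.2) triangle)
    (hq : ContinuousOn q (Icc 0 Real.pi)) (hδ : δ ∈ Ioo (0 : ℝ) (Real.pi / 2)) :
    ∀ᶠ ρ in sectorInfty δ, Delta1 M q (ρ ^ 2) ≠ 0 := by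
  filter_upwards [(tendsto_im_sectorInfty hδ).eventually_ge_atTop 1,
    (tendsto_norm_sectorInfty δ).eventually_ge_atTop (16 * totalMass M q)] with ρ h1 h2
  exact Delta1_ne_zero hM hq h1 h2

section Taylor

lemma exists_hasFPowerSeriesAt_coeff (hq : AnalyticAt ℝ q 0) :
    ∃ p : FormalMultilinearSeries ℝ ℝ ℂ, HasFPowerSeriesAt q p 0 ∧
      ∀ n, p.coeff n = iteratedDeriv n q 0 / n.factorial := by
  obtain ⟨p, r, hp⟩ := hq
  refine ⟨p, ⟨r, hp⟩, fun n => ?_⟩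
  have h : n.factorial • p.coeff n = iteratedDeriv n q 0 := hp.factorial_smul 1 n
  rw [eq_div_iff (Nat.cast_ne_zero.2 n.factorial_ne_zero), ← h, nsmul_eq_mul, mul_comm]

/-- Cauchy–Hadamard. -/
lemma taylorRadius_eq_radius {p : FormalMultilinearSeries ℝ ℝ ℂ} {c : ℕ → ℂ}
    (hp : ∀ n, p.coeff n = c n / n.factorial) : taylorRadius c = p.radius := by
  rw [← inv_inv p.radius, FormalMultilinearSeries.radius_inv_eq_limsup, taylorRadius]
  congr 2
  ext n
  have h : ‖c n‖ / n.factorial = ((‖p n‖₊ : NNReal) : ℝ) := by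
    rw [coe_nnnorm, FormalMultilinearSeries.norm_apply_eq_norm_coef, hp, norm_div,
      Complex.norm_natCast]
  rw [h, ← NNReal.coe_rpow, ENNReal.ofReal_coe_nnreal]

lemma taylorRadius_pos (hq : AnalyticAt ℝ q 0) :
    0 < taylorRadius fun k => iteratedDeriv k q 0 := by
  obtain ⟨p, hp, hc⟩ := exists_hasFPowerSeriesAt_coeff hq
  rw [taylorRadius_eq_radius hc]
  exact hp.radius_pos

/-- A local expansion gives equality with the sum only near 0. The identity theorem on [0, x], where
both q and the sum are analytic, extends it to every x inside the radius. -/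
lemma isTaylorSum_iteratedDeriv (hq : AnalyticOnNhd ℝ q (Icc 0 Real.pi)) :
    IsTaylorSum (fun k => iteratedDeriv k q 0) q := by
  intro x hx hxp hxr
  obtain ⟨p, hp, hc⟩ := exists_hasFPowerSeriesAt_coeff (hq 0 zero_mem_Icc_pi)
  rw [taylorRadius_eq_radius hc] at hxr
  have hs := p.hasFPowerSeriesOnBall hp.radius_pos
  have hmem : ∀ t ∈ Icc 0 x, t ∈ Metric.eball (0 : ℝ) p.radius := fun t ht => by
    rw [Metric.mem_eball, edist_dist, Real.dist_eq, sub_zero, abs_of_nonneg ht.1]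
    exact (ENNReal.ofReal_le_ofReal ht.2).trans_lt hxr
  have h0 : q =ᶠ[𝓝 0] p.sum := by
    filter_upwards [hp.eventually_hasSum, hs.hasFPowerSeriesAt.eventually_hasSum] with t h1 h2
    simp only [zero_add] at h1 h2
    exact h1.unique h2
  have heq : EqOn q p.sum (Icc 0 x) :=
    AnalyticOnNhd.eqOn_of_preconnected_of_eventuallyEq
      (hq.mono (Icc_subset_Icc_right hxp)) (fun t ht => hs.analyticAt_of_mem (hmem t ht))
      isPreconnected_Icc (left_mem_Icc.2 hx.le) h0
  have h1 := hs.hasSum (hmem x (right_mem_Icc.2 hx.le))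
  rw [zero_add, ← heq (right_mem_Icc.2 hx.le)] at h1
  have e : (fun k : ℕ => iteratedDeriv k q 0 * (x : ℂ) ^ k / (k.factorial : ℂ)) =
      fun n => p n fun _ => x := by
    funext n
    rw [FormalMultilinearSeries.apply_eq_pow_smul_coeff, hc, Complex.real_smul]
    push_cast
    ring
  rw [← e] at h1
  exact h1

lemma eqOn_of_isTaylorSum {c : ℕ → ℂ} (hc : 0 < taylorRadius c)
    (hq : AnalyticOnNhd ℝ q (Icc 0 Real.pi)) (hg : AnalyticOnNhd ℝ g (Icc 0 Real.pi))
    (h : IsTaylorSum c q) (h' : IsTaylorSum c g) : EqOn g q (Icc 0 Real.pi) := by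
  obtain ⟨r, hr0, hr⟩ := ENNReal.lt_iff_exists_nnreal_btwn.1 hc
  have hr0' : (0 : ℝ) < r := by exact_mod_cast hr0
  set b := min (r : ℝ) Real.pi with hb
  have hb0 : 0 < b := lt_min hr0' Real.pi_pos
  have hbpi : b ≤ Real.pi := min_le_right _ _
  -- The sum controls the functions only to the right of 0, so the identity theorem is started at an
  -- interior point.
  have h1 : g =ᶠ[𝓝 (b / 2)] q := by
    filter_upwards [Ioo_mem_nhds (half_pos hb0) (half_lt_self hb0)] with x hx
    have hx1 : x ≤ Real.pi := hx.2.le.trans hbpi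
    have hx2 : ENNReal.ofReal x < taylorRadius c := by
      refine lt_of_le_of_lt ?_ hr
      rw [← ENNReal.ofReal_coe_nnreal]
      exact ENNReal.ofReal_le_ofReal (hx.2.le.trans (min_le_left _ _))
    exact (h' x hx.1 hx1 hx2).unique (h x hx.1 hx1 hx2)
  exact hg.eqOn_of_preconnected_of_eventuallyEq hq isPreconnected_Icc
    ⟨(half_pos hb0).le, (half_lt_self hb0).le.trans hbpi⟩ h1

lemma eqOn_of_iteratedDeriv_eq (hq : AnalyticOnNhd ℝ q (Icc 0 Real.pi))
    (hq' : AnalyticOnNhd ℝ q' (Icc 0 Real.pi))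
    (h : ∀ k, iteratedDeriv k q 0 = iteratedDeriv k q' 0) : EqOn q q' (Icc 0 Real.pi) := by
  have h1 := isTaylorSum_iteratedDeriv hq'
  simp_rw [← h] at h1
  exact (eqOn_of_isTaylorSum (taylorRadius_pos (hq 0 zero_mem_Icc_pi)) hq hq'
    (isTaylorSum_iteratedDeriv hq) h1).symm

lemma hasDerivAt_ofReal_pow (j : ℕ) (x : ℝ) :
    HasDerivAt (fun x : ℝ => (x : ℂ) ^ j) (j * (x : ℂ) ^ (j - 1)) x :=
  (hasDerivAt_pow j (x : ℂ)).comp_ofReal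

lemma contDiff_ofReal_pow {n : WithTop ℕ∞} (j : ℕ) : ContDiff ℝ n fun x : ℝ => (x : ℂ) ^ j :=
  Complex.ofRealCLM.contDiff.pow j

lemma iteratedDeriv_ofReal_pow_zero (i j : ℕ) :
    iteratedDeriv i (fun x : ℝ => (x : ℂ) ^ j) 0 = if i = j then (j.factorial : ℂ) else 0 := by
  induction i generalizing j with
  | zero =>
    rw [iteratedDeriv_zero]
    rcases j with _ | j <;> simp
  | succ i ih =>
    rw [iteratedDeriv_succ']
    have h : deriv (fun x : ℝ => (x : ℂ) ^ j) = fun x : ℝ => (j : ℂ) * (x : ℂ) ^ (j - 1) := by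
      ext x; exact (hasDerivAt_ofReal_pow j x).deriv
    rw [h, iteratedDeriv_const_mul _ (contDiff_ofReal_pow _).contDiffAt, ih]
    rcases j with _ | j
    -- For j = 0 the truncated exponent j - 1 is harmless, because the factor j vanishes.
    · simp
    · simp only [Nat.add_sub_cancel, add_left_inj, Nat.factorial_succ]
      split_ifs <;> push_cast <;> ring

/-- The polynomial with prescribed derivatives at `0` of order less than `k`. -/
noncomputable def taylorPolynomial (c : ℕ → ℂ) (k : ℕ) (x : ℝ) : ℂ :=
  ∑ j ∈ Finset.range k, c j / j.factorial * (x : ℂ) ^ j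

lemma analyticOnNhd_taylorPolynomial (c : ℕ → ℂ) (k : ℕ) (s : Set ℝ) :
    AnalyticOnNhd ℝ (taylorPolynomial c k) s := by
  have h : taylorPolynomial c k =
      fun x : ℝ => ∑ j ∈ Finset.range k, c j / j.factorial * (x : ℂ) ^ j := rfl
  rw [h]
  exact Finset.analyticOnNhd_fun_sum _ fun j _ x _ =>
    analyticAt_const.mul ((Complex.ofRealCLM.analyticAt x).pow j)

lemma iteratedDeriv_taylorPolynomial (c : ℕ → ℂ) {k i : ℕ} (hi : i < k) :
    iteratedDeriv i (taylorPolynomial c k) 0 = c i := by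
  have h : taylorPolynomial c k =
      fun x : ℝ => ∑ j ∈ Finset.range k, c j / j.factorial * (x : ℂ) ^ j := rfl
  rw [h, iteratedDeriv_fun_sum fun j _ => (contDiff_const.mul (contDiff_ofReal_pow j)).contDiffAt]
  rw [Finset.sum_congr rfl fun j _ => by
    rw [iteratedDeriv_const_mul _ (contDiff_ofReal_pow j).contDiffAt,
      iteratedDeriv_ofReal_pow_zero]]
  rw [Finset.sum_eq_single_of_mem i (Finset.mem_range.2 hi) fun j _ hj => by
    rw [if_neg hj.symm, mul_zero], if_pos rfl]
  exact div_mul_cancel₀ _ (Nat.cast_ne_zero.2 i.factorial_ne_zero)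

end Taylor

/-- The Weyl-type function determines the potential. -/
lemma eqOn_of_weylN_eq (hM : IntegrableOn (fun p : ℝ × ℝ => M p.1 p.2) triangle)
    (hq : AnalyticOnNhd ℝ q (Icc 0 Real.pi)) (hq' : AnalyticOnNhd ℝ q' (Icc 0 Real.pi))
    (h : ∀ lam : ℂ, Delta1 M q lam ≠ 0 → Delta1 M q' lam ≠ 0 → weylN M q lam = weylN M q' lam) :
    EqOn q q' (Icc 0 Real.pi) := by
  have hδ : Real.pi / 4 ∈ Ioo (0 : ℝ) (Real.pi / 2) := by
    constructor <;> linarith [Real.pi_pos]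
  have := sectorInfty_neBot hδ
  refine eqOn_of_iteratedDeriv_eq hq hq' fun k => ?_
  induction k using Nat.strong_induction_on with
  | _ k ih =>
    have h1 := tendsto_weylN_sub hM hq hq' hδ k fun j hj => (ih j hj).symm
    -- Equality of the Weyl-type functions is assumed only off the zeros of both Δ₁; far out in the
    -- sector there are none, so the expression is eventually 0.
    have h2 : Tendsto (fun ρ : ℂ => -((-2 * Complex.I * ρ) ^ (k + 1) *
        (weylN M q (ρ ^ 2) - weylN M q' (ρ ^ 2)))) (sectorInfty (Real.pi / 4)) (𝓝 0) := by
      refine tendsto_const_nhds.congr' ?_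
      filter_upwards [eventually_Delta1_ne_zero hM hq.continuousOn hδ,
        eventually_Delta1_ne_zero hM hq'.continuousOn hδ] with ρ h3 h4
      rw [h _ h3 h4, sub_self, mul_zero, neg_zero]
    exact sub_eq_zero.1 (tendsto_nhds_unique h1 h2)

/-- The algorithm can be run with polynomial models. -/
lemma isRun_taylorPolynomial (hM : IntegrableOn (fun p : ℝ × ℝ => M p.1 p.2) triangle)
    (hq : AnalyticOnNhd ℝ q (Icc 0 Real.pi)) (hδ : δ ∈ Ioo (0 : ℝ) (Real.pi / 2)) :
    IsRun M (weylN M q) δ (taylorPolynomial fun k => iteratedDeriv k q 0)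
      fun k => iteratedDeriv k q 0 where
  analytic k := analyticOnNhd_taylorPolynomial _ k _
  agree _ _ hj := iteratedDeriv_taylorPolynomial _ hj
  step k := tendsto_weylN_sub hM hq (analyticOnNhd_taylorPolynomial _ k _) hδ k
    fun _ hj => iteratedDeriv_taylorPolynomial _ hj

/-- Every run of the algorithm computes the derivatives of the potential at `0`. -/
lemma IsRun.eq_iteratedDeriv (hM : IntegrableOn (fun p : ℝ × ℝ => M p.1 p.2) triangle)
    (hq : AnalyticOnNhd ℝ q (Icc 0 Real.pi)) (hδ : δ ∈ Ioo (0 : ℝ) (Real.pi / 2))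
    {m : ℕ → ℝ → ℂ} {c : ℕ → ℂ} (h : IsRun M (weylN M q) δ m c) (k : ℕ) :
    c k = iteratedDeriv k q 0 := by
  have := sectorInfty_neBot hδ
  induction k using Nat.strong_induction_on with
  | _ k ih =>
    have h1 := tendsto_weylN_sub hM hq (h.analytic k) hδ k fun j hj =>
      (h.agree k j hj).trans (ih j hj)
    exact sub_left_injective (tendsto_nhds_unique (h.step k) h1)

end IntegroDiff


/-! ### Assembly of the theorem. -/

open IntegroDiff in
theorem mainTheorem2 (M : ℝ → ℝ → ℂ)
    (hM : IntegrableOn (fun p : ℝ × ℝ => M p.1 p.2) triangle) :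
    -- the objects are well defined: `C`, `S`, the entire functions `Δ₁`, `Δ₂`, the eigenvalues, `N`
    (∀ q : ℝ → ℂ, AnalyticOnNhd ℝ q (Icc 0 Real.pi) →
      (∀ lam : ℂ,
        (IsSolution M q lam (solC M q lam) ∧ solC M q lam 0 = 1 ∧ der (solC M q lam) 0 = 0) ∧
        (IsSolution M q lam (solS M q lam) ∧ solS M q lam 0 = 0 ∧ der (solS M q lam) 0 = 1) ∧
        (∀ y, IsSolution M q lam y →
          ∀ x ∈ Icc (0 : ℝ) Real.pi, y x = y 0 * solC M q lam x + der y 0 * solS M q lam x) ∧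
        (IsEigenvalue1 M q lam ↔ Delta1 M q lam = 0) ∧
        (IsEigenvalue2 M q lam ↔ Delta2 M q lam = 0) ∧
        (Delta1 M q lam ≠ 0 →
          (∃ y, IsSolution M q lam y ∧ y 0 = 1 ∧ y Real.pi = 0) ∧
          ∀ y, IsSolution M q lam y → y 0 = 1 → y Real.pi = 0 → der y 0 = weylN M q lam)) ∧
      Differentiable ℂ (Delta1 M q) ∧ Differentiable ℂ (Delta2 M q) ∧
      (∀ δ ∈ Ioo (0 : ℝ) (Real.pi / 2), ∀ᶠ ρ in sectorInfty δ, Delta1 M q (ρ ^ 2) ≠ 0)) ∧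
    -- uniqueness: `N` determines `q`, and the two spectra determine `q`
    (∀ q q' : ℝ → ℂ, AnalyticOnNhd ℝ q (Icc 0 Real.pi) → AnalyticOnNhd ℝ q' (Icc 0 Real.pi) →
      ((∀ lam : ℂ, Delta1 M q lam ≠ 0 → Delta1 M q' lam ≠ 0 → weylN M q lam = weylN M q' lam) ↔
        EqOn q q' (Icc 0 Real.pi)) ∧
      ((∀ lam : ℂ, spectrum1 M q lam = spectrum1 M q' lam ∧
          spectrum2 M q lam = spectrum2 M q' lam) ↔
        EqOn q q' (Icc 0 Real.pi))) ∧
    -- reconstruction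
    (∀ q : ℝ → ℂ, AnalyticOnNhd ℝ q (Icc 0 Real.pi) → ∀ δ ∈ Ioo (0 : ℝ) (Real.pi / 2),
      -- the formula for the next Taylor coefficient, with an arbitrary model potential
      (∀ (k : ℕ) (q' : ℝ → ℂ), AnalyticOnNhd ℝ q' (Icc 0 Real.pi) →
        (∀ j < k, iteratedDeriv j q' 0 = iteratedDeriv j q 0) →
        Tendsto
          (fun ρ : ℂ => -((-2 * Complex.I * ρ) ^ (k + 1) *
            (weylN M q (ρ ^ 2) - weylN M q' (ρ ^ 2))))
          (sectorInfty δ) (𝓝 (iteratedDeriv k q 0 - iteratedDeriv k q' 0))) ∧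
      -- step (i) can be carried out, and every run yields the Taylor coefficients of `q`;
      -- step (ii) then yields `q` on the whole of `[0, π]`
      (∃ m c, IsRun M (weylN M q) δ m c) ∧
      (∀ m c, IsRun M (weylN M q) δ m c →
        (∀ k, c k = iteratedDeriv k q 0) ∧
        0 < taylorRadius c ∧
        IsTaylorSum c q ∧
        (∀ g : ℝ → ℂ, AnalyticOnNhd ℝ g (Icc 0 Real.pi) → IsTaylorSum c g →
          EqOn g q (Icc 0 Real.pi)))) := by
  refine ⟨fun q hq => ⟨fun lam => ?_, ?_, ?_, fun δ hδ => ?_⟩, fun q q' hq hq' => ⟨⟨?_, ?_⟩, ?_, ?_⟩,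
    fun q hq δ hδ => ⟨fun k q' hq' hj => ?_, ?_, fun m c hrun => ?_⟩⟩
  · have cq := hq.continuousOn
    exact ⟨isSolution_solC hM cq lam, isSolution_solS hM cq lam,
      fun y hy x hx => hy.eq_combination hM cq hx, isEigenvalue1_iff hM cq lam,
      isEigenvalue2_iff hM cq lam, fun hD => ⟨exists_weylSolution hM cq hD,
        fun y hy h0 hp => hy.der_eq_weylN hM cq hD h0 hp⟩⟩
  · exact differentiable_Delta1 hM hq.continuousOn
  · exact differentiable_Delta2 hM hq.continuousOn
  · exact eventually_Delta1_ne_zero hM hq.continuousOn hδ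
  · exact eqOn_of_weylN_eq hM hq hq'
  · intro h lam _ _
    simp only [weylN, Delta1, Delta2, solC, solS, cauchySol_congr h]
  · intro h
    -- The two spectra give both characteristic functions, hence their quotient, which reduces the
    -- claim to the first uniqueness statement.
    have h1 := Delta1_eq_of_spectrum1_eq hM hq.continuousOn hq'.continuousOn fun lam => (h lam).1
    have h2 := Delta2_eq_of_spectrum2_eq hM hq.continuousOn hq'.continuousOn fun lam => (h lam).2
    exact eqOn_of_weylN_eq hM hq hq' fun lam _ _ => by rw [weylN, weylN, h1, h2]
  · intro h lam
    have h1 : Delta1 M q = Delta1 M q' := by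
      funext z; simp only [Delta1, solS, cauchySol_congr h]
    have h2 : Delta2 M q = Delta2 M q' := by
      funext z; simp only [Delta2, solC, cauchySol_congr h]
    rw [spectrum1, spectrum1, spectrum2, spectrum2, h1, h2]
    exact ⟨rfl, rfl⟩
  · exact tendsto_weylN_sub hM hq hq' hδ k hj
  · exact ⟨_, _, isRun_taylorPolynomial hM hq hδ⟩
  · obtain rfl : c = fun k => iteratedDeriv k q 0 :=
      funext fun k => hrun.eq_iteratedDeriv hM hq hδ k
    have hpos := taylorRadius_pos (hq 0 zero_mem_Icc_pi)
    exact ⟨fun _ => rfl, hpos, isTaylorSum_iteratedDeriv hq, fun g hg hgs =>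
      eqOn_of_isTaylorSum hpos hq hg (isTaylorSum_iteratedDeriv hq) hgs⟩
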